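/- Let $S$ be a noetherian separated integral scheme. A (line bundle-valued) quadratic form of rank $n$ on $S$ is a triple $(\mathcal E,q,\mathcal L)$ where $\mathcal E$ is a locally free $\mathcal O_S$-module of rank $n$, $\mathcal L$ is an invertible $\mathcal O_S$-module and $q:\mathcal E\to\mathcal L$ is a morphism of sheaves with $q(av)=a^2q(v)$ whose polar form $b_q(v,w)=q(v+w)-q(v)-q(w)$ is $\mathcal O_S$-bilinear. Let $\psi_q:\mathcal E\to\mathcal{H}om(\mathcal E,\mathcal L)$ be the adjoint of $b_q$. The form is generically regular if $\psi_q$ is an isomorphism at the generic point of $S$. It has simple degeneration if, for every closed point $x$ of $S$, the radical of its fibre at $x$, that is, the kernel of $\psi_q\otimes\kappa(x):\mathcal E(x)\to\mathrm{Hom}_{\kappa(x)}(\mathcal E(x),\mathcal L(x))$, has dimension at most $1$ over the residue field $\kappa(x)$. The even Clifford algebra $\mathcal C_0$ is the quotient of the tensor algebra of $\mathcal E\otimes\mathcal E\otimes\mathcal L^\vee$ by the two-sided ideal generated by the local sections $$v\otimes v\otimes\varphi-\varphi(q(v)),\qquad (u\otimes v\otimes\varphi)\otimes(v\otimes w\otimes\psi)-\varphi(q(v))\,(u\otimes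 w\otimes\psi).$$ Let $\mathcal Z$ be its center and let $f:T=\mathbf{Spec}_S\,\mathcal Z\to S$ be the discriminant cover, so that $\mathcal C_0$ corresponds to a sheaf of algebras on $T$, again denoted $\mathcal C_0$. Proposition. Let $(\mathcal E,q,\mathcal L)$ be a generically regular quadratic form of even rank on $S$. 1. If $(\mathcal E,q,\mathcal L)$ has simple degeneration or has rank $2$ (and any degeneration), then $\mathcal C_0$ is an Azumaya $\mathcal O_T$-algebra. 2. If $2$ is invertible on $S$, then $\mathcal C_0$ is an Azumaya $\mathcal O_T$-algebra if and only if $(\mathcal E,q,\mathcal L)$ has simple degeneration or has rank $2$. -/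

import Mathlib

/-! ### The even Clifford algebra of a module-valued quadratic map -/

universe u

noncomputable section

open TensorProduct

namespace QuadraticMap

section EvenClifford

variable {R M N : Type*} [CommRing R] [AddCommGroup M] [Module R M] [AddCommGroup N] [Module R N]

/-- The relations `v ⊗ v ⊗ φ = φ (Q v)` and
`(u ⊗ v ⊗ φ) (v ⊗ w ⊗ ψ) = φ (Q v) (u ⊗ w ⊗ ψ)` in the tensor algebra of `M ⊗ M ⊗ N^∨`. -/
inductive EvenCliffordRel (Q : QuadraticMap R M N) :
    TensorAlgebra R (M ⊗[R] (M ⊗[R] Module.Dual R N)) →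
      TensorAlgebra R (M ⊗[R] (M ⊗[R] Module.Dual R N)) → Prop
  | contract (v : M) (φ : Module.Dual R N) :
      EvenCliffordRel Q (TensorAlgebra.ι R (v ⊗ₜ (v ⊗ₜ φ))) (algebraMap R _ (φ (Q v)))
  | contract_mid (u v w : M) (φ ψ : Module.Dual R N) :
      EvenCliffordRel Q
        (TensorAlgebra.ι R (u ⊗ₜ (v ⊗ₜ φ)) * TensorAlgebra.ι R (v ⊗ₜ (w ⊗ₜ ψ)))
        (φ (Q v) • TensorAlgebra.ι R (u ⊗ₜ (w ⊗ₜ ψ)))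

/-- The even Clifford algebra of a quadratic map `Q : M → N` (with `N` an invertible module): the
quotient of the tensor algebra of `M ⊗ M ⊗ N^∨` by the two-sided ideal generated by
`v ⊗ v ⊗ φ - φ (Q v)` and `(u ⊗ v ⊗ φ) ⊗ (v ⊗ w ⊗ ψ) - φ (Q v) (u ⊗ w ⊗ ψ)`. -/
def EvenClifford (Q : QuadraticMap R M N) : Type _ := RingQuot (EvenCliffordRel Q)

namespace EvenClifford

variable (Q : QuadraticMap R M N)

instance : Ring (EvenClifford Q) := inferInstanceAs (Ring (RingQuot (EvenCliffordRel Q)))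

instance : Algebra R (EvenClifford Q) :=
  inferInstanceAs (Algebra R (RingQuot (EvenCliffordRel Q)))

/-- The quotient map from the tensor algebra to the even Clifford algebra. -/
def mk : TensorAlgebra R (M ⊗[R] (M ⊗[R] Module.Dual R N)) →ₐ[R] EvenClifford Q :=
  RingQuot.mkAlgHom R (EvenCliffordRel Q)

/-- The canonical linear map from `M ⊗ M ⊗ N^∨` to the even Clifford algebra. -/
def ι : M ⊗[R] (M ⊗[R] Module.Dual R N) →ₗ[R] EvenClifford Q :=
  (mk Q).toLinearMap ∘ₗ TensorAlgebra.ι R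

theorem ι_contract (v : M) (φ : Module.Dual R N) :
    ι Q (v ⊗ₜ (v ⊗ₜ φ)) = algebraMap R _ (φ (Q v)) :=
  (RingQuot.mkAlgHom_rel R (EvenCliffordRel.contract (Q := Q) v φ)).trans (AlgHom.commutes _ _)

theorem ι_contract_mid (u v w : M) (φ ψ : Module.Dual R N) :
    ι Q (u ⊗ₜ (v ⊗ₜ φ)) * ι Q (v ⊗ₜ (w ⊗ₜ ψ)) = φ (Q v) • ι Q (u ⊗ₜ (w ⊗ₜ ψ)) := by
  have h := RingQuot.mkAlgHom_rel R (EvenCliffordRel.contract_mid (Q := Q) u v w φ ψ)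
  rw [map_mul, map_smul] at h
  exact h

variable {Q}

/-- The universal property of the even Clifford algebra. -/
def lift {A : Type*} [Ring A] [Algebra R A]
    (f : M ⊗[R] (M ⊗[R] Module.Dual R N) →ₗ[R] A)
    (h₁ : ∀ v φ, f (v ⊗ₜ (v ⊗ₜ φ)) = algebraMap R A (φ (Q v)))
    (h₂ : ∀ u v w φ ψ,
      f (u ⊗ₜ (v ⊗ₜ φ)) * f (v ⊗ₜ (w ⊗ₜ ψ)) = φ (Q v) • f (u ⊗ₜ (w ⊗ₜ ψ))) :
    EvenClifford Q →ₐ[R] A :=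
  RingQuot.liftAlgHom R ⟨TensorAlgebra.lift R f, by
    rintro _ _ (⟨v, φ⟩ | ⟨u, v, w, φ, ψ⟩)
    · simp [h₁]
    · simp [h₂]⟩

@[simp]
theorem lift_ι {A : Type*} [Ring A] [Algebra R A]
    (f : M ⊗[R] (M ⊗[R] Module.Dual R N) →ₗ[R] A) (h₁) (h₂)
    (x : M ⊗[R] (M ⊗[R] Module.Dual R N)) :
    lift (Q := Q) f h₁ h₂ (ι Q x) = f x :=
  (RingQuot.liftAlgHom_mkAlgHom_apply R _ _ _).trans (TensorAlgebra.lift_ι_apply _ _)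

theorem adjoin_range_ι : Algebra.adjoin R (Set.range (ι Q)) = ⊤ := by
  have h : Set.range (ι Q) =
      mk Q '' Set.range (TensorAlgebra.ι R) := by
    rw [← Set.range_comp]; rfl
  rw [h, ← AlgHom.map_adjoin, TensorAlgebra.adjoin_range_ι, Algebra.map_top]
  exact (AlgHom.range_eq_top _).mpr (RingQuot.mkAlgHom_surjective R _)

@[elab_as_elim]
theorem induction {C : EvenClifford Q → Prop}
    (algebraMap : ∀ r, C (algebraMap R (EvenClifford Q) r))
    (ι : ∀ u v φ, C (ι Q (u ⊗ₜ (v ⊗ₜ φ))))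
    (mul : ∀ a b, C a → C b → C (a * b)) (add : ∀ a b, C a → C b → C (a + b))
    (a : EvenClifford Q) : C a := by
  have ha : a ∈ Algebra.adjoin R (Set.range (EvenClifford.ι Q)) := by
    rw [adjoin_range_ι]; trivial
  induction ha using Algebra.adjoin_induction with
  | mem x hx =>
    obtain ⟨t, rfl⟩ := hx
    have h0 : C 0 := by simpa using algebraMap 0
    induction t with
    | zero => simpa using h0
    | add x y hx hy => rw [map_add]; exact add _ _ hx hy
    | tmul u s =>
      induction s with
      | zero => simpa using h0
      | add x y hx hy => rw [tmul_add, map_add]; exact add _ _ hx hy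
      | tmul v φ => exact ι u v φ
  | algebraMap r => exact algebraMap r
  | add x y _ _ hx hy => exact add _ _ hx hy
  | mul x y _ _ hx hy => exact mul _ _ hx hy

theorem ringHom_ext {B : Type*} [Semiring B] {f g : EvenClifford Q →+* B}
    (h₁ : ∀ r, f (algebraMap R _ r) = g (algebraMap R _ r))
    (h₂ : ∀ u v φ, f (ι Q (u ⊗ₜ (v ⊗ₜ φ))) = g (ι Q (u ⊗ₜ (v ⊗ₜ φ)))) : f = g := by
  ext a
  induction a using EvenClifford.induction with
  | algebraMap r => exact h₁ r
  | ι u v φ => exact h₂ u v φ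
  | mul a b ha hb => rw [map_mul, map_mul, ha, hb]
  | add a b ha hb => rw [map_add, map_add, ha, hb]

end EvenClifford

end EvenClifford

namespace EvenClifford

section BaseChange

variable {R R' M M' N N' : Type*} [CommRing R] [CommRing R'] [Algebra R R']
  [AddCommGroup M] [Module R M] [AddCommGroup N] [Module R N]
  [AddCommGroup M'] [Module R' M'] [Module R M'] [IsScalarTower R R' M']
  [AddCommGroup N'] [Module R' N']
  {Q : QuadraticMap R M N} {Q' : QuadraticMap R' M' N'}

/-- The ring homomorphism of even Clifford algebras induced by a homomorphism of rings
`R → R'`, by a compatible map `M → M'` and by a compatible map `d` on the duals of the modules of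
values. -/
def map (f : M →ₗ[R] M') (d : Module.Dual R N →ₗ[R] Module.Dual R' N')
    (h : ∀ φ v, d φ (Q' (f v)) = algebraMap R R' (φ (Q v))) :
    EvenClifford Q →+* EvenClifford Q' :=
  letI : Algebra R (EvenClifford Q') := Algebra.compHom _ (algebraMap R R')
  haveI : IsScalarTower R R' (EvenClifford Q') := IsScalarTower.of_algebraMap_eq fun _ ↦ rfl
  (lift (A := EvenClifford Q')
    (TensorProduct.lift ((LinearMap.mk₂ R
      (fun u (t : M ⊗[R] Module.Dual R N) ↦
        ι Q' (f u ⊗ₜ TensorProduct.lift ((LinearMap.mk₂ R (fun v φ ↦ f v ⊗ₜ[R'] d φ)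
          (fun _ _ _ ↦ by rw [map_add, add_tmul])
          (fun c m n ↦ by rw [map_smul, ← algebraMap_smul R', ← smul_tmul', algebraMap_smul])
          (fun _ _ _ ↦ by rw [map_add, tmul_add])
          (fun c m n ↦ by rw [map_smul, ← algebraMap_smul R', tmul_smul, algebraMap_smul])) :
            M →ₗ[R] Module.Dual R N →ₗ[R] M' ⊗[R'] Module.Dual R' N') t))
      (fun _ _ _ ↦ by rw [map_add, add_tmul, map_add])
      (fun c m n ↦ by
        rw [map_smul, ← algebraMap_smul R', ← smul_tmul', map_smul, algebraMap_smul])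
      (fun _ _ _ ↦ by rw [map_add, tmul_add, map_add])
      (fun c m n ↦ by
        rw [map_smul, ← algebraMap_smul R', tmul_smul, map_smul, algebraMap_smul])) :
          M →ₗ[R] M ⊗[R] Module.Dual R N →ₗ[R] EvenClifford Q'))
    (fun v φ ↦ by
      simp only [TensorProduct.lift.tmul, LinearMap.mk₂_apply, ι_contract, h]; rfl)
    (fun u v w φ ψ ↦ by
      simp only [TensorProduct.lift.tmul, LinearMap.mk₂_apply, ι_contract_mid, h]
      rw [algebraMap_smul])).toRingHom

@[simp]
theorem map_algebraMap (f : M →ₗ[R] M') (d : Module.Dual R N →ₗ[R] Module.Dual R' N')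
    (h : ∀ φ v, d φ (Q' (f v)) = algebraMap R R' (φ (Q v))) (r : R) :
    map f d h (algebraMap R _ r) = algebraMap R' _ (algebraMap R R' r) :=
  let : Algebra R (EvenClifford Q') := Algebra.compHom _ (algebraMap R R')
  AlgHom.commutes (lift (Q := Q) (A := EvenClifford Q') _ _ _) r

@[simp]
theorem map_ι (f : M →ₗ[R] M') (d : Module.Dual R N →ₗ[R] Module.Dual R' N')
    (h : ∀ φ v, d φ (Q' (f v)) = algebraMap R R' (φ (Q v))) (u v : M) (φ : Module.Dual R N) :
    map f d h (ι Q (u ⊗ₜ (v ⊗ₜ φ))) = ι Q' (f u ⊗ₜ (f v ⊗ₜ d φ)) := by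
  let : Algebra R (EvenClifford Q') := Algebra.compHom _ (algebraMap R R')
  have : IsScalarTower R R' (EvenClifford Q') := IsScalarTower.of_algebraMap_eq fun _ ↦ rfl
  refine (lift_ι (Q := Q) (A := EvenClifford Q') _ _ _ _).trans ?_
  simp

end BaseChange

section Localization

variable {R R' M M' N N' : Type*} [CommRing R] [CommRing R'] [Algebra R R']
  [AddCommGroup M] [Module R M] [AddCommGroup N] [Module R N]
  [AddCommGroup M'] [Module R' M'] [Module R M'] [IsScalarTower R R' M']
  [AddCommGroup N'] [Module R' N']
  {Q : QuadraticMap R M N} {Q' : QuadraticMap R' M' N'}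
  (g : R) [IsLocalization.Away g R']
  (f : M →ₗ[R] M') [IsLocalizedModule.Away g f]
  (d : Module.Dual R N →ₗ[R] Module.Dual R' N') [IsLocalizedModule.Away g d]
  (h : ∀ φ v, d φ (Q' (f v)) = algebraMap R R' (φ (Q v)))

/-- Extension of linear maps to a base change, as a linear map. -/
def extend {X : Type*} [AddCommGroup X] [Module R' X] [Module R X] [IsScalarTower R R' X]
    {P P' : Type*} [AddCommGroup P] [Module R P] [AddCommGroup P'] [Module R' P'] [Module R P']
    [IsScalarTower R R' P'] {e : P →ₗ[R] P'} (he : IsBaseChange R' e) :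
    (P →ₗ[R] X) →ₗ[R] (P' →ₗ[R'] X) where
  toFun a := he.lift a
  map_add' a b := he.algHom_ext _ _ fun x ↦ by simp [he.lift_eq]
  map_smul' c a := he.algHom_ext _ _ fun x ↦ by simp [he.lift_eq]

theorem exists_eq_smul {X Y : Type*} [AddCommGroup X] [AddCommGroup Y] [Module R X] [Module R Y]
    [Module R' Y] [IsScalarTower R R' Y] (e : X →ₗ[R] Y) [IsLocalizedModule.Away g e] (y : Y) :
    ∃ (r : R') (x : X), y = r • e x := by
  obtain ⟨⟨x, ⟨_, n, rfl⟩⟩, hx⟩ := IsLocalizedModule.surj (.powers g) e y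
  obtain ⟨r, hr⟩ := ((IsLocalization.Away.algebraMap_isUnit (S := R') g).pow n).exists_left_inv
  refine ⟨r, x, ?_⟩
  have hx' : g ^ n • y = e x := hx
  rw [← hx', ← algebraMap_smul R' (g ^ n) y, smul_smul, map_pow, hr, one_smul]

theorem exists_smul_eq_zero_of_map_eq_zero (a : EvenClifford Q) (ha : map f d h a = 0) :
    ∃ n : ℕ, g ^ n • a = 0 := by
  have hf : IsBaseChange R' f := (isLocalizedModule_iff_isBaseChange (.powers g) R' f).mp ‹_›
  have hd' : IsBaseChange R' d := (isLocalizedModule_iff_isBaseChange (.powers g) R' d).mp ‹_›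
  let B := R' ⊗[R] EvenClifford Q
  let j : EvenClifford Q →ₐ[R] B := Algebra.TensorProduct.includeRight
  let β₀ : M →ₗ[R] M →ₗ[R] Module.Dual R N →ₗ[R] B :=
    LinearMap.mk₂ R (fun u v ↦ (j.toLinearMap ∘ₗ ι Q) ∘ₗ TensorProduct.mk R _ _ u ∘ₗ
      TensorProduct.mk R _ _ v) (fun _ _ _ ↦ by ext; simp)
      (fun _ _ _ ↦ by ext; simp) (fun _ _ _ ↦ by ext; simp [tmul_add])
      (fun _ _ _ ↦ by ext; simp)
  let β₁ : M →ₗ[R] M →ₗ[R] Module.Dual R' N' →ₗ[R'] B := β₀.compr₂ (extend hd')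
  let β₂ : M →ₗ[R] M' →ₗ[R'] Module.Dual R' N' →ₗ[R'] B :=
    extend (X := Module.Dual R' N' →ₗ[R'] B) hf ∘ₗ β₁
  let β : M' →ₗ[R'] M' →ₗ[R'] Module.Dual R' N' →ₗ[R'] B :=
    extend (X := M' →ₗ[R'] Module.Dual R' N' →ₗ[R'] B) hf β₂
  have hβ (u v φ) : β (f u) (f v) (d φ) = j (ι Q (u ⊗ₜ (v ⊗ₜ φ))) := by
    simp [β, β₂, β₁, β₀, extend, hf.lift_eq, hd'.lift_eq]
  let F : M' ⊗[R'] (M' ⊗[R'] Module.Dual R' N') →ₗ[R'] B :=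
    TensorProduct.lift ((TensorProduct.lift.equiv (.id R') M' (Module.Dual R' N') B).toLinearMap ∘ₗ β)
  have hF (u v φ) : F (u ⊗ₜ (v ⊗ₜ φ)) = β u v φ := by simp [F]
  let G : EvenClifford Q' →ₐ[R'] B := lift F
    (fun v φ ↦ by
      obtain ⟨r, v, rfl⟩ := exists_eq_smul (R' := R') g f v
      obtain ⟨s, φ, rfl⟩ := exists_eq_smul (R' := R') g d φ
      have hj (r : R) : j (algebraMap R _ r) = algebraMap R' B (algebraMap R R' r) := by
        rw [AlgHom.commutes, IsScalarTower.algebraMap_apply R R' B]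
      simp only [hF, map_smul, LinearMap.smul_apply, hβ, ι_contract, QuadraticMap.map_smul, h, hj,
        smul_smul, smul_eq_mul, Algebra.smul_def, ← map_mul]
      congr 1
      ring)
    (fun u v w φ ψ ↦ by
      obtain ⟨r, u, rfl⟩ := exists_eq_smul (R' := R') g f u
      obtain ⟨s, v, rfl⟩ := exists_eq_smul (R' := R') g f v
      obtain ⟨t, w, rfl⟩ := exists_eq_smul (R' := R') g f w
      obtain ⟨a, φ, rfl⟩ := exists_eq_smul (R' := R') g d φ
      obtain ⟨b, ψ, rfl⟩ := exists_eq_smul (R' := R') g d ψ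
      simp only [hF, map_smul, LinearMap.smul_apply, hβ, QuadraticMap.map_smul, h,
        smul_mul_assoc, mul_smul_comm, ← map_mul, ι_contract_mid]
      rw [← algebraMap_smul R' (φ (Q v))]
      simp only [smul_smul, smul_eq_mul]
      congr 1
      ring)
  have hG : G.toRingHom.comp (map f d h) = j.toRingHom := by
    refine ringHom_ext (fun r ↦ ?_) (fun u v φ ↦ ?_)
    · simp [IsScalarTower.algebraMap_apply R R' B]
    · simp [G, hF, hβ]
  have h0 : j a = 0 := by
    have := congr($hG a)
    simpa [ha] using this.symm
  have hj : IsLocalizedModule (.powers g) (TensorProduct.mk R R' (EvenClifford Q) 1) :=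
    (isLocalizedModule_iff_isBaseChange (.powers g) R' _).mpr (TensorProduct.isBaseChange R _ R')
  obtain ⟨⟨_, n, rfl⟩, hn⟩ := (IsLocalizedModule.eq_zero_iff (.powers g) (TensorProduct.mk R R' (EvenClifford Q) 1)).mp h0
  exact ⟨n, hn⟩

theorem map_smul' (r : R) (a : EvenClifford Q) :
    map f d h (r • a) = algebraMap R R' r • map f d h a := by
  rw [Algebra.smul_def, Algebra.smul_def, map_mul, map_algebraMap]

theorem exists_map_eq_smul (b : EvenClifford Q') :
    ∃ (n : ℕ) (a : EvenClifford Q), map f d h a = algebraMap R R' g ^ n • b := by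
  induction b using EvenClifford.induction with
  | algebraMap r =>
    obtain ⟨n, x, hx⟩ := IsLocalization.Away.surj g r
    refine ⟨n, algebraMap _ _ x, ?_⟩
    rw [map_algebraMap, ← hx, Algebra.smul_def, ← map_mul, mul_comm]
  | ι u v φ =>
    obtain ⟨⟨u, ⟨_, l, rfl⟩⟩, hu⟩ := IsLocalizedModule.surj (.powers g) f u
    obtain ⟨⟨v, ⟨_, m, rfl⟩⟩, hv⟩ := IsLocalizedModule.surj (.powers g) f v
    obtain ⟨⟨φ, ⟨_, n, rfl⟩⟩, hφ⟩ := IsLocalizedModule.surj (.powers g) d φ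
    simp only [Submonoid.smul_def] at hu hv hφ
    refine ⟨l + (m + n), ι Q (u ⊗ₜ (v ⊗ₜ φ)), ?_⟩
    rw [map_ι, ← hu, ← hv, ← hφ, ← algebraMap_smul R', ← algebraMap_smul R' (g ^ m),
      ← algebraMap_smul R' (g ^ n)]
    simp only [tmul_smul, ← smul_tmul', map_smul, smul_smul, map_pow, pow_add]
    ring_nf
  | mul b c hb hc =>
    obtain ⟨n, x, hx⟩ := hb
    obtain ⟨m, y, hy⟩ := hc
    refine ⟨n + m, x * y, ?_⟩
    rw [map_mul, hx, hy, smul_mul_smul_comm, pow_add]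
  | add b c hb hc =>
    obtain ⟨n, x, hx⟩ := hb
    obtain ⟨m, y, hy⟩ := hc
    refine ⟨n + m, g ^ m • x + g ^ n • y, ?_⟩
    rw [map_add, map_smul', map_smul', hx, hy, smul_smul, smul_smul, smul_add, map_pow, map_pow,
      pow_add, mul_comm]

theorem map_mem_center (g₀ : R) [IsLocalization.Away g₀ R'] [IsLocalizedModule.Away g₀ f]
    [IsLocalizedModule.Away g₀ d] {a : EvenClifford Q} (ha : a ∈ Subring.center (EvenClifford Q)) :
    map f d h a ∈ Subring.center (EvenClifford Q') := by
  rw [Subring.mem_center_iff] at ha ⊢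
  intro b
  obtain ⟨n, x, hx⟩ := exists_map_eq_smul g₀ f d h b
  have hg := (IsLocalization.Away.algebraMap_isUnit (S := R') g₀).pow n
  rw [← hg.smul_left_cancel, ← smul_mul_assoc, ← mul_smul_comm, ← hx, ← map_mul, ← map_mul, ha]

theorem exists_pow_smul_mem_center [Module.Finite R M] [Module.Finite R (Module.Dual R N)]
    (a : EvenClifford Q) (ha : map f d h a ∈ Subring.center (EvenClifford Q')) :
    ∃ n : ℕ, g ^ n • a ∈ Subring.center (EvenClifford Q) := by
  classical
  obtain ⟨s, hs⟩ := (inferInstance : Module.Finite R (M ⊗[R] (M ⊗[R] Module.Dual R N))).fg_top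
  have h1 (x : EvenClifford Q) : ∃ n : ℕ, g ^ n • (x * a - a * x) = 0 := by
    refine exists_smul_eq_zero_of_map_eq_zero g f d h _ ?_
    rw [map_sub, map_mul, map_mul, Subring.mem_center_iff.mp ha, sub_self]
  choose m hm using h1
  refine ⟨s.sup fun t ↦ m (ι Q t), ?_⟩
  set k := s.sup fun t ↦ m (ι Q t)
  have h2 (t : M ⊗[R] (M ⊗[R] Module.Dual R N)) :
      ι Q t * (g ^ k • a) = (g ^ k • a) * ι Q t := by
    have ht : t ∈ Submodule.span R (s : Set _) := hs ▸ Submodule.mem_top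
    induction ht using Submodule.span_induction with
    | mem t ht =>
      have hk : m (ι Q t) ≤ k := Finset.le_sup (f := fun t ↦ m (ι Q t)) ht
      rw [mul_smul_comm, smul_mul_assoc, ← sub_eq_zero, ← smul_sub, ← Nat.sub_add_cancel hk,
        pow_add, mul_smul, hm, smul_zero]
    | zero => simp
    | add x y _ _ hx hy => rw [map_add, add_mul, mul_add, hx, hy]
    | smul c x _ hx => rw [map_smul, smul_mul_assoc, hx, mul_smul_comm]
  rw [Subring.mem_center_iff]
  intro b
  induction b using EvenClifford.induction with
  | algebraMap r => exact Algebra.commutes _ _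
  | ι u v φ => exact h2 _
  | mul b c hb hc => rw [mul_assoc, hc, ← mul_assoc, hb, mul_assoc]
  | add b c hb hc => rw [add_mul, mul_add, hb, hc]

end Localization

end EvenClifford

end QuadraticMap

namespace AlgebraicGeometry

open CategoryTheory Limits Opposite TopologicalSpace

namespace Scheme

variable {S : Scheme.{u}}

/-- An `𝒪_S`-module is locally free of rank `n`: it is locally free, and every point has an open
neighbourhood `U` with sections `e₁, …, eₙ` over `U` which form a basis over every open subset
of `U`. -/
structure IsLocallyFreeOfRank (E : S.Modules) (n : ℕ) : Prop where
  isLocallyFree : SheafOfModules.IsLocallyFree.{u} E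
  exists_basis : ∀ x : S, ∃ U : S.Opens, x ∈ U ∧ ∃ e : Fin n → Γ(E, U),
    ∀ (V : S.Opens) (i : V ⟶ U),
      Function.Bijective fun c : Fin n → Γ(S, V) ↦ ∑ k, c k • E.presheaf.map i.op (e k)

theorem IsLocallyFreeOfRank.isQuasicoherent {E : S.Modules} {n : ℕ} (h : IsLocallyFreeOfRank E n) :
    SheafOfModules.IsQuasicoherent.{u} E :=
  have := h.isLocallyFree
  SheafOfModules.instIsQuasicoherentOfIsLocallyFree E

variable (S) in
/-- A line bundle-valued quadratic form `(E, q, L)` of rank `n`. -/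
structure LineBundleQuadraticForm (n : ℕ) where
  /-- The underlying vector bundle. -/
  E : S.Modules
  /-- The line bundle of values. -/
  L : S.Modules
  locallyFree : IsLocallyFreeOfRank E n
  invertible : IsLocallyFreeOfRank L 1
  /-- The quadratic morphism on sections over an open set. -/
  q (U : S.Opens) : QuadraticMap Γ(S, U) Γ(E, U) Γ(L, U)
  map_q {U V : S.Opens} (i : V ⟶ U) (s : Γ(E, U)) :
    L.presheaf.map i.op (q U s) = q V (E.presheaf.map i.op s)

section Sections

variable {U V : S.Opens} (i : V ⟶ U) (E : S.Modules)

/-- The algebra structure of `𝒪_S(V)` over `𝒪_S(U)` for `V ⊆ U`. -/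
abbrev resAlgebra : Algebra Γ(S, U) Γ(S, V) := (S.presheaf.map i.op).hom.toAlgebra

/-- The `𝒪_S(U)`-module structure of `E(V)` for `V ⊆ U`. -/
abbrev resModule : Module Γ(S, U) Γ(E, V) := Module.compHom _ (S.presheaf.map i.op).hom

/-- The restriction of sections as a linear map. -/
def resLinear : letI := resModule i E; Γ(E, U) →ₗ[Γ(S, U)] Γ(E, V) :=
  letI := resModule i E
  { toFun := E.presheaf.map i.op
    map_add' := map_add _
    map_smul' := fun r s ↦ E.map_smul i r s }

theorem appIso_fromSpec_inv (hU : IsAffineOpen U) (W : (Spec Γ(S, U)).Opens) (h : hU.fromSpec ''ᵁ W ≤ U)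
    (r : Γ(S, U)) :
    (hU.fromSpec.appIso W).inv ((Spec Γ(S, U)).presheaf.map W.leTop.op
      ((Scheme.ΓSpecIso Γ(S, U)).inv r)) = S.presheaf.map (homOfLE h).op r := by
  have e : W ≤ hU.fromSpec ⁻¹ᵁ U := by simp
  have h1 := hU.fromSpec.appLE_appIso_inv e
  have h2 : hU.fromSpec.appLE U W e =
      (Scheme.ΓSpecIso Γ(S, U)).inv ≫ (Spec Γ(S, U)).presheaf.map W.leTop.op := by
    rw [Scheme.Hom.appLE, hU.fromSpec_app_self, Category.assoc, ← Functor.map_comp]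
    rfl
  rw [h2] at h1
  exact congr($h1 r)

theorem spec_smul_eq (hU : IsAffineOpen U) (W : (Spec Γ(S, U)).Opens) (h : hU.fromSpec ''ᵁ W ≤ U)
    (r : Γ(S, U)) (x : Γ(E.restrict hU.fromSpec, W)) :
    (E.restrictAppIso hU.fromSpec W).hom (r • x) =
      S.presheaf.map (homOfLE h).op r • (E.restrictAppIso hU.fromSpec W).hom x := by
  rw [← appIso_fromSpec_inv hU W h]
  rfl

theorem map_spec_smul (hU : IsAffineOpen U) (W : (Spec Γ(S, U)).Opens)
    (i : V ⟶ U) (k : V ⟶ hU.fromSpec ''ᵁ W) (h : hU.fromSpec ''ᵁ W ≤ U)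
    (r : Γ(S, U)) (x : Γ(E.restrict hU.fromSpec, W)) :
    E.presheaf.map k.op ((E.restrictAppIso hU.fromSpec W).hom (r • x)) =
      S.presheaf.map i.op r • E.presheaf.map k.op ((E.restrictAppIso hU.fromSpec W).hom x) := by
  rw [spec_smul_eq E hU W h, E.map_smul, ← ConcreteCategory.comp_apply, ← Functor.map_comp]
  rfl

theorem spec_surj {R : CommRingCat.{u}} (M : (Spec R).Modules) [SheafOfModules.IsQuasicoherent.{u} M]
    (f : R) (W : (Spec R).Opens) (hW : W = PrimeSpectrum.basicOpen f) (y : Γ(M, W)) :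
    ∃ (n : ℕ) (x : Γ(M, ⊤)), f ^ n • y = M.presheaf.map W.leTop.op x := by
  subst hW
  have hM := (isIso_fromTildeΓ_iff_isLocalizing M).mp inferInstance f
  obtain ⟨⟨x, ⟨_, n, rfl⟩⟩, hx⟩ := hM.surj y
  exact ⟨n, x, hx⟩

theorem spec_eq_zero {R : CommRingCat.{u}} (M : (Spec R).Modules)
    [SheafOfModules.IsQuasicoherent.{u} M] (f : R) (W : (Spec R).Opens)
    (hW : W = PrimeSpectrum.basicOpen f) (x : Γ(M, ⊤)) (hx : M.presheaf.map W.leTop.op x = 0) :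
    ∃ n : ℕ, f ^ n • x = 0 := by
  subst hW
  have hM := (isIso_fromTildeΓ_iff_isLocalizing M).mp inferInstance f
  obtain ⟨⟨_, n, rfl⟩, hn⟩ := (@IsLocalizedModule.eq_zero_iff _ _ (.powers f) _ _ _ _ _ _ _ hM x).mp hx
  exact ⟨n, hn⟩

theorem map_map_eq {A B C D : S.Opens} (a : B ⟶ A) (b : C ⟶ B) (a' : D ⟶ A) (b' : C ⟶ D)
    (x : Γ(E, A)) : E.presheaf.map b.op (E.presheaf.map a.op x) =
      E.presheaf.map b'.op (E.presheaf.map a'.op x) := by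
  rw [← ConcreteCategory.comp_apply, ← Functor.map_comp, ← ConcreteCategory.comp_apply,
    ← Functor.map_comp]
  rfl

theorem map_map_self {A B : S.Opens} (a : B ⟶ A) (b : A ⟶ B) (x : Γ(E, A)) :
    E.presheaf.map b.op (E.presheaf.map a.op x) = x := by
  rw [map_map_eq E a b (𝟙 A) (𝟙 A)]
  simp

theorem isLocalizedModule_res (hU : IsAffineOpen U) (f : Γ(S, U)) (hV : S.basicOpen f = V)
    [SheafOfModules.IsQuasicoherent.{u} E] :
    letI := resModule i E
    IsLocalizedModule.Away f (resLinear i E) := by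
  subst hV
  have h1 : hU.fromSpec ''ᵁ ⊤ = U := by simp
  have h2 : hU.fromSpec ''ᵁ (PrimeSpectrum.basicOpen f) = S.basicOpen f :=
    hU.fromSpec_image_basicOpen f
  let := resModule i E
  have hle : hU.fromSpec ''ᵁ PrimeSpectrum.basicOpen f ≤ U := h2.trans_le (S.basicOpen_le f)
  set W : (Spec Γ(S, U)).Opens := PrimeSpectrum.basicOpen f with hW
  refine IsLocalizedModule.Away.mk_of_addCommGroup ?_ ?_ ?_
  · rw [Module.End.isUnit_iff]
    have hf : IsUnit (S.presheaf.map i.op f) := S.toRingedSpace.isUnit_res_basicOpen f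
    have hf' := (Module.End.isUnit_iff _).mp
      (hf.map (algebraMap Γ(S, S.basicOpen f) (Module.End Γ(S, S.basicOpen f) Γ(E, S.basicOpen f))))
    exact hf'
  · intro y
    obtain ⟨n, x, hx⟩ := spec_surj (E.restrict hU.fromSpec) f W hW
      ((E.restrictAppIso hU.fromSpec W).inv (E.presheaf.map (eqToHom h2).op y))
    refine ⟨n, E.presheaf.map (eqToHom h1.symm).op ((E.restrictAppIso hU.fromSpec _).hom x), ?_⟩
    have hx' := congr(E.presheaf.map (eqToHom h2.symm).op
      ((E.restrictAppIso hU.fromSpec _).hom $hx))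
    rw [map_spec_smul E hU W i _ hle] at hx'
    have e1 := map_map_self E (eqToHom h2) (eqToHom h2.symm) y
    have e2 := map_map_eq E (homOfLE (h2.trans_le ((S.basicOpen_le f).trans h1.ge)))
      (eqToHom h2.symm) (eqToHom h1.symm) i ((E.restrictAppIso hU.fromSpec _).hom x)
    refine Eq.trans ?_ (hx'.trans e2)
    change S.presheaf.map i.op (f ^ n) • y = _
    congr 1
    exact e1.symm
  · intro x hx
    obtain ⟨n, hn⟩ := spec_eq_zero (E.restrict hU.fromSpec) f W hW
      ((E.restrictAppIso hU.fromSpec ⊤).inv (E.presheaf.map (eqToHom h1).op x))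
      ((map_map_eq E (eqToHom h1) (homOfLE (h2.trans_le ((S.basicOpen_le f).trans h1.ge))) i
        (eqToHom h2) x).trans (by
          have hx' : E.presheaf.map i.op x = 0 := hx
          rw [hx', map_zero]; rfl))
    refine ⟨n, ?_⟩
    have hn' := congr(E.presheaf.map (eqToHom h1.symm).op
      ((E.restrictAppIso hU.fromSpec _).hom $hn))
    rw [map_spec_smul E hU ⊤ (𝟙 U) _ h1.le] at hn'
    have e1 := map_map_self E (eqToHom h1) (eqToHom h1.symm) x
    rw [map_zero, map_zero] at hn'
    refine Eq.trans ?_ hn'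
    have e2 : S.presheaf.map (𝟙 U : U ⟶ U).op (f ^ n) = f ^ n := by simp
    rw [e2]
    congr 1
    exact e1.symm

theorem exists_equiv_of_le {n : ℕ} {e : Fin n → Γ(E, U)} (i : V ⟶ U)
    (he : Function.Bijective fun c : Fin n → Γ(S, V) ↦ ∑ k, c k • E.presheaf.map i.op (e k)) :
    Nonempty ((Fin n → Γ(S, V)) ≃ₗ[Γ(S, V)] Γ(E, V)) :=
  ⟨LinearEquiv.ofBijective
    { toFun := fun c ↦ ∑ k, c k • E.presheaf.map i.op (e k)
      map_add' := fun _ _ ↦ by simp [add_smul, Finset.sum_add_distrib]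
      map_smul' := fun _ _ ↦ by simp [Finset.smul_sum, smul_smul] } he⟩

theorem span_trivializing {n : ℕ} {E : S.Modules} (hE : IsLocallyFreeOfRank E n)
    (hU : IsAffineOpen U) :
    Ideal.span {g : Γ(S, U) | Nonempty ((Fin n → Γ(S, S.basicOpen g)) ≃ₗ[Γ(S, S.basicOpen g)]
      Γ(E, S.basicOpen g))} = ⊤ := by
  rw [← hU.self_le_iSup_basicOpen_iff]
  intro x hx
  obtain ⟨W, hxW, e, he⟩ := hE.exists_basis x
  obtain ⟨g, hgW, hxg⟩ := hU.exists_basicOpen_le ⟨x, hxW⟩ hx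
  exact Opens.mem_iSup.mpr ⟨⟨g, exists_equiv_of_le E (homOfLE hgW) (he _ _)⟩, hxg⟩

theorem finitePresentation {n : ℕ} {E : S.Modules} (hE : IsLocallyFreeOfRank E n)
    (hU : IsAffineOpen U) : Module.FinitePresentation Γ(S, U) Γ(E, U) := by
  have : SheafOfModules.IsQuasicoherent.{u} E := hE.isQuasicoherent
  let i (g : Γ(S, U)) : S.basicOpen g ⟶ U := homOfLE (S.basicOpen_le g)
  let _ (g : Γ(S, U)) := resAlgebra (i g)
  let _ (g : Γ(S, U)) := resModule (i g) E
  have (g : Γ(S, U)) : IsScalarTower Γ(S, U) Γ(S, S.basicOpen g) Γ(E, S.basicOpen g) :=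
    .of_algebraMap_smul fun _ _ ↦ rfl
  have (g : Γ(S, U)) : IsLocalization.Away g Γ(S, S.basicOpen g) := hU.isLocalization_basicOpen g
  have (g : Γ(S, U)) : IsLocalizedModule.Away g (resLinear (i g) E) :=
    isLocalizedModule_res (i g) E hU g rfl
  refine Module.FinitePresentation.of_localizationSpan' _ (span_trivializing hE hU)
    (Rₚ := fun g ↦ Γ(S, S.basicOpen g.1)) (fun g ↦ resLinear (i g.1) E) fun g ↦ ?_
  exact Module.FinitePresentation.of_equiv g.2.some

theorem finite_dual {n : ℕ} {E : S.Modules} (hE : IsLocallyFreeOfRank E n)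
    (hU : IsAffineOpen U) : Module.Finite Γ(S, U) (Module.Dual Γ(S, U) Γ(E, U)) := by
  have : SheafOfModules.IsQuasicoherent.{u} E := hE.isQuasicoherent
  have := finitePresentation hE hU
  let i (g : Γ(S, U)) : S.basicOpen g ⟶ U := homOfLE (S.basicOpen_le g)
  let _ (g : Γ(S, U)) := resAlgebra (i g)
  let _ (g : Γ(S, U)) := resModule (i g) E
  have (g : Γ(S, U)) : IsScalarTower Γ(S, U) Γ(S, S.basicOpen g) Γ(E, S.basicOpen g) :=
    .of_algebraMap_smul fun _ _ ↦ rfl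
  have (g : Γ(S, U)) : IsLocalization.Away g Γ(S, S.basicOpen g) := hU.isLocalization_basicOpen g
  have (g : Γ(S, U)) : IsLocalizedModule.Away g (resLinear (i g) E) :=
    isLocalizedModule_res (i g) E hU g rfl
  refine Module.Finite.of_localizationSpan' _ (span_trivializing hE hU)
    (Rₚ := fun g ↦ Γ(S, S.basicOpen g.1))
    (Mₚ := fun g ↦ Module.Dual Γ(S, S.basicOpen g.1) Γ(E, S.basicOpen g.1))
    (fun g ↦ IsLocalizedModule.mapExtendScalars (.powers g.1) (resLinear (i g.1) E)
      (Algebra.linearMap Γ(S, U) Γ(S, S.basicOpen g.1)) Γ(S, S.basicOpen g.1)) fun g ↦ ?_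
  exact Module.Finite.equiv g.2.some.dualMap.symm

end Sections

namespace LineBundleQuadraticForm

variable {n : ℕ} (Q : S.LineBundleQuadraticForm n)

section Restriction

variable {U V : S.Opens} (i : V ⟶ U) (hU : IsAffineOpen U) (g : Γ(S, U)) (hV : S.basicOpen g = V)

theorem isLocalization_res {U V : S.Opens} (i : V ⟶ U) (hU : IsAffineOpen U) (g : Γ(S, U))
    (hV : S.basicOpen g = V) :
    letI := resAlgebra i
    IsLocalization.Away g Γ(S, V) := by
  subst hV
  exact hU.isLocalization_basicOpen g

/-- The restriction map on the sections of the dual of the line bundle of values. -/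
def dualRes :
    letI := resAlgebra i
    Module.Dual Γ(S, U) Γ(Q.L, U) →ₗ[Γ(S, U)] Module.Dual Γ(S, V) Γ(Q.L, V) :=
  letI := resAlgebra i
  letI := resModule i Q.L
  haveI : IsScalarTower Γ(S, U) Γ(S, V) Γ(Q.L, V) := .of_algebraMap_smul fun _ _ ↦ rfl
  haveI : SheafOfModules.IsQuasicoherent.{u} Q.L := Q.invertible.isQuasicoherent
  haveI : IsLocalization.Away g Γ(S, V) := isLocalization_res i hU g hV
  haveI : IsLocalizedModule.Away g (resLinear i Q.L) := isLocalizedModule_res i Q.L hU g hV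
  IsLocalizedModule.mapExtendScalars (.powers g) (resLinear i Q.L)
    (Algebra.linearMap Γ(S, U) Γ(S, V)) Γ(S, V)

theorem dualRes_apply (φ : Module.Dual Γ(S, U) Γ(Q.L, U)) (s : Γ(Q.L, U)) :
    Q.dualRes i hU g hV φ (Q.L.presheaf.map i.op s) = S.presheaf.map i.op (φ s) := by
  let := resAlgebra i
  let := resModule i Q.L
  have : IsScalarTower Γ(S, U) Γ(S, V) Γ(Q.L, V) := .of_algebraMap_smul fun _ _ ↦ rfl
  have : SheafOfModules.IsQuasicoherent.{u} Q.L := Q.invertible.isQuasicoherent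
  have : IsLocalization.Away g Γ(S, V) := isLocalization_res i hU g hV
  have : IsLocalizedModule.Away g (resLinear i Q.L) := isLocalizedModule_res i Q.L hU g hV
  exact IsLocalizedModule.map_apply (.powers g) (resLinear i Q.L)
    (Algebra.linearMap Γ(S, U) Γ(S, V)) φ s

theorem isLocalizedModule_dualRes :
    letI := resAlgebra i
    IsLocalizedModule.Away g (Q.dualRes i hU g hV) := by
  let := resAlgebra i
  let := resModule i Q.L
  have : IsScalarTower Γ(S, U) Γ(S, V) Γ(Q.L, V) := .of_algebraMap_smul fun _ _ ↦ rfl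
  have : SheafOfModules.IsQuasicoherent.{u} Q.L := Q.invertible.isQuasicoherent
  have : IsLocalization.Away g Γ(S, V) := isLocalization_res i hU g hV
  have : IsLocalizedModule.Away g (resLinear i Q.L) := isLocalizedModule_res i Q.L hU g hV
  have := finitePresentation Q.invertible hU
  exact Module.FinitePresentation.isLocalizedModule_mapExtendScalars (.powers g)
    (resLinear i Q.L) (Algebra.linearMap Γ(S, U) Γ(S, V)) Γ(S, V)

theorem dual_ext {U V : S.Opens} (i : V ⟶ U) (hU : IsAffineOpen U) (g : Γ(S, U))
    (hV : S.basicOpen g = V) {φ ψ : Module.Dual Γ(S, V) Γ(Q.L, V)}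
    (h : ∀ s : Γ(Q.L, U), φ (Q.L.presheaf.map i.op s) = ψ (Q.L.presheaf.map i.op s)) : φ = ψ := by
  let := resAlgebra i
  let := resModule i Q.L
  have : IsScalarTower Γ(S, U) Γ(S, V) Γ(Q.L, V) := .of_algebraMap_smul fun _ _ ↦ rfl
  have : SheafOfModules.IsQuasicoherent.{u} Q.L := Q.invertible.isQuasicoherent
  have : IsLocalization.Away g Γ(S, V) := isLocalization_res i hU g hV
  have : IsLocalizedModule.Away g (resLinear i Q.L) := isLocalizedModule_res i Q.L hU g hV
  ext x
  obtain ⟨r, s, rfl⟩ := QuadraticMap.EvenClifford.exists_eq_smul (R' := Γ(S, V)) g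
    (resLinear i Q.L) x
  rw [map_smul, map_smul]
  exact congr(r • $(h s))

/-- The restriction map of even Clifford algebras from an affine open to a basic open subset. -/
def evenCliffordRes : QuadraticMap.EvenClifford (Q.q U) →+* QuadraticMap.EvenClifford (Q.q V) :=
  letI := resAlgebra i
  letI := resModule i Q.E
  haveI : IsScalarTower Γ(S, U) Γ(S, V) Γ(Q.E, V) := .of_algebraMap_smul fun _ _ ↦ rfl
  QuadraticMap.EvenClifford.map (resLinear i Q.E) (Q.dualRes i hU g hV) fun φ v ↦
    (congrArg _ (Q.map_q i v).symm).trans (Q.dualRes_apply i hU g hV φ _)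

theorem evenCliffordRes_algebraMap (r : Γ(S, U)) :
    Q.evenCliffordRes i hU g hV (algebraMap _ _ r) = algebraMap _ _ (S.presheaf.map i.op r) :=
  letI := resAlgebra i
  letI := resModule i Q.E
  haveI : IsScalarTower Γ(S, U) Γ(S, V) Γ(Q.E, V) := .of_algebraMap_smul fun _ _ ↦ rfl
  QuadraticMap.EvenClifford.map_algebraMap (resLinear i Q.E) (Q.dualRes i hU g hV) _ r

theorem evenCliffordRes_ι (u v : Γ(Q.E, U)) (φ : Module.Dual Γ(S, U) Γ(Q.L, U)) :
    Q.evenCliffordRes i hU g hV (QuadraticMap.EvenClifford.ι _ (u ⊗ₜ (v ⊗ₜ φ))) =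
      QuadraticMap.EvenClifford.ι _ (Q.E.presheaf.map i.op u ⊗ₜ
        (Q.E.presheaf.map i.op v ⊗ₜ Q.dualRes i hU g hV φ)) :=
  letI := resAlgebra i
  letI := resModule i Q.E
  haveI : IsScalarTower Γ(S, U) Γ(S, V) Γ(Q.E, V) := .of_algebraMap_smul fun _ _ ↦ rfl
  QuadraticMap.EvenClifford.map_ι (resLinear i Q.E) (Q.dualRes i hU g hV) _ u v φ

theorem evenCliffordRes_mem_center {a : QuadraticMap.EvenClifford (Q.q U)}
    (ha : a ∈ Subring.center (QuadraticMap.EvenClifford (Q.q U))) :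
    Q.evenCliffordRes i hU g hV a ∈ Subring.center (QuadraticMap.EvenClifford (Q.q V)) :=
  letI := resAlgebra i
  letI := resModule i Q.E
  haveI : IsScalarTower Γ(S, U) Γ(S, V) Γ(Q.E, V) := .of_algebraMap_smul fun _ _ ↦ rfl
  haveI : SheafOfModules.IsQuasicoherent.{u} Q.E := Q.locallyFree.isQuasicoherent
  haveI : IsLocalization.Away g Γ(S, V) := isLocalization_res i hU g hV
  haveI : IsLocalizedModule.Away g (resLinear i Q.E) := isLocalizedModule_res i Q.E hU g hV
  haveI := Q.isLocalizedModule_dualRes i hU g hV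
  QuadraticMap.EvenClifford.map_mem_center (resLinear i Q.E) (Q.dualRes i hU g hV) _ g ha

theorem evenCliffordRes_eq_zero {a : QuadraticMap.EvenClifford (Q.q U)}
    (ha : Q.evenCliffordRes i hU g hV a = 0) : ∃ m : ℕ, g ^ m • a = 0 :=
  letI := resAlgebra i
  letI := resModule i Q.E
  haveI : IsScalarTower Γ(S, U) Γ(S, V) Γ(Q.E, V) := .of_algebraMap_smul fun _ _ ↦ rfl
  haveI : SheafOfModules.IsQuasicoherent.{u} Q.E := Q.locallyFree.isQuasicoherent
  haveI : IsLocalization.Away g Γ(S, V) := isLocalization_res i hU g hV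
  haveI : IsLocalizedModule.Away g (resLinear i Q.E) := isLocalizedModule_res i Q.E hU g hV
  haveI := Q.isLocalizedModule_dualRes i hU g hV
  QuadraticMap.EvenClifford.exists_smul_eq_zero_of_map_eq_zero g (resLinear i Q.E)
    (Q.dualRes i hU g hV) _ a ha

theorem exists_evenCliffordRes_eq (b : QuadraticMap.EvenClifford (Q.q V)) :
    ∃ (m : ℕ) (a : QuadraticMap.EvenClifford (Q.q U)),
      Q.evenCliffordRes i hU g hV a = S.presheaf.map i.op g ^ m • b :=
  letI := resAlgebra i
  letI := resModule i Q.E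
  haveI : IsScalarTower Γ(S, U) Γ(S, V) Γ(Q.E, V) := .of_algebraMap_smul fun _ _ ↦ rfl
  haveI : SheafOfModules.IsQuasicoherent.{u} Q.E := Q.locallyFree.isQuasicoherent
  haveI : IsLocalization.Away g Γ(S, V) := isLocalization_res i hU g hV
  haveI : IsLocalizedModule.Away g (resLinear i Q.E) := isLocalizedModule_res i Q.E hU g hV
  haveI := Q.isLocalizedModule_dualRes i hU g hV
  QuadraticMap.EvenClifford.exists_map_eq_smul g (resLinear i Q.E)
    (Q.dualRes i hU g hV) _ b

theorem exists_pow_smul_mem_center (a : QuadraticMap.EvenClifford (Q.q U))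
    (ha : Q.evenCliffordRes i hU g hV a ∈ Subring.center (QuadraticMap.EvenClifford (Q.q V))) :
    ∃ m : ℕ, g ^ m • a ∈ Subring.center (QuadraticMap.EvenClifford (Q.q U)) :=
  letI := resAlgebra i
  letI := resModule i Q.E
  haveI : IsScalarTower Γ(S, U) Γ(S, V) Γ(Q.E, V) := .of_algebraMap_smul fun _ _ ↦ rfl
  haveI : SheafOfModules.IsQuasicoherent.{u} Q.E := Q.locallyFree.isQuasicoherent
  haveI : IsLocalization.Away g Γ(S, V) := isLocalization_res i hU g hV
  haveI : IsLocalizedModule.Away g (resLinear i Q.E) := isLocalizedModule_res i Q.E hU g hV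
  haveI := Q.isLocalizedModule_dualRes i hU g hV
  haveI := finitePresentation Q.locallyFree hU
  haveI := finite_dual Q.invertible hU
  QuadraticMap.EvenClifford.exists_pow_smul_mem_center g (resLinear i Q.E)
    (Q.dualRes i hU g hV) _ a ha

theorem dualRes_id (hg : S.basicOpen g = U) (φ : Module.Dual Γ(S, U) Γ(Q.L, U)) :
    Q.dualRes (𝟙 U) hU g hg φ = φ :=
  Q.dual_ext (𝟙 U) hU g hg fun s ↦ by rw [dualRes_apply]; simp

theorem dualRes_comp {W : S.Opens} (j : W ⟶ V) (hV' : IsAffineOpen V) (g' : Γ(S, V))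
    (hW : S.basicOpen g' = W) (g'' : Γ(S, U)) (hW' : S.basicOpen g'' = W)
    (φ : Module.Dual Γ(S, U) Γ(Q.L, U)) :
    Q.dualRes j hV' g' hW (Q.dualRes i hU g hV φ) = Q.dualRes (j ≫ i) hU g'' hW' φ :=
  Q.dual_ext (j ≫ i) hU g'' hW' fun s ↦ by
    rw [dualRes_apply, op_comp, Functor.map_comp, Functor.map_comp, ConcreteCategory.comp_apply,
      dualRes_apply, dualRes_apply]
    rfl

theorem evenCliffordRes_id (hg : S.basicOpen g = U) :
    Q.evenCliffordRes (𝟙 U) hU g hg = RingHom.id _ :=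
  QuadraticMap.EvenClifford.ringHom_ext
    (fun r ↦ by rw [evenCliffordRes_algebraMap]; simp)
    (fun u v φ ↦ by rw [evenCliffordRes_ι, dualRes_id]; simp)

theorem evenCliffordRes_comp {W : S.Opens} (j : W ⟶ V) (hV' : IsAffineOpen V) (g' : Γ(S, V))
    (hW : S.basicOpen g' = W) (g'' : Γ(S, U)) (hW' : S.basicOpen g'' = W) :
    (Q.evenCliffordRes j hV' g' hW).comp (Q.evenCliffordRes i hU g hV) =
      Q.evenCliffordRes (j ≫ i) hU g'' hW' :=
  QuadraticMap.EvenClifford.ringHom_ext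
    (fun r ↦ by
      rw [RingHom.comp_apply, evenCliffordRes_algebraMap, evenCliffordRes_algebraMap,
        evenCliffordRes_algebraMap, op_comp, Functor.map_comp, ConcreteCategory.comp_apply])
    (fun u v φ ↦ by
      rw [RingHom.comp_apply, evenCliffordRes_ι, evenCliffordRes_ι, evenCliffordRes_ι,
        Q.dualRes_comp i hU g hV j hV' g' hW g'' hW', op_comp, Functor.map_comp]
      rfl)

theorem evenCliffordRes_congr (g' : Γ(S, U)) (hV' : S.basicOpen g' = V) :
    Q.evenCliffordRes i hU g hV = Q.evenCliffordRes i hU g' hV' :=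
  QuadraticMap.EvenClifford.ringHom_ext
    (fun r ↦ by rw [evenCliffordRes_algebraMap, evenCliffordRes_algebraMap])
    (fun u v φ ↦ by
      have : Q.dualRes i hU g hV φ = Q.dualRes i hU g' hV' φ :=
        Q.dual_ext i hU g hV fun s ↦ by rw [dualRes_apply, dualRes_apply]
      rw [evenCliffordRes_ι, evenCliffordRes_ι, this])

end Restriction

/-- The presheaf `U ↦ Z (C₀ (U))` on the affine open subsets of `S`: the center of the even
Clifford algebra. -/
def centerPresheaf : S.AffineZariskiSiteᵒᵖ ⥤ CommRingCat.{u} where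
  obj U := .of (Subring.center (QuadraticMap.EvenClifford (Q.q U.unop.1)))
  map {U _} j := CommRingCat.ofHom
    ((Q.evenCliffordRes ((AffineZariskiSite.toOpensFunctor S).map j.unop) U.unop.2 j.unop.le.choose
      j.unop.le.choose_spec).restrict _ _ fun _ ha ↦ Q.evenCliffordRes_mem_center _ _ _ _ ha)
  map_id U := CommRingCat.hom_ext (RingHom.ext fun a ↦ Subtype.ext
    (DFunLike.congr_fun (Q.evenCliffordRes_id (U := U.unop.1) U.unop.2 _ _) a.1))
  map_comp {U V _} i j := CommRingCat.hom_ext (RingHom.ext fun a ↦ Subtype.ext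
    (DFunLike.congr_fun (Q.evenCliffordRes_comp
      ((AffineZariskiSite.toOpensFunctor S).map i.unop) U.unop.2 _ _
      ((AffineZariskiSite.toOpensFunctor S).map j.unop) V.unop.2 _ _ _ _) a.1).symm)

/-- The structure map from the structure sheaf to the center of the even Clifford algebra. -/
def toCenter : (AffineZariskiSite.toOpensFunctor S).op ⋙ S.presheaf ⟶ Q.centerPresheaf where
  app U := CommRingCat.ofHom ((algebraMap Γ(S, U.unop.1)
    (QuadraticMap.EvenClifford (Q.q U.unop.1))).codRestrict _ fun r ↦
      Subring.mem_center_iff.mpr fun a ↦ (Algebra.commutes r a).symm)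
  naturality {U V} j := by
    ext r
    exact Subtype.ext (Q.evenCliffordRes_algebraMap _ _ _ _ r).symm

theorem isLocalizationAway_center {A B : Type*} [Ring A] [Ring B] {R : Type*} [CommRing R]
    [Algebra R A] (ρ : A →+* B) (τ : Subring.center A →+* Subring.center B)
    (hτ : ∀ a, (τ a).1 = ρ a.1) (g : R) (z : Subring.center A) (hz : z.1 = algebraMap R A g)
    (hu : IsUnit (ρ z.1))
    (h₀ : ∀ a, ρ a = 0 → ∃ m : ℕ, g ^ m • a = 0)
    (h₁ : ∀ b, ∃ (m : ℕ) (a : A), ρ a = ρ z.1 ^ m * b)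
    (h₂ : ∀ a, ρ a ∈ Subring.center B → ∃ m : ℕ, g ^ m • a ∈ Subring.center A) :
    letI := τ.toAlgebra
    IsLocalization.Away z (Subring.center B) := by
  let := τ.toAlgebra
  have hs (m : ℕ) (a : A) : g ^ m • a = z.1 ^ m * a := by
    rw [Algebra.smul_def, map_pow, hz]
  refine IsLocalization.Away.mk z ?_ (fun b ↦ ?_) (fun a b hab ↦ ?_)
  · obtain ⟨w, hw⟩ := hu.exists_right_inv
    have hc : ρ z.1 ∈ Subring.center B := hτ z ▸ (τ z).2
    have hwc : w ∈ Subring.center B := by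
      rw [Subring.mem_center_iff] at hc ⊢
      intro b
      have h1 : w * ρ z.1 = 1 := by rw [hc, hw]
      calc b * w = w * ρ z.1 * (b * w) := by rw [h1, one_mul]
        _ = w * (b * ρ z.1) * w := by rw [hc b]; simp only [mul_assoc]
        _ = w * b := by rw [mul_assoc, mul_assoc, hw, mul_one]
    refine IsUnit.of_mul_eq_one ⟨w, hwc⟩ (Subtype.ext ?_)
    exact (congrArg (· * w) (hτ z)).trans hw
  · obtain ⟨m, a, ha⟩ := h₁ b.1
    have hac : ρ a ∈ Subring.center B := by
      rw [ha]
      exact mul_mem (pow_mem (hτ z ▸ (τ z).2) _) b.2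
    obtain ⟨k, hk⟩ := h₂ a hac
    refine ⟨k + m, ⟨_, hk⟩, Subtype.ext ?_⟩
    change b.1 * (τ z ^ (k + m)).1 = (τ _).1
    rw [hτ]
    change _ = ρ (g ^ k • a)
    rw [hs, map_mul, map_pow, ha, ← mul_assoc, ← pow_add, Subring.mem_center_iff.mp b.2,
      SubmonoidClass.coe_pow, hτ]
  · have h : ρ (a.1 - b.1) = 0 := by
      rw [map_sub, ← hτ, ← hτ, sub_eq_zero]
      exact congrArg Subtype.val hab
    obtain ⟨m, hm⟩ := h₀ _ h
    refine ⟨m, Subtype.ext ?_⟩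
    rw [hs, mul_sub, sub_eq_zero] at hm
    exact hm

theorem coequifibered_toCenter : Q.toCenter.Coequifibered := by
  refine AffineZariskiSite.coequifibered_iff_forall_isLocalizationAway.mpr fun U f ↦ ?_
  let h : U.basicOpen f ⟶ U := homOfLE (U.basicOpen_le f)
  let i : (U.basicOpen f).1 ⟶ U.1 := homOfLE (S.basicOpen_le f)
  have hf : Q.evenCliffordRes i U.2 f rfl (algebraMap _ _ f) =
    algebraMap _ _ (S.presheaf.map i.op f) := Q.evenCliffordRes_algebraMap i U.2 f rfl f
  have hu : IsUnit (S.presheaf.map i.op f) := S.toRingedSpace.isUnit_res_basicOpen f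
  refine isLocalizationAway_center (Q.evenCliffordRes i U.2 f rfl) (Q.centerPresheaf.map h.op).hom
    (fun a ↦ DFunLike.congr_fun (Q.evenCliffordRes_congr i U.2 _ _ f rfl) a.1) f _ rfl
    (hf ▸ hu.map _) (fun a ↦ Q.evenCliffordRes_eq_zero i U.2 f rfl) (fun b ↦ ?_)
    (fun a ↦ Q.exists_pow_smul_mem_center i U.2 f rfl a)
  obtain ⟨m, a, ha⟩ := Q.exists_evenCliffordRes_eq i U.2 f rfl b
  refine ⟨m, a, ha.trans ?_⟩
  rw [Algebra.smul_def, map_pow]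
  exact congrArg (· ^ m * b) hf.symm

/-- The gluing data of the schemes `Spec Z (C₀ (U))`, for `U` an affine open of `S`. -/
def glueData : (AffineZariskiSite.directedCover S).RelativeGluingData :=
  AffineZariskiSite.relativeGluingData Q.coequifibered_toCenter

instance : (Q.glueData.functor ⋙ Scheme.forget).IsLocallyDirected :=
  Cover.RelativeGluingData.instIsLocallyDirectedI₀CompFunctorForgetOfIsThin ..

/-- The discriminant cover `T`: the relative spectrum over `S` of the center of the even Clifford
algebra. -/
def discriminantCover : Scheme.{u} := Q.glueData.glued

/-- The structure morphism `f : T ⟶ S` of the discriminant cover. -/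
def toBase : Q.discriminantCover ⟶ S := Q.glueData.toBase

/-- The open immersion `Spec Z (C₀ (U)) ⟶ T` for an affine open `U` of `S`. -/
def ιCover (U : S.AffineZariskiSite) :
    Spec (Q.centerPresheaf.obj (.op U)) ⟶ Q.discriminantCover :=
  colimit.ι Q.glueData.functor U

theorem isOpenImmersion_ιCover (U : S.AffineZariskiSite) : IsOpenImmersion (Q.ιCover U) := by
  exact Q.glueData.cover.map_prop U

theorem opensRange_ιCover (U : S.AffineZariskiSite) :
    haveI := Q.isOpenImmersion_ιCover U
    (Q.ιCover U).opensRange = Q.toBase ⁻¹ᵁ U.1 := by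
  have h := Q.glueData.toBase_preimage_eq_opensRange_ι U
  have e : ((AffineZariskiSite.directedCover S).f U).opensRange = U.1 := U.1.opensRange_ι
  rw [e] at h
  exact h.symm

/-- The identification of the functions on `f⁻¹ (U) ⊆ T` with the center of `C₀ (U)`. -/
def sectionsIso (U : S.AffineZariskiSite) :
    Γ(Q.discriminantCover, Q.toBase ⁻¹ᵁ U.1) ≅ Q.centerPresheaf.obj (.op U) :=
  haveI := Q.isOpenImmersion_ιCover U
  Q.discriminantCover.presheaf.mapIso
      (eqToIso ((Hom.image_top_eq_opensRange _).trans (Q.opensRange_ιCover U))).op ≪≫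
    (Q.ιCover U).appIso ⊤ ≪≫ ΓSpecIso _

/-- The structure of an algebra over `Γ(f⁻¹ (U), 𝒪_T)` on the even Clifford algebra over an affine
open `U`: this is the datum of `C₀` as a sheaf of algebras on `T`. -/
@[reducible]
def evenCliffordAlgebra (U : S.AffineZariskiSite) :
    Algebra Γ(Q.discriminantCover, Q.toBase ⁻¹ᵁ U.1) (QuadraticMap.EvenClifford (Q.q U.1)) :=
  RingHom.toAlgebra' ((Subring.center _).subtype.comp (Q.sectionsIso U).hom.hom)
    fun c x ↦ (Subring.mem_center_iff.mp ((Q.sectionsIso U).hom.hom c).2 x).symm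

/-- The even Clifford algebra is an Azumaya algebra over the discriminant cover `f : T ⟶ S`: for
every affine open `U` of `S`, its sections `C₀ (U)` form an Azumaya algebra over the ring of
functions on the affine open `f⁻¹ (U)` of `T`. -/
def IsAzumayaOverDiscriminantCover : Prop :=
  ∀ U : S.AffineZariskiSite,
    letI := Q.evenCliffordAlgebra U
    IsAzumaya Γ(Q.discriminantCover, Q.toBase ⁻¹ᵁ U.1) (QuadraticMap.EvenClifford (Q.q U.1))

section Fibre

variable (U : S.Opens) (x : S) (hx : x ∈ U)

/-- The residue field `κ (x)` as an algebra over the functions on an open neighbourhood of `x`. -/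
abbrev residueAlgebra : Algebra Γ(S, U) (S.residueField x) :=
  (S.evaluation U x hx).hom.toAlgebra

/-- The polar form of `q` on the fibre at the point `x`, computed on a neighbourhood `U` of `x`:
the adjoint map `E(x) → Hom (E(x), L(x))`, where `E(x) = κ(x) ⊗ E(U)` and `L(x) = κ(x) ⊗ L(U)`. -/
def fibrePolar :
    letI := residueAlgebra U x hx
    LinearMap.BilinMap (S.residueField x) (S.residueField x ⊗[Γ(S, U)] Γ(Q.E, U))
      (S.residueField x ⊗[Γ(S, U)] Γ(Q.L, U)) :=
  letI := residueAlgebra U x hx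
  (Q.q U).polarBilin.baseChange (S.residueField x)

end Fibre

/-- `q` is generically regular: at the generic point of `S`, the adjoint `E → Hom (E, L)` of the
polar form is an isomorphism. -/
def IsGenericallyRegular [IrreducibleSpace S] : Prop :=
  ∀ (U : S.Opens) (_ : IsAffineOpen U) (hx : genericPoint S ∈ U),
    Function.Bijective (Q.fibrePolar U (genericPoint S) hx)

/-- `q` has simple degeneration: at every closed point `x` of `S`, the radical of the fibre of `q`,
that is the kernel of the adjoint `E(x) → Hom (E(x), L(x))` of its polar form, has dimension at
most `1` over the residue field. -/
def HasSimpleDegeneration : Prop :=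
  ∀ (U : S.Opens) (_ : IsAffineOpen U) (x : S) (hx : x ∈ U), IsClosed {x} →
    Module.finrank (S.residueField x) (LinearMap.ker (Q.fibrePolar U x hx)) ≤ 1

end LineBundleQuadraticForm

end Scheme

end AlgebraicGeometry

end

open AlgebraicGeometry

/-! Everything is checked over an affine open of `S`, where `A` is the even Clifford algebra and `Z`
its center.

Direct implication. Call an element of `A ⊗[Z] Aᵐᵒᵖ` balanced if left and right multiplication by
each element of `A` agree on it. Balanced elements act on `A` with central values, so they give
functionals `A → Z`. If `1 ⊗ 1` is a combination of left multiples of balanced elements, this yields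
dual bases and inverts the map to `End Z A` (`isAzumaya_of_one_mem_balancedSpan`). The scalars
carrying `1 ⊗ 1` into this span form an ideal, so one may work near each point of the base. In rank
`2` (and `0`) the algebra is commutative and `1 ⊗ 1` is already balanced. In rank `2k + 2`, a
radical of dimension at most `1` at a point allows one to split the form near it into `k` regular
binary forms `⟨pᵢ, qᵢ⟩` and one binary form `⟨c, w⟩`, possibly degenerate, with `Q c` a unit. The
products `c pᵢ`, `c qᵢ` satisfy Clifford relations; twisting them by the commutators of the earlier
pairs gives `k` commuting quaternion algebras with unit discriminants, and the product of their
Casimir elements is balanced by them. The last generator `c w` can be recovered from these and a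
central element `ω`, and central elements balance everything because the tensor product is over `Z`.
This is why a degenerate `⟨c, w⟩` does no harm (`IsFrame.exists_pow_smul_one_mem_balancedSpan`).
Closed points suffice, because a neighbourhood of a closed point contains all its generizations.

Converse, with `2` invertible. If `A` is Azumaya over `Z`, an element whose image under a ring
homomorphism commutes with the image of `A` has the same image as an element of `Z`
(`exists_algebraMap_eq_of_commute`). If the radical at `x` contains the independent classes of two
vectors `u`, `v`, then `u v` becomes central in the fibre, so it agrees there with a central
element. But in rank at least `3`, generic regularity forces central elements to have no component
of degree `2`, in the sense that a suitable functional kills them (`exists_functional`) while its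
value at `u v` is nonzero at `x`. This is a contradiction (`IsLocalBasis.finrank_ker_le_one`). -/

noncomputable section

open TensorProduct

/-! ### Balanced elements and a criterion for Azumaya algebras -/

namespace AzumayaCriterion

open MulOpposite

section Casimir

variable {Z A : Type*} [CommRing Z] [Ring A] [Algebra Z A]

/-- An element `E` of `A ⊗ Aᵒᵖ` is balanced by `a` if the left and right multiplications by `a`
agree on it. -/
def BalancedBy (a : A) (E : A ⊗[Z] Aᵐᵒᵖ) : Prop :=
  ((1 : A) ⊗ₜ[Z] op a) * E = (a ⊗ₜ[Z] (1 : Aᵐᵒᵖ)) * E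

variable (Z A) in
/-- The elements `∑ (aᵢ ⊗ 1) Eᵢ` of `A ⊗ Aᵒᵖ`, where each `Eᵢ` is balanced by all of `A`. -/
def balancedSpan : Submodule Z (A ⊗[Z] Aᵐᵒᵖ) :=
  Submodule.span Z {t | ∃ (a : A) (E : A ⊗[Z] Aᵐᵒᵖ), (∀ b, BalancedBy b E) ∧
    t = (a ⊗ₜ[Z] (1 : Aᵐᵒᵖ)) * E}

/-- Balancing turns each right factor of `t` into a left one, so `t * E` depends only on the value
at `1` of the endomorphism defined by `t`. -/
theorem mul_eq_of_balanced {E : A ⊗[Z] Aᵐᵒᵖ} (hE : ∀ b, BalancedBy b E) (t : A ⊗[Z] Aᵐᵒᵖ) :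
    t * E = (AlgHom.mulLeftRight Z A t 1 ⊗ₜ[Z] (1 : Aᵐᵒᵖ)) * E := by
  induction t with
  | zero => simp
  | add x y hx hy => rw [add_mul, hx, hy, map_add, LinearMap.add_apply, TensorProduct.add_tmul, add_mul]
  | tmul a b =>
    have h : a ⊗ₜ[Z] b = (a ⊗ₜ[Z] (1 : Aᵐᵒᵖ)) * ((1 : A) ⊗ₜ[Z] op b.unop) := by simp
    rw [h, mul_assoc, hE b.unop, ← mul_assoc]
    simp

/-- Evaluating the balancing relation at `x` shows that `E` acts with central values; this turns `E`
into a functional `A → Z`. -/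
theorem mul_apply_of_balanced {E : A ⊗[Z] Aᵐᵒᵖ} (hE : ∀ b, BalancedBy b E) (x b : A) :
    AlgHom.mulLeftRight Z A E x * b = b * AlgHom.mulLeftRight Z A E x := by
  have h := congr(AlgHom.mulLeftRight Z A $(hE b) x)
  simpa [map_mul] using h

/-- If `1 ⊗ 1` is a combination of balanced elements, then `A` is an Azumaya algebra over its
center. -/
theorem isAzumaya_of_one_mem_balancedSpan (hinj : Function.Injective (algebraMap Z A))
    (hcenter : ∀ a : A, (∀ b, a * b = b * a) → ∃ z, algebraMap Z A z = a)
    (h : (1 : A ⊗[Z] Aᵐᵒᵖ) ∈ balancedSpan Z A) : IsAzumaya Z A := by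
  obtain ⟨n, c, g, hg⟩ := Submodule.mem_span_set'.mp h
  choose a E hE hgE using fun i ↦ (g i).2
  replace hg : ∃ b : Fin n → A, ∑ i, b i ⊗ₜ[Z] (1 : Aᵐᵒᵖ) * E i = 1 := by
    refine ⟨fun i ↦ c i • a i, hg ▸ Finset.sum_congr rfl fun i _ ↦ ?_⟩
    rw [hgE, ← TensorProduct.smul_tmul', smul_mul_assoc]
  obtain ⟨b, hg⟩ := hg
  let ψ : Fin n → A →ₗ[Z] Z := fun i ↦
    (LinearEquiv.ofInjective (Algebra.linearMap Z A) hinj).symm.toLinearMap ∘ₗ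
      (AlgHom.mulLeftRight Z A (E i)).codRestrict _ fun x ↦
        (hcenter _ fun y ↦ mul_apply_of_balanced (hE i) x y)
  have hψ (i x) : algebraMap Z A (ψ i x) = AlgHom.mulLeftRight Z A (E i) x := by
    have := LinearEquiv.apply_symm_apply (LinearEquiv.ofInjective (Algebra.linearMap Z A) hinj)
      ⟨AlgHom.mulLeftRight Z A (E i) x, hcenter _ fun y ↦ mul_apply_of_balanced (hE i) x y⟩
    exact congr(($this).1)
  -- Evaluating `∑ (b i ⊗ 1) E i = 1` at `x` shows that `b` and `ψ` are dual bases, hence that `A`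
  -- is finite and projective.
  have hdual (x : A) : ∑ i, ψ i x • b i = x := by
    have := congr(AlgHom.mulLeftRight Z A $hg x)
    rw [map_sum, LinearMap.sum_apply, map_one, Module.End.one_apply] at this
    nth_rw 2 [← this]
    refine Finset.sum_congr rfl fun i _ ↦ ?_
    rw [map_mul, Module.End.mul_apply, AlgHom.mulLeftRight_apply, ← hψ, Algebra.smul_def,
      Algebra.commutes, unop_one, mul_one]
  have hP : Module.Projective Z A := by
    refine Module.Projective.of_split (LinearMap.pi ψ) (Fintype.linearCombination Z b) ?_
    ext x
    simp [Fintype.linearCombination_apply, hdual]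
  have hF : Module.Finite Z A := by
    refine Module.Finite.of_surjective (Fintype.linearCombination Z b) fun x ↦ ⟨fun i ↦ ψ i x, ?_⟩
    simp [Fintype.linearCombination_apply, hdual]
  have hS : FaithfulSMul Z A := (faithfulSMul_iff_algebraMap_injective Z A).mpr hinj
  -- For injectivity, `t (b i ⊗ 1) E i` depends only on the value of `t` at `b i`. For surjectivity,
  -- an endomorphism `f` is determined by the `f (b i)`, and the witness is its expansion in the
  -- dual bases.
  refine { bij := ⟨?_, fun f ↦ ⟨∑ i, (f (b i) ⊗ₜ[Z] (1 : Aᵐᵒᵖ)) * E i, ?_⟩⟩ }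
  · rw [injective_iff_map_eq_zero]
    intro t ht
    rw [← mul_one t, ← hg, Finset.mul_sum]
    refine Finset.sum_eq_zero fun i _ ↦ ?_
    rw [← mul_assoc, mul_eq_of_balanced (hE i), map_mul, ht]
    simp
  · ext x
    rw [map_sum, LinearMap.sum_apply]
    nth_rw 2 [← hdual x]
    rw [map_sum]
    refine Finset.sum_congr rfl fun i _ ↦ ?_
    rw [map_mul, Module.End.mul_apply, AlgHom.mulLeftRight_apply, ← hψ, map_smul, Algebra.smul_def,
      Algebra.commutes, unop_one, mul_one]

end Casimir

end AzumayaCriterion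

/-! ### Casimir elements of commuting quaternion algebras -/

namespace AzumayaCriterion

open MulOpposite

set_option linter.unusedSimpArgs false

section Quaternion

variable {R T : Type*} [CommRing R] [Ring T] [Algebra R T]

/-- The Casimir element of the quaternion algebra with generators `x`, `y` subject to `x² = α`,
`y² = γ`, `xy + yx = β`, with values in a ring which contains commuting copies of this algebra
(generated by `x`, `y`) and of its opposite (generated by `x'`, `y'`). -/
def quaternionCasimir (α β γ : R) (x y x' y' : T) : T :=
  (β ^ 2 - 2 * α * γ) • (1 : T) - β • (y' * x') + x * (β • y' - (2 * γ) • x') +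
    y * (β • x' - (2 * α) • y') - β • (x * y) + (2 : R) • (x * (y * (y' * x')))

/-- Since `y' * x'` is the opposite copy of `x y`, the Casimir element is `∑ u ⊗ v` with `u` among
`1, x, y, xy` and `v` the dual basis for the reduced trace form, scaled by the discriminant. Such a
sum is balanced; here this is verified after rewriting words in the order `x, y, y', x'`. -/
theorem mul_quaternionCasimir {α β γ : R} {x y x' y' : T}
    (hx : x * x = α • (1 : T)) (hy : y * y = γ • (1 : T)) (hxy : y * x = β • (1 : T) - x * y)
    (hx' : x' * x' = α • (1 : T)) (hy' : y' * y' = γ • (1 : T))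
    (hxy' : x' * y' = β • (1 : T) - y' * x')
    (h₁ : x' * x = x * x') (h₂ : x' * y = y * x') (h₃ : y' * x = x * y') (h₄ : y' * y = y * y') :
    x' * quaternionCasimir α β γ x y x' y' = x * quaternionCasimir α β γ x y x' y' ∧
    y' * quaternionCasimir α β γ x y x' y' = y * quaternionCasimir α β γ x y x' y' := by
  have e {a b c : T} (h : a * b = c) (t : T) : a * (b * t) = c * t := by rw [← mul_assoc, h]
  constructor <;>
  · simp only [quaternionCasimir, mul_add, add_mul, mul_sub, sub_mul, smul_mul_assoc,
      mul_smul_comm, mul_one, one_mul, mul_assoc, hx, hy, hxy, hx', hy', hxy', h₁, h₂, h₃, h₄,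
      e hx, e hy, e hxy, e hx', e hy', e hxy', e h₁, e h₂, e h₃, e h₄, smul_add, smul_sub]
    module

/-- With the same dual pairs, `a ↦ ∑ u a v` is the discriminant times the reduced trace. Applied to
the left factors of the Casimir element it leaves the discriminant times `∑ tr(u) v`, and this last
sum is again the discriminant; hence the square. -/
theorem sum_conj_quaternionCasimir {α β γ : R} {x y x' y' : T}
    (hx : x * x = α • (1 : T)) (hy : y * y = γ • (1 : T)) (hxy : y * x = β • (1 : T) - x * y)
    (h₁ : x' * x = x * x') (h₂ : x' * y = y * x') (h₃ : y' * x = x * y') (h₄ : y' * y = y * y') :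
    quaternionCasimir α β γ x y x' y' * ((β ^ 2 - 2 * α * γ) • (1 : T) - β • (x * y)) +
    x * quaternionCasimir α β γ x y x' y' * (β • y - (2 * γ) • x) +
    y * quaternionCasimir α β γ x y x' y' * (β • x - (2 * α) • y) +
    x * y * quaternionCasimir α β γ x y x' y' * ((2 : R) • (x * y) - β • (1 : T)) =
      ((β ^ 2 - 4 * α * γ) ^ 2) • (1 : T) := by
  have e {a b c : T} (h : a * b = c) (t : T) : a * (b * t) = c * t := by rw [← mul_assoc, h]
  simp only [quaternionCasimir, mul_add, add_mul, mul_sub, sub_mul, smul_mul_assoc,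
      mul_smul_comm, mul_one, one_mul, mul_assoc, hx, hy, hxy, h₁, h₂, h₃, h₄,
      e hx, e hy, e hxy, e h₁, e h₂, e h₃, e h₄, smul_add, smul_sub]
  module

theorem commute_quaternionCasimir {α β γ : R} {x y x' y' t : T} (hx : Commute t x)
    (hy : Commute t y) (hx' : Commute t x') (hy' : Commute t y') :
    Commute t (quaternionCasimir α β γ x y x' y') := by
  have e := Commute.one_right t
  unfold quaternionCasimir
  exact ((((((e.smul_right _).sub_right ((hy'.mul_right hx').smul_right _)).add_right
    (hx.mul_right ((hy'.smul_right _).sub_right (hx'.smul_right _)))).add_right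
    (hy.mul_right ((hx'.smul_right _).sub_right (hy'.smul_right _)))).sub_right
    ((hx.mul_right hy).smul_right _)).add_right
    ((hx.mul_right (hy.mul_right (hy'.mul_right hx'))).smul_right _))

end Quaternion

section Family

variable {R A T : Type*} [CommRing R] [Ring A] [Algebra R A] [Ring T] [Algebra R T]
  (l : A →ₐ[R] T) (r : Aᵐᵒᵖ →ₐ[R] T)

/-- For a finite family of pairwise commuting quaternion algebras in `A`, there is an element
balanced by all of them, and which generates an ideal containing the product of their
discriminants. -/
theorem exists_balanced_of_commuting_quaternions (hlr : ∀ a b, Commute (r b) (l a)) (k : ℕ)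
    (X Y : ℕ → A) (α β γ : ℕ → R) (hX : ∀ i < k, X i * X i = α i • (1 : A))
    (hY : ∀ i < k, Y i * Y i = γ i • (1 : A))
    (hXY : ∀ i < k, X i * Y i + Y i * X i = β i • (1 : A))
    (hc : ∀ i < k, ∀ j < k, i ≠ j →
      Commute (X i) (X j) ∧ Commute (X i) (Y j) ∧ Commute (Y i) (X j) ∧ Commute (Y i) (Y j)) :
    ∃ E : T, (∀ i < k, r (op (X i)) * E = l (X i) * E ∧ r (op (Y i)) * E = l (Y i) * E) ∧
      (∀ a, (∀ i < k, Commute a (X i) ∧ Commute a (Y i)) →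
        Commute (l a) E ∧ Commute (r (op a)) E) ∧
      (∏ i ∈ Finset.range k, (β i ^ 2 - 4 * α i * γ i) ^ 2) • (1 : T) ∈
        Submodule.span R {t | ∃ a b, t = l a * E * l b} := by
  induction k with
  | zero =>
    refine ⟨1, by simp, by simp, Submodule.subset_span ⟨1, 1, by simp⟩⟩
  | succ k ih =>
    obtain ⟨E, hE, hEc, hEs⟩ := ih (fun i hi ↦ hX i (by omega)) (fun i hi ↦ hY i (by omega))
      (fun i hi ↦ hXY i (by omega)) (fun i hi j hj ↦ hc i (by omega) j (by omega))
    have hk := k.lt_succ_self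
    have hyx : Y k * X k = β k • (1 : A) - X k * Y k := eq_sub_of_add_eq' (hXY k hk)
    -- The `k`-th pair commutes with the earlier ones, so both of its copies in `T` commute with
    -- `E`, and balancing by it can be tested on the new factor `C`.
    obtain ⟨c₁, c₁'⟩ := hEc (X k) fun i hi ↦
      ⟨(hc k hk i (by omega) (by omega)).1, (hc k hk i (by omega) (by omega)).2.1⟩
    obtain ⟨c₂, c₂'⟩ := hEc (Y k) fun i hi ↦
      ⟨(hc k hk i (by omega) (by omega)).2.2.1, (hc k hk i (by omega) (by omega)).2.2.2⟩
    set x := l (X k) with hx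
    set y := l (Y k) with hy
    set x' := r (op (X k)) with hx'
    set y' := r (op (Y k)) with hy'
    have r₁ : x * x = α k • (1 : T) := by rw [hx, ← map_mul, hX k hk, map_smul, map_one]
    have r₂ : y * y = γ k • (1 : T) := by rw [hy, ← map_mul, hY k hk, map_smul, map_one]
    have r₃ : y * x = β k • (1 : T) - x * y := by
      rw [hx, hy, ← map_mul, hyx, map_sub, map_smul, map_one, map_mul]
    have r₁' : x' * x' = α k • (1 : T) := by
      rw [hx', ← map_mul, ← op_mul, hX k hk, op_smul, op_one, map_smul, map_one]
    have r₂' : y' * y' = γ k • (1 : T) := by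
      rw [hy', ← map_mul, ← op_mul, hY k hk, op_smul, op_one, map_smul, map_one]
    have r₃' : x' * y' = β k • (1 : T) - y' * x' := by
      rw [hx', hy', ← map_mul, ← op_mul, hyx, op_sub, op_smul, op_one, op_mul, map_sub, map_smul,
        map_one, map_mul]
    set C := quaternionCasimir (α k) (β k) (γ k) x y x' y' with hC
    have hCinv := mul_quaternionCasimir r₁ r₂ r₃ r₁' r₂' r₃' (hlr _ _) (hlr _ _) (hlr _ _) (hlr _ _)
    rw [← hC] at hCinv
    refine ⟨E * C, fun i hi ↦ ?_, fun a ha ↦ ?_, ?_⟩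
    · obtain hi | rfl := Nat.lt_succ_iff_lt_or_eq.mp hi
      · simp only [← mul_assoc, hE i hi, and_self]
      · rw [← hx, ← hy, ← hx', ← hy']
        constructor
        · rw [← mul_assoc, c₁'.eq, mul_assoc, hCinv.1, ← mul_assoc, ← c₁.eq, mul_assoc]
        · rw [← mul_assoc, c₂'.eq, mul_assoc, hCinv.2, ← mul_assoc, ← c₂.eq, mul_assoc]
    · have h := hEc a fun i hi ↦ ha i (by omega)
      have h' := ha k hk
      refine ⟨h.1.mul_right (commute_quaternionCasimir ?_ ?_ ?_ ?_),
        h.2.mul_right (commute_quaternionCasimir ?_ ?_ ?_ ?_)⟩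
      · exact h'.1.map l
      · exact h'.2.map l
      · exact (hlr _ _).symm
      · exact (hlr _ _).symm
      · exact hlr _ _
      · exact hlr _ _
      · exact h'.1.op.map r
      · exact h'.2.op.map r
    · have key : ((β k ^ 2 - 4 * α k * γ k) ^ 2) • E =
          E * C * l ((β k ^ 2 - 2 * α k * γ k) • (1 : A) - β k • (X k * Y k)) +
          x * (E * C) * l (β k • Y k - (2 * γ k) • X k) +
          y * (E * C) * l (β k • X k - (2 * α k) • Y k) +
          l (X k * Y k) * (E * C) * l ((2 : R) • (X k * Y k) - β k • (1 : A)) := by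
        have h := congr(E * $(sum_conj_quaternionCasimir r₁ r₂ r₃ (hlr (X k) (op (X k)))
          (hlr (Y k) (op (X k))) (hlr (X k) (op (Y k))) (hlr (Y k) (op (Y k)))))
        rw [← hC, mul_smul_comm, mul_one] at h
        rw [← h]
        have e₁ (t : T) : x * (E * t) = E * (x * t) := by rw [← mul_assoc, c₁.eq, mul_assoc]
        have e₂ (t : T) : y * (E * t) = E * (y * t) := by rw [← mul_assoc, c₂.eq, mul_assoc]
        simp only [map_sub, map_smul, map_mul, map_one, mul_add, mul_assoc, ← hx, ← hy, e₁, e₂]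
      rw [Finset.prod_range_succ, mul_comm, mul_smul]
      have hle : Submodule.span R {t | ∃ a b, t = l a * E * l b} ≤
          (Submodule.span R {t | ∃ a b, t = l a * (E * C) * l b}).comap
            (LinearMap.lsmul R T ((β k ^ 2 - 4 * α k * γ k) ^ 2)) := by
        rw [Submodule.span_le]
        rintro _ ⟨a, b, rfl⟩
        simp only [SetLike.mem_coe, Submodule.mem_comap, LinearMap.lsmul_apply]
        rw [← smul_mul_assoc, ← mul_smul_comm, key]
        simp only [mul_add, add_mul]
        have hm (c d : A) : l a * (l c * (E * C) * l d) * l b ∈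
            Submodule.span R {t | ∃ a b, t = l a * (E * C) * l b} :=
          Submodule.subset_span ⟨a * c, d * b, by simp only [map_mul, mul_assoc]⟩
        refine add_mem (add_mem (add_mem ?_ (hm _ _)) (hm _ _)) (hm _ _)
        simpa only [map_one, one_mul] using hm 1 _
      exact hle hEs

end Family
end AzumayaCriterion

/-! ### Clifford relations, twisted generators and the central element -/

namespace AzumayaCriterion

section CliffordFamily

variable {R A : Type*} [CommRing R] [Ring A] [Algebra R A]

/-- The elements `pᵢ`, `qᵢ` for `i < k` satisfy the relations of the Clifford algebra of an
orthogonal sum of binary forms `αᵢ s² + βᵢ s t + γᵢ t²`. -/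
structure CliffordFamily (k : ℕ) (p q : ℕ → A) (α β γ : ℕ → R) : Prop where
  hp : ∀ i < k, p i * p i = α i • (1 : A)
  hq : ∀ i < k, q i * q i = γ i • (1 : A)
  hpq : ∀ i < k, p i * q i + q i * p i = β i • (1 : A)
  hpp : ∀ i < k, ∀ j < k, i ≠ j → p i * p j = -(p j * p i)
  hqq : ∀ i < k, ∀ j < k, i ≠ j → q i * q j = -(q j * q i)
  hpq' : ∀ i < k, ∀ j < k, i ≠ j → p i * q j = -(q j * p i)

/-- The pair of conjugate elements whose difference is the product of the `pᵢ qᵢ - qᵢ pᵢ`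
for `i < m`. -/
def conjPair (p q : ℕ → A) : ℕ → A × A
  | 0 => (1, 0)
  | m + 1 => ((conjPair p q m).1 * (p m * q m) + (conjPair p q m).2 * (q m * p m),
      (conjPair p q m).1 * (q m * p m) + (conjPair p q m).2 * (p m * q m))

/-- The product of the `pᵢ qᵢ - qᵢ pᵢ` for `i < m`. -/
def zeta (p q : ℕ → A) (m : ℕ) : A := (conjPair p q m).1 - (conjPair p q m).2

theorem zeta_succ (p q : ℕ → A) (m : ℕ) :
    zeta p q (m + 1) = zeta p q m * (p m * q m - q m * p m) := by
  simp only [zeta, conjPair]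
  noncomm_ring

namespace CliffordFamily

variable {k : ℕ} {p q : ℕ → A} {α β γ : ℕ → R} (h : CliffordFamily k p q α β γ)
include h

theorem commute_mul {a : A} {i j : ℕ} (ha : a = p j ∨ a = q j) (hi : i < k) (hj : j < k)
    (hij : i ≠ j) : Commute a (p i * q i) ∧ Commute a (q i * p i) := by
  have e {u v w : A} (hu : w * u = -(u * w)) (hv : w * v = -(v * w)) : Commute w (u * v) := by
    change w * (u * v) = u * v * w
    rw [← mul_assoc, hu, neg_mul, mul_assoc, hv, mul_neg, neg_neg, mul_assoc]
  obtain rfl | rfl := ha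
  · have h₁ := h.hpp j hj i hi hij.symm
    have h₂ := h.hpq' j hj i hi hij.symm
    exact ⟨e h₁ h₂, e h₂ h₁⟩
  · have h₁ : q j * p i = -(p i * q j) := by rw [h.hpq' i hi j hj hij, neg_neg]
    have h₂ := h.hqq j hj i hi hij.symm
    exact ⟨e h₁ h₂, e h₂ h₁⟩

theorem commute_conjPair {a : A} {j : ℕ} (ha : a = p j ∨ a = q j) (hj : j < k) {m : ℕ}
    (hm : m ≤ j) : Commute a (conjPair p q m).1 ∧ Commute a (conjPair p q m).2 := by
  induction m with
  | zero => exact ⟨Commute.one_right _, Commute.zero_right _⟩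
  | succ m ih =>
    obtain ⟨h₁, h₂⟩ := ih (by omega)
    obtain ⟨h₃, h₄⟩ := h.commute_mul (i := m) ha (by omega) hj (by omega)
    exact ⟨(h₁.mul_right h₃).add_right (h₂.mul_right h₄),
      (h₁.mul_right h₄).add_right (h₂.mul_right h₃)⟩

/-- Because `p j` and `q j` have scalar squares, moving either of them across exchanges the two
products `p j * q j` and `q j * p j`. -/
theorem mul_conj {a : A} {j : ℕ} (ha : a = p j ∨ a = q j) (hj : j < k) :
    a * (p j * q j) = q j * p j * a ∧ a * (q j * p j) = p j * q j * a := by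
  obtain rfl | rfl := ha
  · refine ⟨?_, by rw [mul_assoc]⟩
    rw [← mul_assoc, h.hp j hj, mul_assoc, h.hp j hj, smul_mul_assoc, mul_smul_comm, one_mul,
      mul_one]
  · refine ⟨by rw [mul_assoc], ?_⟩
    rw [← mul_assoc, h.hq j hj, mul_assoc, h.hq j hj, smul_mul_assoc, mul_smul_comm, one_mul,
      mul_one]

/-- The components of the pair collect the terms with an even, respectively odd, number of factors
`q i * p i`. A generator of index below `m` reverses its own factor and commutes with all others, so
it exchanges the components. -/
theorem mul_conjPair {a : A} {j : ℕ} (ha : a = p j ∨ a = q j) {m : ℕ} (hm : j < m) (hk : m ≤ k) :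
    a * (conjPair p q m).1 = (conjPair p q m).2 * a ∧
      a * (conjPair p q m).2 = (conjPair p q m).1 * a := by
  induction m with
  | zero => omega
  | succ m ih =>
    simp only [conjPair, mul_add, add_mul, ← mul_assoc a]
    obtain hm | rfl := Nat.lt_succ_iff_lt_or_eq.mp hm
    · obtain ⟨h₁, h₂⟩ := ih hm (by omega)
      obtain ⟨h₃, h₄⟩ := h.commute_mul (i := m) ha (by omega) (by omega) (by omega)
      simp only [h₁, h₂, mul_assoc _ a, h₃.eq, h₄.eq]
      simp only [← mul_assoc]
      exact ⟨add_comm _ _, add_comm _ _⟩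
    · obtain ⟨h₁, h₂⟩ := h.commute_conjPair ha (by omega) le_rfl
      obtain ⟨h₃, h₄⟩ := h.mul_conj ha (by omega)
      simp only [h₁.eq, h₂.eq, mul_assoc _ a, h₃, h₄, and_self]
      simp only [← mul_assoc, and_self]

theorem commute_zeta {a : A} {j : ℕ} (ha : a = p j ∨ a = q j) (hj : j < k) {m : ℕ}
    (hm : m ≤ j) : Commute a (zeta p q m) :=
  (h.commute_conjPair ha hj hm).1.sub_right (h.commute_conjPair ha hj hm).2

theorem zeta_mul {a : A} {j : ℕ} (ha : a = p j ∨ a = q j) {m : ℕ} (hm : j < m) (hk : m ≤ k) :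
    zeta p q m * a = -(a * zeta p q m) := by
  obtain ⟨h₁, h₂⟩ := h.mul_conjPair ha hm hk
  rw [zeta, sub_mul, mul_sub, h₁, h₂, neg_sub]

theorem zeta_commute_mul {a b : A} {j : ℕ} (ha : a = p j ∨ a = q j) (hb : b = p j ∨ b = q j)
    (hj : j < k) {m : ℕ} (hm : m ≤ k) : Commute (zeta p q m) (a * b) := by
  by_cases hjm : j < m
  · change _ * _ = _ * _
    rw [← mul_assoc, h.zeta_mul ha hjm hm, neg_mul, mul_assoc, h.zeta_mul hb hjm hm, mul_neg,
      neg_neg, mul_assoc]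
  · exact (h.commute_zeta ha hj (by omega)).symm.mul_right
      (h.commute_zeta hb hj (by omega)).symm

theorem zeta_commute_zeta {m l : ℕ} (hm : m ≤ k) (hl : l ≤ k) :
    Commute (zeta p q m) (zeta p q l) := by
  induction l with
  | zero => simpa [zeta, conjPair] using Commute.one_right _
  | succ l ih =>
    rw [zeta_succ]
    exact (ih (by omega)).mul_right
      ((h.zeta_commute_mul (.inl rfl) (.inr rfl) (by omega) hm).sub_right
        (h.zeta_commute_mul (.inr rfl) (.inl rfl) (by omega) hm))

/-- The factors `p i * q i - q i * p i` commute with each other, and each squares to the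
discriminant of its binary form. -/
theorem zeta_mul_self {m : ℕ} (hm : m ≤ k) : zeta p q m * zeta p q m =
    (∏ i ∈ Finset.range m, (β i ^ 2 - 4 * α i * γ i)) • (1 : A) := by
  induction m with
  | zero => simp [zeta, conjPair]
  | succ m ih =>
    have hc : Commute (zeta p q m) (p m * q m - q m * p m) :=
      (h.zeta_commute_mul (.inl rfl) (.inr rfl) (by omega) (by omega)).sub_right
        (h.zeta_commute_mul (.inr rfl) (.inl rfl) (by omega) (by omega))
    have hz : (p m * q m - q m * p m) * (p m * q m - q m * p m) =
        (β m ^ 2 - 4 * α m * γ m) • (1 : A) := by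
      have e {a b c : A} (h : a * b = c) (t : A) : a * (b * t) = c * t := by rw [← mul_assoc, h]
      have h₁ := h.hp m (by omega)
      have h₂ := h.hq m (by omega)
      have h₃ := eq_sub_of_add_eq' (h.hpq m (by omega))
      simp only [mul_sub, sub_mul, mul_assoc, h₁, h₂, h₃, e h₁, e h₂, e h₃, smul_mul_assoc,
        mul_smul_comm, one_mul, mul_one]
      module
    rw [zeta_succ, hc.symm.mul_mul_mul_comm, ih (by omega), hz, Finset.prod_range_succ,
      smul_mul_smul_comm, one_mul]

/-- Two signs cancel: one because `a` and `b` anticommute, the other because `a` anticommutes with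
`zeta p q j`, which contains the factor of index `i`. This twist makes the quaternion algebras
commute. -/
theorem commute_zeta_mul {a b : A} {i j : ℕ} (ha : a = p i ∨ a = q i) (hb : b = p j ∨ b = q j)
    (hi : i < k) (hj : j < k) (hij : i < j) :
    Commute (zeta p q i * a) (zeta p q j * b) := by
  have h₁ := h.zeta_mul ha hij hj.le
  have h₂ := h.commute_zeta hb hj hij.le
  have h₃ := h.zeta_commute_zeta hi.le hj.le
  have h₄ : a * b = -(b * a) := by
    obtain rfl | rfl := ha <;> obtain rfl | rfl := hb
    · exact h.hpp i hi j hj hij.ne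
    · exact h.hpq' i hi j hj hij.ne
    · rw [h.hpq' j hj i hi hij.ne', neg_neg]
    · exact h.hqq i hi j hj hij.ne
  calc zeta p q i * a * (zeta p q j * b)
      = zeta p q i * -(-(a * zeta p q j)) * b := by simp only [neg_neg, mul_assoc]
    _ = zeta p q i * zeta p q j * -(a * b) := by
      rw [← h₁, mul_neg, neg_mul, mul_neg]; simp only [mul_assoc]
    _ = zeta p q j * (zeta p q i * b) * a := by
      rw [h₄, neg_neg, h₃.eq]; simp only [mul_assoc]
    _ = _ := by rw [← h₂.eq]; simp only [mul_assoc]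

theorem zeta_mul_mul {a b : A} {i : ℕ} (ha : a = p i ∨ a = q i) (hi : i < k) :
    zeta p q i * a * (zeta p q i * b) =
      (∏ j ∈ Finset.range i, (β j ^ 2 - 4 * α j * γ j)) • (a * b) := by
  rw [mul_assoc, ← mul_assoc a, (h.commute_zeta ha hi le_rfl).eq, ← mul_assoc, ← mul_assoc,
    h.zeta_mul_self hi.le, smul_mul_assoc, smul_mul_assoc, one_mul]

section Central

variable {x : A} {b : R} (hx : ∀ i < k, p i * x = (b • (1 : A) - x) * p i ∧
  q i * x = (b • (1 : A) - x) * q i)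
include hx

/-- Each generator conjugates `x` into `b - x`, so a product of two generators commutes with `x`. -/
theorem commute_conjPair_of_conj {m : ℕ} (hm : m ≤ k) :
    Commute x (conjPair p q m).1 ∧ Commute x (conjPair p q m).2 := by
  have e {u v : A} (hu : u * x = (b • (1 : A) - x) * u) (hv : v * x = (b • (1 : A) - x) * v) :
      Commute x (u * v) := by
    have hu' : x * u = u * (b • (1 : A) - x) := by
      rw [mul_sub, hu, sub_mul, mul_smul_comm, smul_mul_assoc, one_mul, mul_one, sub_sub_cancel]
    change x * (u * v) = u * v * x
    rw [← mul_assoc, hu', mul_assoc, ← hv, mul_assoc]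
  induction m with
  | zero => exact ⟨Commute.one_right _, Commute.zero_right _⟩
  | succ m ih =>
    obtain ⟨h₁, h₂⟩ := ih (by omega)
    obtain ⟨h₃, h₄⟩ := hx m (by omega)
    exact ⟨(h₁.mul_right (e h₃ h₄)).add_right (h₂.mul_right (e h₄ h₃)),
      (h₁.mul_right (e h₄ h₃)).add_right (h₂.mul_right (e h₃ h₄))⟩

/-- For the pair `(c, c')`, the element is `c * x + c' * (b - x)`. Conjugation by a generator
exchanges `c` with `c'` and `x` with `b - x`. No division by `2` is involved. -/
theorem commute_omega : Commute x (zeta p q k * x + b • (conjPair p q k).2) ∧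
    ∀ i < k, Commute (p i) (zeta p q k * x + b • (conjPair p q k).2) ∧
      Commute (q i) (zeta p q k * x + b • (conjPair p q k).2) := by
  obtain ⟨h₁, h₂⟩ := h.commute_conjPair_of_conj hx le_rfl
  refine ⟨((h₁.sub_right h₂).mul_right (Commute.refl x)).add_right (h₂.smul_right b), ?_⟩
  have e {a : A} (h₁ : a * (conjPair p q k).1 = (conjPair p q k).2 * a)
      (h₂ : a * (conjPair p q k).2 = (conjPair p q k).1 * a)
      (h₃ : a * x = (b • (1 : A) - x) * a) :
      Commute a (zeta p q k * x + b • (conjPair p q k).2) := by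
    change a * _ = _ * a
    rw [zeta, mul_add, sub_mul, mul_sub, ← mul_assoc, ← mul_assoc, h₁, h₂, mul_smul_comm, h₂,
      mul_assoc _ a, mul_assoc _ a, h₃]
    simp only [sub_mul, mul_sub, add_mul, smul_mul_assoc, mul_smul_comm, one_mul, mul_assoc]
    abel
  intro i hi
  obtain ⟨h₁, h₂⟩ := h.mul_conjPair (.inl rfl) hi le_rfl
  obtain ⟨h₃, h₄⟩ := h.mul_conjPair (.inr rfl) hi le_rfl
  exact ⟨e h₁ h₂ (hx i hi).1, e h₃ h₄ (hx i hi).2⟩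

end Central

theorem conjPair_mem {S : Subalgebra R A} {m : ℕ} (hS : ∀ i < m, p i ∈ S ∧ q i ∈ S) :
    (conjPair p q m).1 ∈ S ∧ (conjPair p q m).2 ∈ S := by
  induction m with
  | zero => exact ⟨one_mem S, zero_mem S⟩
  | succ m ih =>
    obtain ⟨h₁, h₂⟩ := ih fun i hi ↦ hS i (by omega)
    obtain ⟨h₃, h₄⟩ := hS m (by omega)
    exact ⟨add_mem (mul_mem h₁ (mul_mem h₃ h₄)) (mul_mem h₂ (mul_mem h₄ h₃)),
      add_mem (mul_mem h₁ (mul_mem h₄ h₃)) (mul_mem h₂ (mul_mem h₃ h₄))⟩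

theorem mem_of_prod_smul_mem {S : Subalgebra R A}
    (hd : ∀ i < k, ∀ a, (β i ^ 2 - 4 * α i * γ i) • a ∈ S → a ∈ S) {m : ℕ} (hm : m ≤ k) {a : A}
    (ha : (∏ j ∈ Finset.range m, (β j ^ 2 - 4 * α j * γ j)) • a ∈ S) : a ∈ S := by
  induction m generalizing a with
  | zero => simpa using ha
  | succ m ih =>
    rw [Finset.prod_range_succ, mul_smul] at ha
    exact hd m (by omega) _ (ih (by omega) ha)

/-- Untwisting: `zeta p q i` involves only pairs of index below `i`, already known to lie in `S`,
and its square is a product of discriminants, by which `S` admits division. -/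
theorem mem_of_zeta_mul_mem {S : Subalgebra R A}
    (hd : ∀ i < k, ∀ a, (β i ^ 2 - 4 * α i * γ i) • a ∈ S → a ∈ S)
    (hS : ∀ i < k, zeta p q i * p i ∈ S ∧ zeta p q i * q i ∈ S) {i : ℕ} (hi : i < k) :
    p i ∈ S ∧ q i ∈ S := by
  induction i using Nat.strong_induction_on with
  | h i ih =>
    obtain ⟨h₁, h₂⟩ := h.conjPair_mem (S := S) fun j hj ↦ ih j hj (hj.trans hi)
    have hz : zeta p q i ∈ S := sub_mem h₁ h₂
    have e {a : A} (ha : zeta p q i * a ∈ S) : a ∈ S := by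
      have := mul_mem hz ha
      rw [← mul_assoc, h.zeta_mul_self hi.le, smul_mul_assoc, one_mul] at this
      exact h.mem_of_prod_smul_mem hd hi.le this
    exact ⟨e (hS i hi).1, e (hS i hi).2⟩

/-- Subtracting `b • c'` from `ω` and multiplying by `zeta p q k` leaves a product of discriminants
times `x`. -/
theorem mem_of_omega_mem {S : Subalgebra R A}
    (hd : ∀ i < k, ∀ a, (β i ^ 2 - 4 * α i * γ i) • a ∈ S → a ∈ S)
    (hS : ∀ i < k, p i ∈ S ∧ q i ∈ S) {x : A} {b : R}
    (hω : zeta p q k * x + b • (conjPair p q k).2 ∈ S) : x ∈ S := by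
  obtain ⟨h₁, h₂⟩ := h.conjPair_mem hS
  have := mul_mem (show zeta p q k ∈ S from sub_mem h₁ h₂) (sub_mem hω (S.smul_mem h₂ b))
  rw [add_sub_cancel_right, ← mul_assoc, h.zeta_mul_self le_rfl, smul_mul_assoc, one_mul] at this
  exact h.mem_of_prod_smul_mem hd le_rfl this

end CliffordFamily

end CliffordFamily

end AzumayaCriterion

/-! ### Frames and balanced elements in the even Clifford algebra -/

namespace QuadraticMap.EvenClifford

open MulOpposite AzumayaCriterion

variable {R M N : Type*} [CommRing R] [AddCommGroup M] [Module R M] [AddCommGroup N] [Module R N]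
  (Q : QuadraticMap R M N)

/-- The element `u ⊗ v ⊗ φ` of the even Clifford algebra. -/
def br (φ : Module.Dual R N) (u v : M) : EvenClifford Q := ι Q (u ⊗ₜ (v ⊗ₜ φ))

variable {Q}

theorem br_self (φ : Module.Dual R N) (v : M) : br Q φ v v = φ (Q v) • (1 : EvenClifford Q) := by
  rw [br, ι_contract, Algebra.algebraMap_eq_smul_one]

theorem br_add_left (φ : Module.Dual R N) (u u' v : M) :
    br Q φ (u + u') v = br Q φ u v + br Q φ u' v := by
  simp only [br, add_tmul, map_add]

theorem br_add_right (φ : Module.Dual R N) (u v v' : M) :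
    br Q φ u (v + v') = br Q φ u v + br Q φ u v' := by
  simp only [br, add_tmul, tmul_add, map_add]

theorem br_smul_left (φ : Module.Dual R N) (r : R) (u v : M) :
    br Q φ (r • u) v = r • br Q φ u v := by
  simp only [br, ← smul_tmul', map_smul]

theorem br_smul_right (φ : Module.Dual R N) (r : R) (u v : M) :
    br Q φ u (r • v) = r • br Q φ u v := by
  simp only [br, ← smul_tmul', tmul_smul, map_smul]

theorem br_smul (φ : Module.Dual R N) (r : R) (u v : M) :
    br Q (r • φ) u v = r • br Q φ u v := by
  simp only [br, tmul_smul, map_smul]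

theorem br_add_br (φ : Module.Dual R N) (u v : M) :
    br Q φ u v + br Q φ v u = φ (polar Q u v) • (1 : EvenClifford Q) := by
  have h := br_self (Q := Q) φ (u + v)
  rw [br_add_left, br_add_right, br_add_right, br_self, br_self] at h
  rw [polar, map_sub, map_sub, sub_smul, sub_smul, ← h]
  abel

theorem br_mul_br (φ ψ : Module.Dual R N) (u v w : M) :
    br Q φ u v * br Q ψ v w = φ (Q v) • br Q ψ u w := ι_contract_mid Q u v w φ ψ

theorem br_mul_br_add (φ ψ : Module.Dual R N) (u v v' w : M) :
    br Q φ u v * br Q ψ v' w + br Q φ u v' * br Q ψ v w = φ (polar Q v v') • br Q ψ u w := by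
  have h := br_mul_br (Q := Q) φ ψ u (v + v') w
  rw [br_add_left, br_add_right, mul_add, add_mul, add_mul, br_mul_br, br_mul_br] at h
  rw [polar, map_sub, map_sub, sub_smul, sub_smul, ← h]
  abel

/-- In the Clifford algebra this is `c u c v = -c c u v`, as `c` and `u` anticommute. -/
theorem br_mul_br_of_orthogonal {φ : Module.Dual R N} {c u : M} (hu : φ (polar Q u c) = 0) (v : M) :
    br Q φ c u * br Q φ c v = -(φ (Q c) • br Q φ u v) := by
  have h := br_mul_br_add (Q := Q) φ φ c u c v
  rw [hu, zero_smul, br_self, smul_mul_assoc, one_mul] at h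
  exact eq_neg_of_add_eq_zero_left h

/-- The vectors which appear in an orthogonal frame. -/
def frameSet (k : ℕ) (p q : ℕ → M) (c w : M) : Set M :=
  {x | x = c ∨ x = w ∨ ∃ i < k, x = p i ∨ x = q i}

/-- After inverting `s`, the form `φ ∘ Q` is the orthogonal sum of the regular binary forms spanned
by `pᵢ` and `qᵢ` for `i < k` and of a binary form spanned by `c` and `w`, which takes a unit value
at `c`; and `φ` becomes a basis of the dual of `N`. -/
structure IsFrame (Q : QuadraticMap R M N) (s : R) (k : ℕ) (φ : Module.Dual R N) (p q : ℕ → M)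
    (c w : M) : Prop where
  dual : ∀ ψ : Module.Dual R N, ∃ (n : ℕ) (r : R), s ^ n • ψ = r • φ
  span : ∀ u : M, ∃ n : ℕ, s ^ n • u ∈ Submodule.span R (frameSet k p q c w)
  pp : ∀ i < k, ∀ j < k, i ≠ j → φ (polar Q (p i) (p j)) = 0
  qq : ∀ i < k, ∀ j < k, i ≠ j → φ (polar Q (q i) (q j)) = 0
  pq : ∀ i < k, ∀ j < k, i ≠ j → φ (polar Q (p i) (q j)) = 0
  pc : ∀ i < k, φ (polar Q (p i) c) = 0
  qc : ∀ i < k, φ (polar Q (q i) c) = 0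
  pw : ∀ i < k, φ (polar Q (p i) w) = 0
  qw : ∀ i < k, φ (polar Q (q i) w) = 0
  unit : ∃ n : ℕ, φ (Q c) ∣ s ^ n
  disc : ∀ i < k, ∃ n : ℕ,
    φ (polar Q (p i) (q i)) ^ 2 - 4 * φ (Q (p i)) * φ (Q (q i)) ∣ s ^ n

/-- The algebra is generated by the image of a finite module, so finitely many elements of the union
are involved and one term of the chain contains them all. -/
theorem exists_eq_top_of_forall_ι_mem [Module.Finite R M] [Module.Finite R (Module.Dual R N)]
    {S : ℕ → Subalgebra R (EvenClifford Q)} (hS : Monotone S)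
    (h : ∀ u v φ, br Q φ u v ∈ ⨆ n, S n) : ∃ n, S n = ⊤ := by
  classical
  obtain ⟨G, hG⟩ := (inferInstance : Module.Finite R (M ⊗[R] (M ⊗[R] Module.Dual R N))).fg_top
  have h₁ (t : M ⊗[R] (M ⊗[R] Module.Dual R N)) : ∃ n, ι Q t ∈ S n := by
    have : ι Q t ∈ ⨆ n, S n := by
      induction t with
      | zero => simp
      | add x y hx hy => rw [map_add]; exact add_mem hx hy
      | tmul u t =>
        induction t with
        | zero => simp
        | add x y hx hy => rw [tmul_add, map_add]; exact add_mem hx hy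
        | tmul v φ => exact h u v φ
    rwa [← SetLike.mem_coe, Subalgebra.coe_iSup_of_directed hS.directed_le, Set.mem_iUnion] at this
  choose m hm using h₁
  refine ⟨G.sup fun t ↦ m t, ?_⟩
  rw [eq_top_iff, ← adjoin_range_ι, Algebra.adjoin_le_iff]
  rintro _ ⟨t, rfl⟩
  have ht : t ∈ Submodule.span R (G : Set _) := hG ▸ Submodule.mem_top
  induction ht using Submodule.span_induction with
  | mem t ht => exact hS (Finset.le_sup (f := fun t ↦ m t) ht) (hm t)
  | zero => simp
  | add x y _ _ hx hy => rw [map_add]; exact add_mem hx hy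
  | smul r x _ hx => rw [map_smul]; exact Subalgebra.smul_mem _ hx r

/-- Such a chain stands in for a subalgebra of the localization at `s`: dividing by `s ^ m` costs
`m` steps, so the union admits division by every divisor of a power of `s`. -/
theorem mem_iSup_of_dvd {A : Type*} [Ring A] [Algebra R A] {s : R} {S : ℕ → Subalgebra R A}
    (hS : Monotone S) (hdiv : ∀ n m a, s ^ m • a ∈ S n → a ∈ S (n + m)) {D : R}
    (hD : ∃ n : ℕ, D ∣ s ^ n) {a : A} (ha : D • a ∈ ⨆ n, S n) : a ∈ ⨆ n, S n := by
  obtain ⟨m, t, ht⟩ := hD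
  rw [← SetLike.mem_coe, Subalgebra.coe_iSup_of_directed hS.directed_le, Set.mem_iUnion] at ha ⊢
  obtain ⟨n, hn⟩ := ha
  refine ⟨n + m, hdiv n m a ?_⟩
  rw [ht, mul_comm, mul_smul]
  exact Subalgebra.smul_mem _ hn t

theorem exists_mul_dvd_pow {s a b : R} (ha : ∃ n : ℕ, a ∣ s ^ n) (hb : ∃ n : ℕ, b ∣ s ^ n) :
    ∃ n : ℕ, a * b ∣ s ^ n := by
  obtain ⟨n, hn⟩ := ha
  obtain ⟨m, hm⟩ := hb
  exact ⟨n + m, by rw [pow_add]; exact mul_dvd_mul hn hm⟩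

theorem exists_prod_dvd_pow {s : R} {f : ℕ → R} {k : ℕ} (h : ∀ i < k, ∃ n : ℕ, f i ∣ s ^ n) :
    ∃ n : ℕ, ∏ i ∈ Finset.range k, f i ∣ s ^ n := by
  induction k with
  | zero => exact ⟨0, by simp⟩
  | succ k ih =>
    rw [Finset.prod_range_succ]
    exact exists_mul_dvd_pow (ih fun i hi ↦ h i (by omega)) (h k (by omega))

/-- The elements of `A` which balance `E`. -/
def balancer {R A Z : Type*} [CommRing R] [CommRing Z] [Ring A] [Algebra Z A] [Algebra R A]
    [Algebra R Z] [IsScalarTower R Z A] (E : A ⊗[Z] Aᵐᵒᵖ) : Subalgebra R A where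
  carrier := {a | BalancedBy a E}
  mul_mem' {a b} ha hb := by
    change _ * _ = _ * _ at ha hb ⊢
    have h₁ : (1 : A) ⊗ₜ[Z] op (a * b) = ((1 : A) ⊗ₜ[Z] op b) * ((1 : A) ⊗ₜ[Z] op a) := by simp
    have h₂ : (a * b) ⊗ₜ[Z] (1 : Aᵐᵒᵖ) = (a ⊗ₜ[Z] (1 : Aᵐᵒᵖ)) * (b ⊗ₜ[Z] (1 : Aᵐᵒᵖ)) := by simp
    have h₃ : ((1 : A) ⊗ₜ[Z] op b) * (a ⊗ₜ[Z] (1 : Aᵐᵒᵖ)) =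
      (a ⊗ₜ[Z] (1 : Aᵐᵒᵖ)) * ((1 : A) ⊗ₜ[Z] op b) := by simp
    rw [h₁, h₂, mul_assoc, ha, ← mul_assoc, h₃, mul_assoc, hb, mul_assoc]
  add_mem' {a b} ha hb := by
    change _ * _ = _ * _ at ha hb ⊢
    rw [op_add, tmul_add, add_tmul, add_mul, add_mul, ha, hb]
  algebraMap_mem' r := by
    change _ * _ = _ * _
    rw [IsScalarTower.algebraMap_apply R Z A, Algebra.algebraMap_eq_smul_one, op_smul, op_one,
      tmul_smul, smul_tmul']

variable {s : R} {k : ℕ} {φ : Module.Dual R N} {p q : ℕ → M} {c w : M}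

namespace IsFrame

variable (h : IsFrame Q s k φ p q c w)
include h

/-- After inverting `s`, the elements `c pᵢ`, `c qᵢ` and `c w` generate the even Clifford algebra.
Finiteness then gives a single exponent. -/
theorem exists_eq_top [Module.Finite R M] [Module.Finite R (Module.Dual R N)]
    {S : ℕ → Subalgebra R (EvenClifford Q)} (hS : Monotone S)
    (hdiv : ∀ n m a, s ^ m • a ∈ S n → a ∈ S (n + m))
    (hpq : ∀ i < k, br Q φ c (p i) ∈ ⨆ n, S n ∧ br Q φ c (q i) ∈ ⨆ n, S n)
    (hw : br Q φ c w ∈ ⨆ n, S n) : ∃ n, S n = ⊤ := by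
  have hpow (n : ℕ) : ∃ m, s ^ n ∣ s ^ m := ⟨n, dvd_rfl⟩
  have h₁ (u : M) : br Q φ c u ∈ ⨆ n, S n := by
    obtain ⟨n, hn⟩ := h.span u
    refine mem_iSup_of_dvd hS hdiv (hpow n) ?_
    rw [← br_smul_right]
    generalize s ^ n • u = t at hn
    induction hn using Submodule.span_induction with
    | mem x hx =>
      obtain rfl | rfl | ⟨i, hi, rfl | rfl⟩ := hx
      · rw [br_self]; exact Subalgebra.smul_mem _ (one_mem _) _
      · exact hw
      · exact (hpq i hi).1
      · exact (hpq i hi).2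
    | zero => simp [br]
    | add x y _ _ hx hy => rw [br_add_right]; exact add_mem hx hy
    | smul r x _ hx => rw [br_smul_right]; exact Subalgebra.smul_mem _ hx r
  have h₂ (u v : M) : br Q φ u v ∈ ⨆ n, S n := by
    refine mem_iSup_of_dvd hS hdiv h.unit ?_
    -- Inserting `c` in the middle gives `φ (Q c) • u v = (u c) (c v)`, and `u c` is a scalar minus
    -- `c u`.
    rw [← br_mul_br, eq_sub_of_add_eq (br_add_br φ u c)]
    exact mul_mem (sub_mem (Subalgebra.smul_mem _ (one_mem _) _) (h₁ u)) (h₁ v)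
  refine exists_eq_top_of_forall_ι_mem hS fun u v ψ ↦ ?_
  obtain ⟨n, r, hr⟩ := h.dual ψ
  refine mem_iSup_of_dvd hS hdiv (hpow n) ?_
  rw [← br_smul, hr, br_smul]
  exact Subalgebra.smul_mem _ (h₂ u v) r

/-- On vectors orthogonal to `c`, the map `u ↦ c u` satisfies the Clifford relations of the form `φ
∘ Q` scaled by `-φ (Q c)`. -/
theorem cliffordFamily : CliffordFamily k (fun i ↦ br Q φ c (p i)) (fun i ↦ br Q φ c (q i))
    (fun i ↦ -(φ (Q c) * φ (Q (p i)))) (fun i ↦ -(φ (Q c) * φ (polar Q (p i) (q i))))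
    (fun i ↦ -(φ (Q c) * φ (Q (q i)))) := by
  have e {u v : M} (hu : φ (polar Q u c) = 0) (hv : φ (polar Q v c) = 0) :
      br Q φ c u * br Q φ c v + br Q φ c v * br Q φ c u =
        (-(φ (Q c) * φ (polar Q u v))) • (1 : EvenClifford Q) := by
    rw [br_mul_br_of_orthogonal hu, br_mul_br_of_orthogonal hv, ← neg_add, ← smul_add, br_add_br,
      smul_smul, neg_smul]
  have e₀ {u v : M} (hu : φ (polar Q u c) = 0) (hv : φ (polar Q v c) = 0)
      (huv : φ (polar Q u v) = 0) :
      br Q φ c u * br Q φ c v = -(br Q φ c v * br Q φ c u) := by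
    have := e hu hv
    rw [huv, mul_zero, neg_zero, zero_smul] at this
    exact eq_neg_of_add_eq_zero_left this
  have e₁ {u : M} (hu : φ (polar Q u c) = 0) :
      br Q φ c u * br Q φ c u = (-(φ (Q c) * φ (Q u))) • (1 : EvenClifford Q) := by
    rw [br_mul_br_of_orthogonal hu, br_self, smul_smul, neg_smul]
  exact
    { hp := fun i hi ↦ e₁ (h.pc i hi)
      hq := fun i hi ↦ e₁ (h.qc i hi)
      hpq := fun i hi ↦ e (h.pc i hi) (h.qc i hi)
      hpp := fun i hi j hj hij ↦ e₀ (h.pc i hi) (h.pc j hj) (h.pp i hi j hj hij)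
      hqq := fun i hi j hj hij ↦ e₀ (h.qc i hi) (h.qc j hj) (h.qq i hi j hj hij)
      hpq' := fun i hi j hj hij ↦ e₀ (h.pc i hi) (h.qc j hj) (h.pq i hi j hj hij) }

/-- For `u` orthogonal to `c` and `w` one has `c u c w = -φ (Q c) u w = φ (Q c) w u = (w c) (c u)`,
and `w c` is the polar value minus `c w`. -/
theorem br_mul_conj : ∀ i < k,
    br Q φ c (p i) * br Q φ c w =
      (φ (polar Q c w) • (1 : EvenClifford Q) - br Q φ c w) * br Q φ c (p i) ∧
    br Q φ c (q i) * br Q φ c w =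
      (φ (polar Q c w) • (1 : EvenClifford Q) - br Q φ c w) * br Q φ c (q i) := by
  have e {u : M} (hc : φ (polar Q u c) = 0) (hw : φ (polar Q u w) = 0) :
      br Q φ c u * br Q φ c w =
        (φ (polar Q c w) • (1 : EvenClifford Q) - br Q φ c w) * br Q φ c u := by
    have h₁ := br_add_br (Q := Q) φ u w
    rw [hw, zero_smul] at h₁
    rw [br_mul_br_of_orthogonal hc, ← eq_sub_of_add_eq' (br_add_br φ c w), br_mul_br,
      ← smul_neg, eq_neg_of_add_eq_zero_left h₁, neg_neg]
  exact fun i hi ↦ ⟨e (h.pc i hi) (h.pw i hi), e (h.qc i hi) (h.qw i hi)⟩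

theorem exists_pow_smul_one_mem_balancedSpan [Module.Finite R M]
    [Module.Finite R (Module.Dual R N)] {Z : Type*} [CommRing Z] [Algebra Z (EvenClifford Q)]
    [Algebra R Z] [IsScalarTower R Z (EvenClifford Q)]
    (hcenter : ∀ a : EvenClifford Q, (∀ b, a * b = b * a) → ∃ z, algebraMap Z _ z = a) :
    ∃ n : ℕ, algebraMap R Z (s ^ n) • (1 : EvenClifford Q ⊗[Z] (EvenClifford Q)ᵐᵒᵖ) ∈
      balancedSpan Z (EvenClifford Q) := by
  set A := EvenClifford Q
  have hF := h.cliffordFamily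
  set P : ℕ → A := fun i ↦ br Q φ c (p i)
  set P' : ℕ → A := fun i ↦ br Q φ c (q i)
  set x : A := br Q φ c w
  obtain ⟨hω, hω'⟩ := hF.commute_omega h.br_mul_conj
  set ω : A := zeta P P' k * x + φ (polar Q c w) • (conjPair P P' k).2
  -- some multiple of `ω` is central
  obtain ⟨m, hm⟩ : ∃ m : ℕ, ∀ a : A, (s ^ m • ω) * a = a * (s ^ m • ω) := by
    -- `ω` commutes with the frame generators, but these generate `A` only after inverting `s`; the
    -- chain of centralizers produces the required power of `s`.
    let S (n : ℕ) : Subalgebra R A := Subalgebra.centralizer R {s ^ n • ω}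
    have hmem (n : ℕ) (a : A) : a ∈ S n ↔ (s ^ n • ω) * a = a * (s ^ n • ω) := by
      simp [S, Subalgebra.mem_centralizer_iff]
    have hS : Monotone S := monotone_nat_of_le_succ fun n a ha ↦ by
      rw [hmem] at ha ⊢
      rw [pow_succ', mul_smul, smul_mul_assoc, mul_smul_comm, ha]
    obtain ⟨m, hm⟩ := h.exists_eq_top hS (fun n m a ha ↦ by
        rw [hmem] at ha ⊢
        rw [pow_add, mul_comm, mul_smul, smul_mul_assoc, mul_smul_comm, ← mul_smul_comm, ha,
          smul_mul_assoc])
      (fun i hi ↦ ⟨le_iSup S 0 ((hmem _ _).mpr (by simpa using (hω' i hi).1.symm.eq)),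
        le_iSup S 0 ((hmem _ _).mpr (by simpa using (hω' i hi).2.symm.eq))⟩)
      (le_iSup S 0 ((hmem _ _).mpr (by simpa using hω.symm.eq)))
    exact ⟨m, fun a ↦ (hmem _ _).mp (hm ▸ Algebra.mem_top)⟩
  obtain ⟨E, hE, -, hEs⟩ := exists_balanced_of_commuting_quaternions (R := R)
    (T := A ⊗[Z] Aᵐᵒᵖ) (Algebra.TensorProduct.includeLeft : A →ₐ[R] A ⊗[Z] Aᵐᵒᵖ)
    ((Algebra.TensorProduct.includeRight : Aᵐᵒᵖ →ₐ[Z] A ⊗[Z] Aᵐᵒᵖ).restrictScalars R)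
    (fun a b ↦ by simp [Commute, SemiconjBy]) k
    (fun i ↦ zeta P P' i * P i) (fun i ↦ zeta P P' i * P' i) _ _ _
    (fun i hi ↦ by rw [hF.zeta_mul_mul (.inl rfl) hi, hF.hp i hi, smul_smul])
    (fun i hi ↦ by rw [hF.zeta_mul_mul (.inr rfl) hi, hF.hq i hi, smul_smul])
    (fun i hi ↦ by
      rw [hF.zeta_mul_mul (.inl rfl) hi, hF.zeta_mul_mul (.inr rfl) hi, ← smul_add, hF.hpq i hi,
        smul_smul])
    (fun i hi j hj hij ↦ by
      obtain hij | hij := hij.lt_or_gt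
      · exact ⟨hF.commute_zeta_mul (.inl rfl) (.inl rfl) hi hj hij,
          hF.commute_zeta_mul (.inl rfl) (.inr rfl) hi hj hij,
          hF.commute_zeta_mul (.inr rfl) (.inl rfl) hi hj hij,
          hF.commute_zeta_mul (.inr rfl) (.inr rfl) hi hj hij⟩
      · exact ⟨(hF.commute_zeta_mul (.inl rfl) (.inl rfl) hj hi hij).symm,
          (hF.commute_zeta_mul (.inr rfl) (.inl rfl) hj hi hij).symm,
          (hF.commute_zeta_mul (.inl rfl) (.inr rfl) hj hi hij).symm,
          (hF.commute_zeta_mul (.inr rfl) (.inr rfl) hj hi hij).symm⟩)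
  set l : A →ₐ[R] A ⊗[Z] Aᵐᵒᵖ := Algebra.TensorProduct.includeLeft
  set r : Aᵐᵒᵖ →ₐ[R] A ⊗[Z] Aᵐᵒᵖ :=
    (Algebra.TensorProduct.includeRight : Aᵐᵒᵖ →ₐ[Z] A ⊗[Z] Aᵐᵒᵖ).restrictScalars R
  -- some multiple of `E` is balanced by everything
  obtain ⟨n, hn⟩ : ∃ n : ℕ, ∀ a : A, BalancedBy a (s ^ n • E) := by
    let S (n : ℕ) : Subalgebra R A := balancer (R := R) (s ^ n • E)
    have hmem (n : ℕ) (a : A) : a ∈ S n ↔ s ^ n • (r (op a) * E) = s ^ n • (l a * E) := by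
      rw [← mul_smul_comm, ← mul_smul_comm]; rfl
    have hS : Monotone S := monotone_nat_of_le_succ fun n a ha ↦ by
      rw [hmem] at ha ⊢
      rw [pow_succ', mul_smul, mul_smul, ha]
    have hdiv (n m : ℕ) (a : A) (ha : s ^ m • a ∈ S n) : a ∈ S (n + m) := by
      rw [hmem] at ha ⊢
      rw [op_smul, map_smul, map_smul, smul_mul_assoc, smul_mul_assoc, smul_smul, smul_smul] at ha
      rw [pow_add, ha]
    have h₀ (a : A) (ha : r (op a) * E = l a * E) : a ∈ ⨆ n, S n :=
      le_iSup S 0 ((hmem _ _).mpr (by rw [ha]))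
    -- The discriminant of the pair `c pᵢ`, `c qᵢ` is `φ (Q c) ^ 2` times that of `pᵢ`, `qᵢ`, so
    -- three successive divisions suffice.
    have hdisc : ∀ i < k, ∀ a : A, ((-(φ (Q c) * φ (polar Q (p i) (q i)))) ^ 2 -
        4 * -(φ (Q c) * φ (Q (p i))) * -(φ (Q c) * φ (Q (q i)))) • a ∈ ⨆ n, S n →
        a ∈ ⨆ n, S n := by
      intro i hi a ha
      refine mem_iSup_of_dvd hS hdiv (h.disc i hi) (mem_iSup_of_dvd hS hdiv h.unit
        (mem_iSup_of_dvd hS hdiv h.unit ?_))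
      rw [smul_smul, smul_smul]
      convert ha using 2
      ring
    have hpq := fun i (hi : i < k) ↦ hF.mem_of_zeta_mul_mem hdisc
      (fun i hi ↦ ⟨h₀ _ (hE i hi).1, h₀ _ (hE i hi).2⟩) hi
    obtain ⟨z, hz⟩ := hcenter _ hm
    -- A central multiple of `ω` comes from `Z` and slides across the tensor product. No regularity
    -- of the form on `c`, `w` is needed.
    have hω₀ : ω ∈ ⨆ n, S n := by
      refine mem_iSup_of_dvd hS hdiv (D := s ^ m) ⟨m, dvd_rfl⟩ (h₀ _ ?_)
      rw [← hz]
      congr 1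
      change (1 : A) ⊗ₜ[Z] op (algebraMap Z A z) = algebraMap Z A z ⊗ₜ[Z] (1 : Aᵐᵒᵖ)
      rw [Algebra.algebraMap_eq_smul_one, op_smul, op_one, tmul_smul, smul_tmul']
    obtain ⟨n, hn⟩ := h.exists_eq_top hS hdiv hpq (hF.mem_of_omega_mem hdisc hpq hω₀)
    refine ⟨n, fun a ↦ ?_⟩
    have : a ∈ S n := hn ▸ Algebra.mem_top
    exact this
  -- Right multiplication by `l b` keeps `s ^ n • E` balanced, while left multiples by `l a` are
  -- allowed in `balancedSpan`.
  have hJ (t : A ⊗[Z] Aᵐᵒᵖ) (ht : t ∈ Submodule.span R {t | ∃ a b, t = l a * E * l b}) :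
      s ^ n • t ∈ balancedSpan Z A := by
    induction ht using Submodule.span_induction with
    | mem t ht =>
      obtain ⟨a, b, rfl⟩ := ht
      refine Submodule.subset_span ⟨a, (s ^ n • E) * l b, fun a ↦ ?_, ?_⟩
      · change _ * _ = _ * _
        rw [← mul_assoc, hn a, mul_assoc]
      · change _ = l a * _
        rw [mul_assoc, smul_mul_assoc, mul_smul_comm]
    | zero => simp
    | add x y _ _ hx hy => rw [smul_add]; exact add_mem hx hy
    | smul r x _ hx =>
      rw [smul_comm, ← algebraMap_smul Z r]
      exact Submodule.smul_mem _ _ hx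
  have hd : ∀ i < k, ∃ n : ℕ, (-(φ (Q c) * φ (polar Q (p i) (q i)))) ^ 2 -
      4 * -(φ (Q c) * φ (Q (p i))) * -(φ (Q c) * φ (Q (q i))) ∣ s ^ n := fun i hi ↦ by
    convert exists_mul_dvd_pow (exists_mul_dvd_pow h.unit h.unit) (h.disc i hi) using 3
    ring
  -- Twisting multiplies the `i`-th discriminant by the square of the product of the earlier ones;
  -- the Casimir identity then squares the result.
  obtain ⟨D, hD⟩ := exists_prod_dvd_pow (k := k) fun i hi ↦ by
    have h₁ := hd i hi
    have h₂ := exists_prod_dvd_pow (k := i) fun j hj ↦ hd j (hj.trans hi)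
    have h₃ := exists_mul_dvd_pow (exists_mul_dvd_pow h₂ h₂) h₁
    exact exists_mul_dvd_pow h₃ h₃
  refine ⟨n + D, ?_⟩
  obtain ⟨t, ht⟩ := hD
  have := Submodule.smul_mem _ (algebraMap R Z t) (hJ _ hEs)
  rw [algebraMap_smul] at this ⊢
  convert this using 1
  rw [smul_smul, smul_smul, pow_add, ht]
  congr 1
  rw [← mul_assoc (s ^ n), mul_comm (s ^ n * _) t, ← mul_assoc]
  congr 1
  exact Finset.prod_congr rfl fun i _ ↦ by ring

end IsFrame
end QuadraticMap.EvenClifford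

/-! ### From frames to Azumaya algebras; the commutative case -/

namespace QuadraticMap.EvenClifford

open MulOpposite AzumayaCriterion

variable {R M N : Type*} [CommRing R] [AddCommGroup M] [Module R M] [AddCommGroup N] [Module R N]
  {Q : QuadraticMap R M N}

theorem eq_top_of_span_eq_top (I : Ideal R) {X : Set R} (hX : Ideal.span X = ⊤)
    (h : ∀ s ∈ X, ∃ n : ℕ, s ^ n ∈ I) : I = ⊤ := by
  rw [← Ideal.radical_eq_top, eq_top_iff, ← hX, Ideal.span_le]
  exact h

section Azumaya

variable {Z : Type*} [CommRing Z] [Algebra Z (EvenClifford Q)]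
  [Algebra R Z] [IsScalarTower R Z (EvenClifford Q)]
  (hinj : Function.Injective (algebraMap Z (EvenClifford Q)))
  (hcenter : ∀ a : EvenClifford Q, (∀ b, a * b = b * a) → ∃ z, algebraMap Z _ z = a)
include hinj hcenter

/-- If the form has locally on the base an orthogonal frame, then its even Clifford algebra is
Azumaya over its center. -/
theorem isAzumaya_of_frames [Module.Finite R M] [Module.Finite R (Module.Dual R N)]
    (h : Ideal.span {s : R | ∃ k φ p q c w, IsFrame Q s k φ p q c w} = ⊤) :
    IsAzumaya Z (EvenClifford Q) := by
  refine isAzumaya_of_one_mem_balancedSpan hinj hcenter ?_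
  -- The scalars of `R` that carry `1 ⊗ 1` into `balancedSpan` form an ideal; each frame puts a
  -- power of its `s` into it.
  let I : Ideal R := Ideal.comap (algebraMap R Z) ((balancedSpan Z (EvenClifford Q)).comap
    (LinearMap.toSpanSingleton Z _ 1))
  have hI : I = ⊤ := by
    refine eq_top_of_span_eq_top I h ?_
    rintro s ⟨k, φ, p, q, c, w, hs⟩
    exact hs.exists_pow_smul_one_mem_balancedSpan hcenter
  have h₁ : algebraMap R Z 1 • (1 : EvenClifford Q ⊗[Z] (EvenClifford Q)ᵐᵒᵖ) ∈
      balancedSpan Z (EvenClifford Q) := (I.eq_top_iff_one.mp hI :)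
  rwa [map_one, one_smul] at h₁

-- Here every element of `A` comes from `Z` and slides across the tensor product, so `1 ⊗ 1` itself
-- is balanced.
omit [Algebra R Z] [IsScalarTower R Z (EvenClifford Q)] in
theorem isAzumaya_of_commute (h : ∀ a b : EvenClifford Q, a * b = b * a) :
    IsAzumaya Z (EvenClifford Q) := by
  refine isAzumaya_of_one_mem_balancedSpan hinj hcenter
    (Submodule.subset_span ⟨1, 1, fun a ↦ ?_, by simp [Algebra.TensorProduct.one_def]⟩)
  obtain ⟨z, rfl⟩ := hcenter a (h a)
  change _ * _ = _ * _
  rw [Algebra.algebraMap_eq_smul_one, op_smul, op_one, tmul_smul, smul_tmul']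

end Azumaya

/-- After inverting `s`, the module `M` is spanned by `x` and `y`, and the dual of `N` by `φ`. -/
structure IsSpannedByTwo (Q : QuadraticMap R M N) (s : R) (φ : Module.Dual R N) (x y : M) :
    Prop where
  dual : ∀ ψ : Module.Dual R N, ∃ (n : ℕ) (r : R), s ^ n • ψ = r • φ
  span : ∀ u : M, ∃ n : ℕ, s ^ n • u ∈ Submodule.span R {x, y}

/-- Since `x x` and `y y` are scalars and `y x` is a scalar minus `x y`, the single element `x y`
generates the algebra after inverting `s`. -/
theorem IsSpannedByTwo.exists_pow_smul_br_mem {s : R} {φ : Module.Dual R N} {x y : M}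
    (h : IsSpannedByTwo Q s φ x y) (u v : M) (ψ : Module.Dual R N) :
    ∃ n : ℕ, s ^ n • br Q ψ u v ∈ Algebra.adjoin R {br Q φ x y} := by
  obtain ⟨a, ha⟩ := h.span u
  obtain ⟨b, hb⟩ := h.span v
  obtain ⟨n, r, hr⟩ := h.dual ψ
  obtain ⟨a₁, a₂, ha⟩ := Submodule.mem_span_pair.mp ha
  obtain ⟨b₁, b₂, hb⟩ := Submodule.mem_span_pair.mp hb
  refine ⟨n + (a + b), ?_⟩
  have h₁ : br Q φ x y ∈ Algebra.adjoin R {br Q φ x y} := Algebra.self_mem_adjoin_singleton _ _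
  have e : s ^ (n + (a + b)) • br Q ψ u v = r • br Q φ (s ^ a • u) (s ^ b • v) := by
    have h₂ : s ^ n • br Q ψ u v = r • br Q φ u v := by rw [← br_smul, hr, br_smul]
    rw [br_smul_left, br_smul_right, pow_add, mul_comm, mul_smul, h₂, pow_add, smul_smul,
      smul_smul, smul_smul]
    congr 1
    ring
  rw [e, ← ha, ← hb]
  simp only [br_add_left, br_add_right, br_smul_left, br_smul_right, br_self,
    eq_sub_of_add_eq' (br_add_br φ x y)]
  refine Subalgebra.smul_mem _ (add_mem (Subalgebra.smul_mem _ (add_mem ?_ ?_) _)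
    (Subalgebra.smul_mem _ (add_mem ?_ ?_) _)) _
  · exact Subalgebra.smul_mem _ (Subalgebra.smul_mem _ (one_mem _) _) _
  · exact Subalgebra.smul_mem _ (sub_mem (Subalgebra.smul_mem _ (one_mem _) _) h₁) _
  · exact Subalgebra.smul_mem _ h₁ _
  · exact Subalgebra.smul_mem _ (Subalgebra.smul_mem _ (one_mem _) _) _

/-- The even Clifford algebra of a form of rank at most `2` is commutative. -/
theorem commute_of_isSpannedByTwo
    (h : Ideal.span {s : R | ∃ φ x y, IsSpannedByTwo Q s φ x y} = ⊤) (a b : EvenClifford Q) :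
    a * b = b * a := by
  have h₁ (u v : M) (ψ) (u' v' : M) (ψ') : br Q ψ u v * br Q ψ' u' v' =
      br Q ψ' u' v' * br Q ψ u v := by
    let I : Ideal R := LinearMap.ker (LinearMap.toSpanSingleton R _
      (br Q ψ u v * br Q ψ' u' v' - br Q ψ' u' v' * br Q ψ u v))
    have hI : I = ⊤ := by
      refine eq_top_of_span_eq_top I h ?_
      rintro s ⟨φ, x, y, hs⟩
      obtain ⟨n, hn⟩ := hs.exists_pow_smul_br_mem u v ψ
      obtain ⟨m, hm⟩ := hs.exists_pow_smul_br_mem u' v' ψ'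
      refine ⟨n + m, ?_⟩
      have hc := congrArg Subtype.val (mul_comm (⟨_, hn⟩ : Algebra.adjoin R {br Q φ x y}) ⟨_, hm⟩)
      simp only [MulMemClass.mk_mul_mk, smul_mul_smul_comm] at hc
      simp only [I, LinearMap.mem_ker, LinearMap.toSpanSingleton_apply, smul_sub, pow_add, hc]
      rw [mul_comm, sub_self]
    have : (1 : R) • (br Q ψ u v * br Q ψ' u' v' - br Q ψ' u' v' * br Q ψ u v) = 0 :=
      (I.eq_top_iff_one.mp hI :)
    rwa [one_smul, sub_eq_zero] at this
  have h₂ (u v : M) (ψ) (b : EvenClifford Q) : br Q ψ u v * b = b * br Q ψ u v := by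
    induction b using EvenClifford.induction with
    | algebraMap r => exact (Algebra.commutes _ _).symm
    | ι u' v' ψ' => exact h₁ u v ψ u' v' ψ'
    | mul x y hx hy => rw [← mul_assoc, hx, mul_assoc, hy, mul_assoc]
    | add x y hx hy => rw [mul_add, add_mul, hx, hy]
  induction a using EvenClifford.induction with
  | algebraMap r => exact Algebra.commutes _ _
  | ι u v ψ => exact h₂ u v ψ b
  | mul x y hx hy => rw [mul_assoc, hy, ← mul_assoc, hx, mul_assoc]
  | add x y hx hy => rw [mul_add, add_mul, hx, hy]

end QuadraticMap.EvenClifford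

/-! ### Orthogonalization at a point -/

namespace QuadraticMap

section Orthogonalization

variable {R M κ : Type*} [CommRing R] [AddCommGroup M] [Module R M] [Field κ] [Algebra R κ]

variable (R κ) in
/-- The elements of `X` lie in the span of `Y`, after localizing at the kernel of `R → κ`. -/
def SpannedAt (X Y : Set M) : Prop :=
  ∀ x ∈ X, ∃ s : R, algebraMap R κ s ≠ 0 ∧ s • x ∈ Submodule.span R Y

theorem SpannedAt.exists_of_mem_span {X Y : Set M} (h : SpannedAt R κ X Y) {x : M}
    (hx : x ∈ Submodule.span R X) : ∃ s : R, algebraMap R κ s ≠ 0 ∧ s • x ∈ Submodule.span R Y := by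
  induction hx using Submodule.span_induction with
  | mem x hx => exact h x hx
  | zero => exact ⟨1, by simp, by simp⟩
  | add x y _ _ hx hy =>
    obtain ⟨s, hs, hx⟩ := hx
    obtain ⟨t, ht, hy⟩ := hy
    refine ⟨s * t, by simp [hs, ht], ?_⟩
    rw [smul_add]
    refine add_mem ?_ ?_
    · rw [mul_comm, mul_smul]
      exact Submodule.smul_mem _ _ hx
    · rw [mul_smul]
      exact Submodule.smul_mem _ _ hy
  | smul r x _ hx =>
    obtain ⟨s, hs, hx⟩ := hx
    exact ⟨s, hs, by rw [smul_comm]; exact Submodule.smul_mem _ _ hx⟩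

theorem SpannedAt.of_subset_span {X Y : Set M} (h : X ⊆ Submodule.span R Y) : SpannedAt R κ X Y :=
  fun x hx ↦ ⟨1, by simp, by simpa using h hx⟩

theorem SpannedAt.trans {X Y W : Set M} (h : SpannedAt R κ X Y) (h' : SpannedAt R κ Y W) :
    SpannedAt R κ X W := by
  intro x hx
  obtain ⟨s, hs, hsx⟩ := h x hx
  obtain ⟨t, ht, htx⟩ := h'.exists_of_mem_span hsx
  exact ⟨t * s, by simp [hs, ht], by rwa [mul_smul]⟩

theorem SpannedAt.insert {X Y : Set M} (h : SpannedAt R κ X Y) (c : M) :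
    SpannedAt R κ (insert c X) (insert c Y) := by
  rintro x (rfl | hx)
  · exact ⟨1, by simp, by simpa using Submodule.subset_span (Set.mem_insert _ _)⟩
  · obtain ⟨s, hs, hx⟩ := h x hx
    exact ⟨s, hs, Submodule.span_mono (Set.subset_insert _ _) hx⟩

variable (q : QuadraticMap R M R)

/-- Orthogonalization of a quadratic form at a point at which `2` is invertible. -/
theorem exists_orthogonal_list (h2 : (2 : κ) ≠ 0) (n : ℕ) (L : List M) (hL : L.length = n) :
    ∃ g r : List M, g.length + r.length = n ∧
      SpannedAt R κ {x | x ∈ L} {x | x ∈ g ++ r} ∧ (∀ x ∈ g ++ r, x ∈ Submodule.span R {x | x ∈ L}) ∧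
      g.Pairwise (fun x y ↦ polar q x y = 0) ∧ (∀ x ∈ g, ∀ y ∈ r, polar q x y = 0) ∧
      (∀ x ∈ g, algebraMap R κ (q x) ≠ 0) ∧
      ∀ x ∈ r, ∀ y ∈ r, algebraMap R κ (polar q x y) = 0 := by
  induction n generalizing L with
  | zero =>
    obtain rfl := List.length_eq_zero_iff.mp hL
    exact ⟨[], [], by simp [SpannedAt]⟩
  | succ n ih =>
    by_cases hB : ∀ x ∈ L, ∀ y ∈ L, algebraMap R κ (polar q x y) = 0
    · exact ⟨[], L, by simpa using hL, SpannedAt.of_subset_span Submodule.subset_span,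
        fun x hx ↦ Submodule.subset_span hx, by simp, by simp, by simp, hB⟩
    obtain ⟨c, L', hc, hL', hcL, hqc⟩ : ∃ (c : M) (L' : List M), L'.length = n ∧
        SpannedAt R κ {x | x ∈ L} (insert c {x | x ∈ L'}) ∧
        (insert c {x | x ∈ L'} ⊆ (Submodule.span R {x | x ∈ L} : Set M)) ∧
        algebraMap R κ (q c) ≠ 0 := by
      have single (a : M) (ha : a ∈ L) (hqa : algebraMap R κ (q a) ≠ 0) :
          ∃ (c : M) (L' : List M), L'.length = n ∧
            SpannedAt R κ {x | x ∈ L} (insert c {x | x ∈ L'}) ∧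
            (insert c {x | x ∈ L'} ⊆ (Submodule.span R {x | x ∈ L} : Set M)) ∧
            algebraMap R κ (q c) ≠ 0 := by
        obtain ⟨s, t, rfl⟩ := List.append_of_mem ha
        refine ⟨a, s ++ t, by simp at hL ⊢; omega, .of_subset_span fun x hx ↦ ?_, fun x hx ↦ ?_, hqa⟩
        · refine Submodule.subset_span ?_
          simp at hx ⊢
          tauto
        · refine Submodule.subset_span ?_
          simp at hx ⊢
          tauto
      push Not at hB
      obtain ⟨a, ha, b, hb, hab⟩ := hB
      -- Given a polar value nonzero in `κ`, one of `a`, `b`, `a + b` has a nonzero value there: if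
      -- `q a` and `q b` vanish, `q (a + b)` reduces to the polar value.
      by_cases hqa : algebraMap R κ (q a) = 0
      swap
      · exact single a ha hqa
      by_cases hqb : algebraMap R κ (q b) = 0
      swap
      · exact single b hb hqb
      have hne : b ≠ a := by
        rintro rfl
        rw [polar_self, map_nsmul, hqa, smul_zero] at hab
        exact hab rfl
      obtain ⟨s, t, rfl⟩ := List.append_of_mem ha
      have hb' : b ∈ s ++ t := by
        simp at hb ⊢
        tauto
      have hb'' := Submodule.subset_span (R := R) (s := {x | x ∈ s ++ a :: t}) hb
      have ha'' := Submodule.subset_span (R := R) (s := {x | x ∈ s ++ a :: t}) ha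
      refine ⟨a + b, s ++ t, by simp at hL ⊢; omega, .of_subset_span fun x hx ↦ ?_, ?_, ?_⟩
      · by_cases hxa : x = a
        · have : x = (a + b) - b := by rw [hxa]; abel
          rw [this]
          exact sub_mem (Submodule.subset_span (Set.mem_insert _ _))
            (Submodule.subset_span (Set.mem_insert_of_mem _ hb'))
        · refine Submodule.subset_span (Set.mem_insert_of_mem _ ?_)
          simp at hx ⊢
          tauto
      · rintro x (rfl | hx)
        · exact add_mem ha'' hb''
        · refine Submodule.subset_span ?_
          simp at hx ⊢
          tauto
      · have : q (a + b) = polar q a b + q a + q b := by rw [polar]; ring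
        rw [this, map_add, map_add, hqa, hqb, add_zero, add_zero]
        exact hab
    -- The projection orthogonal to `c`, multiplied by `2 * q c` to avoid denominators.
    let u (x : M) : M := (2 * q c) • x - polar q c x • c
    have hu (x : M) : polar q c (u x) = 0 := by
      simp only [u, sub_eq_add_neg, ← neg_smul]
      rw [polar_add_right, polar_smul_right, polar_smul_right, polar_self]
      simp only [smul_eq_mul, nsmul_eq_mul, Nat.cast_ofNat]
      ring
    obtain ⟨g, r, hlen, hspan, hmem, hg, hgr, hq, hr⟩ := ih (L'.map u) (by simpa using hc)
    have hcspan (x : M) (hx : x ∈ Submodule.span R {x | x ∈ L'.map u}) : polar q c x = 0 := by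
      induction hx using Submodule.span_induction with
      | mem x hx =>
        obtain ⟨y, -, rfl⟩ := List.mem_map.mp hx
        exact hu y
      | zero => exact polar_zero_right q c
      | add x y _ _ hx hy => rw [polar_add_right, hx, hy, add_zero]
      | smul r x _ hx => rw [polar_smul_right, hx, smul_zero]
    refine ⟨c :: g, r, by simp only [List.length_cons]; omega, ?_, ?_, ?_, ?_, ?_, hr⟩
    · refine hL'.trans (SpannedAt.trans (Y := insert c {x | x ∈ L'.map u}) ?_ ?_)
      · rintro x (rfl | hx)
        · exact ⟨1, by simp, by simpa using Submodule.subset_span (Set.mem_insert _ _)⟩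
        · refine ⟨2 * q c, by rw [map_mul, map_ofNat]; exact mul_ne_zero h2 hqc, ?_⟩
          have : (2 * q c) • x = u x + polar q c x • c := by simp only [u]; abel
          rw [this]
          exact add_mem (Submodule.subset_span (Set.mem_insert_of_mem _ (List.mem_map_of_mem hx)))
            (Submodule.smul_mem _ _ (Submodule.subset_span (Set.mem_insert _ _)))
      · convert hspan.insert c using 1
        ext x
        simp
    · have hcs := hcL (Set.mem_insert _ _)
      intro x hx
      simp only [List.cons_append, List.mem_cons] at hx
      obtain rfl | hx := hx
      · exact hcs
      · refine Submodule.span_le.mpr ?_ (hmem x hx)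
        intro y hy
        obtain ⟨z, hz, rfl⟩ := List.mem_map.mp hy
        exact sub_mem (Submodule.smul_mem _ _ (hcL (Set.mem_insert_of_mem _ hz)))
          (Submodule.smul_mem _ _ hcs)
    · rw [List.pairwise_cons]
      exact ⟨fun x hx ↦ hcspan x (hmem x (by simp [hx])), hg⟩
    · intro x hx y hy
      obtain rfl | hx := List.mem_cons.mp hx
      · exact hcspan y (hmem y (by simp [hy]))
      · exact hgr x hx y hy
    · intro x hx
      obtain rfl | hx := List.mem_cons.mp hx
      · exact hqc
      · exact hq x hx

/-- Orthogonalization of a quadratic form at a point of residue characteristic `2`: it is the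
orthogonal sum of regular binary forms and of a form with a vanishing polar form. -/
theorem exists_orthogonal_pairs (h2 : (2 : κ) = 0) (n : ℕ) (L : List M) (hL : L.length ≤ n) :
    ∃ (g : List (M × M)) (r : List M), (g.flatMap fun p ↦ [p.1, p.2]).length + r.length = L.length ∧
      SpannedAt R κ {x | x ∈ L} {x | x ∈ (g.flatMap fun p ↦ [p.1, p.2]) ++ r} ∧
      (∀ x ∈ (g.flatMap fun p ↦ [p.1, p.2]) ++ r, x ∈ Submodule.span R {x | x ∈ L}) ∧
      g.Pairwise (fun a b ↦ ∀ x ∈ [a.1, a.2], ∀ y ∈ [b.1, b.2], polar q x y = 0) ∧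
      (∀ x ∈ g.flatMap fun p ↦ [p.1, p.2], ∀ y ∈ r, polar q x y = 0) ∧
      (∀ a ∈ g, algebraMap R κ (polar q a.1 a.2) ≠ 0) ∧
      ∀ x ∈ r, ∀ y ∈ r, algebraMap R κ (polar q x y) = 0 := by
  induction n generalizing L with
  | zero =>
    obtain rfl := List.length_eq_zero_iff.mp (Nat.le_zero.mp hL)
    exact ⟨[], [], by simp [SpannedAt]⟩
  | succ n ih =>
    by_cases hB : ∀ x ∈ L, ∀ y ∈ L, algebraMap R κ (polar q x y) = 0
    · exact ⟨[], L, by simp, SpannedAt.of_subset_span Submodule.subset_span,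
        fun x hx ↦ Submodule.subset_span hx, by simp, by simp, by simp, hB⟩
    push Not at hB
    obtain ⟨a, ha, b, hb, hab⟩ := hB
    have hne : b ≠ a := by
      rintro rfl
      rw [polar_self, map_nsmul, nsmul_eq_mul, Nat.cast_ofNat, h2, zero_mul] at hab
      exact hab rfl
    obtain ⟨L', hlen, hsub⟩ : ∃ L' : List M, L'.length + 2 = L.length ∧
        {x | x ∈ L} = insert a (insert b {x | x ∈ L'}) := by
      obtain ⟨s, t, rfl⟩ := List.append_of_mem ha
      have hb' : b ∈ s ++ t := by
        simp at hb ⊢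
        tauto
      obtain ⟨s', t', hst⟩ := List.append_of_mem hb'
      refine ⟨s' ++ t', ?_, ?_⟩
      · have := congrArg List.length hst
        simp at this ⊢
        omega
      · ext x
        have h₁ : x ∈ s ++ t ↔ x ∈ s' ++ b :: t' := by rw [hst]
        simp at h₁ ⊢
        tauto
    set d := polar q a b ^ 2 - 4 * q a * q b with hd
    -- Up to sign `d` is the Gram determinant of the polar form on `a`, `b`; as `2 = 0` in `κ`, it
    -- reduces to the square of the polar value.
    have hd' : algebraMap R κ d ≠ 0 := by
      have h4 : (4 : κ) = 0 := by rw [show (4 : κ) = 2 * 2 by norm_num, h2, mul_zero]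
      rw [hd, map_sub, map_mul, map_mul, map_ofNat, h4, zero_mul, zero_mul, sub_zero, map_pow]
      exact pow_ne_zero 2 hab
    -- Cramer's rule for the projection orthogonal to `a` and `b`, multiplied by `d`.
    let α (x : M) : R := 2 * q b * polar q a x - polar q a b * polar q b x
    let β (x : M) : R := 2 * q a * polar q b x - polar q a b * polar q a x
    let u (x : M) : M := d • x + (α x • a + β x • b)
    have hu (x : M) : polar q a (u x) = 0 ∧ polar q b (u x) = 0 := by
      constructor <;>
      · simp only [u, α, β]
        rw [polar_add_right, polar_add_right, polar_smul_right, polar_smul_right, polar_smul_right,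
          polar_self]
        simp only [smul_eq_mul, nsmul_eq_mul, Nat.cast_ofNat, hd, polar_comm q b a]
        ring
    obtain ⟨g, r, hlen', hspan, hmem, hg, hgr, hq, hr⟩ := ih (L'.map u)
      (by rw [List.length_map]; omega)
    have hcspan (x : M) (hx : x ∈ Submodule.span R {x | x ∈ L'.map u}) :
        polar q a x = 0 ∧ polar q b x = 0 := by
      induction hx using Submodule.span_induction with
      | mem x hx =>
        obtain ⟨y, -, rfl⟩ := List.mem_map.mp hx
        exact hu y
      | zero => exact ⟨polar_zero_right q a, polar_zero_right q b⟩
      | add x y _ _ hx hy => simp [polar_add_right, hx, hy]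
      | smul r x _ hx => simp [polar_smul_right, hx]
    rw [List.length_map] at hlen'
    refine ⟨(a, b) :: g, r, by
      simp only [List.flatMap_cons, List.length_append, List.length_cons, List.length_nil]
      omega, ?_, ?_, ?_, ?_, ?_, hr⟩
    · rw [hsub]
      refine SpannedAt.trans (Y := insert a (insert b {x | x ∈ L'.map u})) ?_ ?_
      · have h₁ : a ∈ Submodule.span R (insert a (insert b {x | x ∈ L'.map u})) :=
          Submodule.subset_span (Set.mem_insert _ _)
        have h₂ : b ∈ Submodule.span R (insert a (insert b {x | x ∈ L'.map u})) :=
          Submodule.subset_span (Set.mem_insert_of_mem _ (Set.mem_insert _ _))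
        rintro x (rfl | rfl | hx)
        · exact ⟨1, by simp, by simpa using h₁⟩
        · exact ⟨1, by simp, by simpa using h₂⟩
        · refine ⟨d, hd', ?_⟩
          have : d • x = u x - (α x • a + β x • b) := by simp only [u]; abel
          rw [this]
          exact sub_mem (Submodule.subset_span (Set.mem_insert_of_mem _ (Set.mem_insert_of_mem _
            (List.mem_map_of_mem hx)))) (add_mem (Submodule.smul_mem _ _ h₁)
              (Submodule.smul_mem _ _ h₂))
      · convert (hspan.insert b).insert a using 1
        ext x
        simp only [List.flatMap_cons, List.cons_append, List.nil_append, List.mem_cons]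
        rfl
    · have h₁ : a ∈ Submodule.span R {x | x ∈ L} := Submodule.subset_span ha
      have h₂ : b ∈ Submodule.span R {x | x ∈ L} := Submodule.subset_span hb
      intro x hx
      simp only [List.flatMap_cons, List.cons_append, List.nil_append, List.mem_cons] at hx
      obtain rfl | rfl | hx := hx
      · exact h₁
      · exact h₂
      · refine Submodule.span_le.mpr ?_ (hmem x hx)
        intro y hy
        obtain ⟨z, hz, rfl⟩ := List.mem_map.mp hy
        refine add_mem (Submodule.smul_mem _ _ (Submodule.subset_span ?_))
          (add_mem (Submodule.smul_mem _ _ h₁) (Submodule.smul_mem _ _ h₂))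
        rw [hsub]
        exact Set.mem_insert_of_mem _ (Set.mem_insert_of_mem _ hz)
    · rw [List.pairwise_cons]
      refine ⟨fun p hp x hx y hy ↦ ?_, hg⟩
      have hy' := hcspan y (hmem y (List.mem_append_left _ (List.mem_flatMap.mpr ⟨p, hp, hy⟩)))
      simp only [List.mem_cons, List.not_mem_nil, or_false] at hx
      obtain rfl | rfl := hx
      exacts [hy'.1, hy'.2]
    · intro x hx y hy
      have hy' := hcspan y (hmem y (List.mem_append_right _ hy))
      simp only [List.flatMap_cons, List.cons_append, List.nil_append, List.mem_cons] at hx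
      obtain rfl | rfl | hx := hx
      exacts [hy'.1, hy'.2, hgr x hx y hy]
    · intro p hp
      obtain rfl | hp := List.mem_cons.mp hp
      · exact hab
      · exact hq p hp

end Orthogonalization

end QuadraticMap

/-! ### Local bases and the dimension of the radical -/

namespace QuadraticMap

open EvenClifford

section LocalBasis

variable {R M N κ : Type*} [CommRing R] [AddCommGroup M] [Module R M] [AddCommGroup N] [Module R N]
  [Field κ] [Algebra R κ]

/-- After inverting `s`, the vectors `e` form a basis of `M`, the vector `l` a basis of `N` and the
form `φ` the dual basis. -/
structure IsLocalBasis (s : R) {n : ℕ} (e : Fin n → M) (l : N) (φ : Module.Dual R N) : Prop where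
  li : LinearIndependent R e
  span : ∀ u, s • u ∈ Submodule.span R (Set.range e)
  smul_eq : ∀ y, s • y = φ y • l
  apply : φ l = s

namespace IsLocalBasis

variable {s : R} {n : ℕ} {e : Fin n → M} {l : N} {φ : Module.Dual R N}
  (h : IsLocalBasis s e l φ)

theorem dual (h : IsLocalBasis s e l φ) (ψ : Module.Dual R N) : s • ψ = ψ l • φ := by
  ext y
  rw [LinearMap.smul_apply, LinearMap.smul_apply, ← map_smul, h.smul_eq, map_smul, smul_eq_mul,
    smul_eq_mul, mul_comm]

/-- The coordinates, multiplied by `s`. -/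
def coord : M →ₗ[R] Fin n → R :=
  (Finsupp.linearEquivFunOnFinite R R (Fin n)).toLinearMap ∘ₗ h.li.repr ∘ₗ
    (LinearMap.lsmul R M s).codRestrict _ h.span

theorem sum_coord (u : M) : ∑ i, h.coord u i • e i = s • u := by
  have := h.li.linearCombination_repr ⟨s • u, h.span u⟩
  rw [Finsupp.linearCombination_apply, Finsupp.sum_fintype _ _ (by simp)] at this
  exact this

theorem coord_apply (i : Fin n) : h.coord (e i) = s • Pi.single i 1 := by
  have h₁ := h.sum_coord (e i)
  have h₂ := Fintype.linearIndependent_iff.mp h.li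
    (fun j ↦ h.coord (e i) j - (s • (Pi.single i 1 : Fin n → R)) j) ?_
  · ext j
    exact sub_eq_zero.mp (h₂ j)
  · simp only [sub_smul, Finset.sum_sub_distrib, h₁, sub_eq_zero]
    rw [Finset.sum_eq_single i]
    · simp
    · intro j _ hj
      simp [hj]
    · simp

/-- Inverting `s` and the denominators supplied by `SpannedAt` makes `Y` generate `M`, and all these
scalars are units in `κ`. -/
theorem span_tmul_eq_top {Y : Set M} (h : IsLocalBasis s e l φ) (hs : algebraMap R κ s ≠ 0)
    (hY : SpannedAt R κ (Set.range e) Y) :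
    Submodule.span κ ((fun y : M ↦ (1 : κ) ⊗ₜ[R] y) '' Y) = ⊤ := by
  rw [eq_top_iff]
  rintro t -
  have h₁ (y : M) (hy : y ∈ Submodule.span R Y) : (1 : κ) ⊗ₜ[R] y ∈
      Submodule.span κ ((fun y : M ↦ (1 : κ) ⊗ₜ[R] y) '' Y) := by
    induction hy using Submodule.span_induction with
    | mem x hx => exact Submodule.subset_span ⟨x, hx, rfl⟩
    | zero => simp
    | add x y _ _ hx hy => rw [tmul_add]; exact add_mem hx hy
    | smul r x _ hx =>
      rw [tmul_smul, ← algebraMap_smul κ r]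
      exact Submodule.smul_mem _ _ hx
  induction t with
  | zero => simp
  | add x y hx hy => exact add_mem hx hy
  | tmul a u =>
    obtain ⟨t, ht, hu⟩ := hY.exists_of_mem_span (h.span u)
    have : a ⊗ₜ[R] u = (a * (algebraMap R κ t * algebraMap R κ s)⁻¹) • ((1 : κ) ⊗ₜ[R] (t • s • u)) := by
      rw [smul_smul, tmul_smul, ← algebraMap_smul κ (t * s), smul_smul, map_mul, smul_tmul',
        smul_eq_mul, mul_one, inv_mul_cancel_right₀ (mul_ne_zero ht hs)]
    rw [this]
    exact Submodule.smul_mem _ _ (h₁ _ hu)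

-- The coordinates scaled by `s` extend to the fibre and send the vectors `1 ⊗ e i` to `s` times the
-- standard basis.
include h in
theorem linearIndependent_tmul (hs : algebraMap R κ s ≠ 0) :
    LinearIndependent κ fun i ↦ (1 : κ) ⊗ₜ[R] e i := by
  let g : M →ₗ[R] Fin n → κ := (Algebra.linearMap R κ).compLeft (Fin n) ∘ₗ h.coord
  refine LinearIndependent.of_comp (g.liftBaseChange κ) ?_
  have : (g.liftBaseChange κ : _ → _) ∘ (fun i ↦ (1 : κ) ⊗ₜ[R] e i) =
      fun i ↦ (Units.mk0 _ hs) • (Pi.basisFun κ (Fin n) i) := by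
    ext i j
    by_cases hij : j = i <;>
      simp [g, h.coord_apply, Units.smul_def, hij, Algebra.algebraMap_eq_smul_one]
  rw [this]
  exact (Pi.basisFun κ (Fin n)).linearIndependent.units_smul fun _ ↦ Units.mk0 _ hs

theorem finrank_eq (h : IsLocalBasis s e l φ) (hs : algebraMap R κ s ≠ 0) :
    Module.finrank κ (κ ⊗[R] M) = n := by
  have h₁ := h.span_tmul_eq_top hs (SpannedAt.of_subset_span Submodule.subset_span)
  rw [← Set.range_comp] at h₁
  have := Module.finrank_eq_card_basis (Module.Basis.mk (h.linearIndependent_tmul hs) h₁.ge)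
  simpa using this

/-- In the fibre, `φ` is up to the unit `s` the coordinate along `l`, so orthogonality may be tested
after applying `φ`, and on the spanning set `Y` only. -/
theorem tmul_mem_ker {Q : QuadraticMap R M N} {Y : Set M} (h : IsLocalBasis s e l φ)
    (hs : algebraMap R κ s ≠ 0)
    (hY : SpannedAt R κ (Set.range e) Y) {a : M}
    (ha : ∀ y ∈ Y, algebraMap R κ (φ (polar Q a y)) = 0) :
    (1 : κ) ⊗ₜ[R] a ∈ LinearMap.ker (Q.polarBilin.baseChange κ) := by
  rw [LinearMap.mem_ker]
  refine LinearMap.ext_on (h.span_tmul_eq_top hs hY) ?_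
  rintro _ ⟨y, hy, rfl⟩
  have h₁ : algebraMap R κ s • ((1 : κ) ⊗ₜ[R] polar Q a y) = 0 := by
    rw [algebraMap_smul, ← tmul_smul, h.smul_eq, tmul_smul, ← algebraMap_smul κ, ha y hy, zero_smul]
  have h₂ := (smul_eq_zero.mp h₁).resolve_left hs
  simpa using h₂

/-- By a count, `g ++ r` gives a basis of the fibre, and its members from `r` lie in the radical; so
the length of `r` is bounded by the dimension of the radical. -/
theorem length_le_one {Q : QuadraticMap R M N} (h : IsLocalBasis s e l φ)
    (hs : algebraMap R κ s ≠ 0)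
    (hker : Module.finrank κ (LinearMap.ker (Q.polarBilin.baseChange κ)) ≤ 1) {g r : List M}
    (hn : g.length + r.length = n) (hgr : SpannedAt R κ (Set.range e) {x | x ∈ g ++ r})
    (horth : ∀ x ∈ g, ∀ y ∈ r, φ (polar Q x y) = 0)
    (hr : ∀ x ∈ r, ∀ y ∈ r, algebraMap R κ (φ (polar Q x y)) = 0) : r.length ≤ 1 := by
  have := h.finrank_eq hs
  let v (i : Fin n) : κ ⊗[R] M := 1 ⊗ₜ[R] (g ++ r).get (i.cast (by simp [hn]))
  have hv : LinearIndependent κ v := by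
    refine linearIndependent_of_top_le_span_of_card_eq_finrank ?_ (by simp [this])
    rw [← h.span_tmul_eq_top hs hgr]
    refine Submodule.span_mono ?_
    rintro _ ⟨x, hx, rfl⟩
    obtain ⟨i, rfl⟩ := List.mem_iff_get.mp hx
    exact ⟨i.cast (by simp [hn]), by simp [v]⟩
  by_contra! hlt
  let j (i : Fin 2) : Fin n := ⟨g.length + i, by omega⟩
  have hj : Function.Injective j := fun a b hab ↦ by
    simpa [j, Fin.ext_iff] using hab
  have hmem (i : Fin 2) : v (j i) ∈ LinearMap.ker (Q.polarBilin.baseChange κ) := by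
    refine h.tmul_mem_ker hs hgr fun y hy ↦ ?_
    have hx : (g ++ r).get ((j i).cast (by simp [hn])) ∈ r := by
      simp [j]
    generalize (g ++ r).get ((j i).cast (by simp [hn])) = x at hx
    rcases List.mem_append.mp hy with hy | hy
    · rw [polar_comm, horth y hy x hx, map_zero]
    · exact hr x hx y hy
  have hli : LinearIndependent κ (fun i : Fin 2 ↦
      (⟨v (j i), hmem i⟩ : LinearMap.ker (Q.polarBilin.baseChange κ))) :=
    LinearIndependent.of_comp (Submodule.subtype _) (hv.comp j hj)
  have : Module.Finite κ (κ ⊗[R] M) := by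
    by_contra hinf
    have := Module.finrank_of_not_finite hinf
    omega
  have := hli.fintype_card_le_finrank
  simp at this
  omega

theorem exists_isFrame {Q : QuadraticMap R M N} (h : IsLocalBasis s e l φ)
    (hs : algebraMap R κ s ≠ 0) {k : ℕ} {p q : ℕ → M} {c w : M}
    (hspan : SpannedAt R κ (Set.range e) (frameSet k p q c w))
    (pp : ∀ i < k, ∀ j < k, i ≠ j → φ (polar Q (p i) (p j)) = 0)
    (qq : ∀ i < k, ∀ j < k, i ≠ j → φ (polar Q (q i) (q j)) = 0)
    (pq : ∀ i < k, ∀ j < k, i ≠ j → φ (polar Q (p i) (q j)) = 0)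
    (pc : ∀ i < k, φ (polar Q (p i) c) = 0) (qc : ∀ i < k, φ (polar Q (q i) c) = 0)
    (pw : ∀ i < k, φ (polar Q (p i) w) = 0) (qw : ∀ i < k, φ (polar Q (q i) w) = 0)
    (unit : algebraMap R κ (φ (Q c)) ≠ 0)
    (disc : ∀ i < k, algebraMap R κ
      (φ (polar Q (p i) (q i)) ^ 2 - 4 * φ (Q (p i)) * φ (Q (q i))) ≠ 0) :
    ∃ s' : R, algebraMap R κ s' ≠ 0 ∧ IsFrame Q s' k φ p q c w := by
  choose t ht htmem using fun i ↦ hspan (e i) ⟨i, rfl⟩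
  -- One scalar that every denominator and every required unit divides: `s`, the `t i` expressing
  -- the basis in the frame, the value at `c` and all discriminants.
  refine ⟨s * (∏ i, t i) * φ (Q c) *
    ∏ i ∈ Finset.range k, (φ (polar Q (p i) (q i)) ^ 2 - 4 * φ (Q (p i)) * φ (Q (q i))), ?_, ?_⟩
  · simp only [map_mul, map_prod]
    refine mul_ne_zero (mul_ne_zero (mul_ne_zero hs ?_) unit) ?_
    · exact Finset.prod_ne_zero_iff.mpr fun i _ ↦ ht i
    · exact Finset.prod_ne_zero_iff.mpr fun i hi ↦ disc i (Finset.mem_range.mp hi)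
  · set d := ∏ i ∈ Finset.range k, (φ (polar Q (p i) (q i)) ^ 2 - 4 * φ (Q (p i)) * φ (Q (q i)))
    refine ⟨fun ψ ↦ ⟨1, (∏ i, t i) * φ (Q c) * d * ψ l, ?_⟩, fun u ↦ ⟨1, ?_⟩, pp, qq, pq, pc, qc,
      pw, qw, ⟨1, ?_⟩, fun i hi ↦ ⟨1, ?_⟩⟩
    · rw [mul_smul _ (ψ l), ← h.dual, smul_smul, pow_one]
      congr 1
      ring
    · have h₁ : (∏ i, t i) • s • u ∈ Submodule.span R (frameSet k p q c w) := by
        have := h.span u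
        generalize s • u = y at this
        induction this using Submodule.span_induction with
        | mem x hx =>
          obtain ⟨i, rfl⟩ := hx
          obtain ⟨b, hb⟩ := Finset.dvd_prod_of_mem t (Finset.mem_univ i)
          rw [hb, mul_comm, mul_smul]
          exact Submodule.smul_mem _ _ (htmem i)
        | zero => simp
        | add x y _ _ hx hy => rw [smul_add]; exact add_mem hx hy
        | smul r x _ hx => rw [smul_comm]; exact Submodule.smul_mem _ _ hx
      have h₂ := Submodule.smul_mem _ (φ (Q c) * d) h₁
      rw [smul_smul, smul_smul] at h₂
      convert h₂ using 2
      ring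
    · rw [pow_one, mul_assoc]
      exact (dvd_mul_right _ _).mul_left _
    · rw [pow_one]
      exact (Finset.dvd_prod_of_mem
        (fun i ↦ φ (polar Q (p i) (q i)) ^ 2 - 4 * φ (Q (p i)) * φ (Q (q i)))
        (Finset.mem_range.mpr hi)).mul_left _

end IsLocalBasis

end LocalBasis

end QuadraticMap

/-! ### Existence of frames where the radical is small -/

namespace QuadraticMap

open EvenClifford

variable {R M N κ : Type*} [CommRing R] [AddCommGroup M] [Module R M] [AddCommGroup N] [Module R N]
  [Field κ] [Algebra R κ]

theorem pairwise_getD {α : Type*} {r : α → α → Prop} {L : List α} (hr : L.Pairwise r)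
    (d : α) {i j : ℕ} (hij : i < j) (hj : j < L.length) :
    r (L.getD i d) (L.getD j d) := by
  rw [List.getD_eq_getElem _ _ hj, List.getD_eq_getElem _ _ (hij.trans hj)]
  exact List.pairwise_iff_getElem.mp hr i j _ _ hij

theorem length_flatMap_pair {α : Type*} (g : List (α × α)) :
    (g.flatMap fun p ↦ [p.1, p.2]).length = 2 * g.length := by
  induction g with
  | nil => rfl
  | cons a g ih => simp only [List.flatMap_cons, List.length_append, ih, List.length_cons,
      List.length_nil]; omega

/-- A form which has at a point a radical of dimension at most `1` has an orthogonal frame in a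
neighbourhood of this point. -/
theorem IsLocalBasis.exists_isFrame_of_finrank_le_one {s : R} {n : ℕ} {e : Fin n → M} {l : N}
    {φ : Module.Dual R N} {Q : QuadraticMap R M N} (h : IsLocalBasis s e l φ)
    (hs : algebraMap R κ s ≠ 0) {k : ℕ} (hk : n = 2 * k + 2)
    (hker : Module.finrank κ (LinearMap.ker (Q.polarBilin.baseChange κ)) ≤ 1) :
    ∃ (s' : R) (p q : ℕ → M) (c w : M),
      algebraMap R κ s' ≠ 0 ∧ IsFrame Q s' k φ p q c w := by
  set q₀ : QuadraticMap R M R := φ.compQuadraticMap Q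
  have hpol (x y : M) : polar q₀ x y = φ (polar Q x y) := by
    simp [q₀, polar, map_sub]
  have hLe : {x | x ∈ List.ofFn e} = Set.range e := by
    ext x
    simp [List.mem_ofFn]
  by_cases h2 : (2 : κ) = 0
  · obtain ⟨g, r, hlen, hspan, -, hg, hgr, hq, hr⟩ :=
      exists_orthogonal_pairs (κ := κ) q₀ h2 n (List.ofFn e) (by simp)
    rw [hLe] at hspan
    simp only [hpol] at hg hgr hq hr
    have hr1 := h.length_le_one hs hker (by simpa using hlen) hspan hgr hr
    rw [length_flatMap_pair, List.length_ofFn] at hlen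
    -- The regular part has even length and so has the whole list; a remainder of length at most `1`
    -- must therefore be empty.
    obtain rfl : r = [] := List.length_eq_zero_iff.mp (by omega)
    have hgk : g.length = k + 1 := by simp at hlen; omega
    rw [List.append_nil] at hspan
    let f (i : ℕ) : M × M := g.getD i 0
    have hf (i : ℕ) (hi : i < k + 1) : f i ∈ g := by
      simp only [f, List.getD_eq_getElem _ _ (hgk ▸ hi)]
      exact List.getElem_mem _
    have horth (i j : ℕ) (hi : i < k + 1) (hj : j < k + 1) (hij : i ≠ j) :
        ∀ x ∈ [(f i).1, (f i).2], ∀ y ∈ [(f j).1, (f j).2], φ (polar Q x y) = 0 := by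
      obtain hij | hij := hij.lt_or_gt
      · exact pairwise_getD hg 0 hij (by omega)
      · intro x hx y hy
        rw [polar_comm]
        exact pairwise_getD hg 0 hij (by omega) y hy x hx
    have h4 : (4 : κ) = 0 := by rw [show (4 : κ) = 2 * 2 by norm_num, h2, mul_zero]
    -- The last regular plane provides `c` and `w`. Its given basis may consist of vectors whose
    -- values vanish in `κ`; then the sum of the two serves as `c`.
    obtain ⟨c, w, hcw, h₁, h₂, hc⟩ : ∃ c w : M,
        (∀ u, φ (polar Q u (f k).1) = 0 → φ (polar Q u (f k).2) = 0 →
          φ (polar Q u c) = 0 ∧ φ (polar Q u w) = 0) ∧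
        (f k).1 ∈ Submodule.span R {c, w} ∧ (f k).2 ∈ Submodule.span R {c, w} ∧
        algebraMap R κ (φ (Q c)) ≠ 0 := by
      by_cases ha : algebraMap R κ (φ (Q (f k).1)) = 0
      swap
      · exact ⟨(f k).1, (f k).2, fun u h h' ↦ ⟨h, h'⟩, Submodule.subset_span (by simp),
          Submodule.subset_span (by simp), ha⟩
      by_cases hb : algebraMap R κ (φ (Q (f k).2)) = 0
      swap
      · exact ⟨(f k).2, (f k).1, fun u h h' ↦ ⟨h', h⟩, Submodule.subset_span (by simp),
          Submodule.subset_span (by simp), hb⟩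
      refine ⟨(f k).1 + (f k).2, (f k).2, fun u h h' ↦ ⟨?_, h'⟩, ?_,
        Submodule.subset_span (by simp), ?_⟩
      · rw [polar_add_right, map_add, h, h', add_zero]
      · exact Submodule.mem_span_pair.mpr ⟨1, -1, by module⟩
      · have : Q ((f k).1 + (f k).2) = polar Q (f k).1 (f k).2 + Q (f k).1 + Q (f k).2 := by
          rw [polar]; abel
        rw [this, map_add, map_add, map_add, map_add, ha, hb, add_zero, add_zero]
        exact hq _ (hf k (by omega))
    have ho (i : ℕ) (hi : i < k) := horth i k (by omega) (by omega) (by omega)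
    have hsp : SpannedAt R κ (Set.range e)
        (frameSet k (fun i ↦ (f i).1) (fun i ↦ (f i).2) c w) := by
      refine hspan.trans (.of_subset_span fun x hx ↦ ?_)
      have hsub : ({c, w} : Set M) ⊆ frameSet k (fun i ↦ (f i).1) (fun i ↦ (f i).2) c w := by
        rintro y (rfl | rfl)
        exacts [.inl rfl, .inr (.inl rfl)]
      obtain ⟨a, ha, hx⟩ := List.mem_flatMap.mp hx
      obtain ⟨i, hi, rfl⟩ := List.mem_iff_getElem.mp ha
      have hfi : g[i] = f i := (List.getD_eq_getElem _ _ hi).symm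
      rw [hfi] at hx
      by_cases hik : i = k
      · subst hik
        have hx' : x = (f i).1 ∨ x = (f i).2 := by simpa using hx
        obtain rfl | rfl := hx'
        · exact Submodule.span_mono hsub h₁
        · exact Submodule.span_mono hsub h₂
      · exact Submodule.subset_span (.inr (.inr ⟨i, by omega, by simpa using hx⟩))
    obtain ⟨s', hs', hF⟩ := h.exists_isFrame (Q := Q) hs (k := k) (p := fun i ↦ (f i).1)
      (q := fun i ↦ (f i).2) (c := c) (w := w)
      hsp
      (fun i hi j hj hij ↦ horth i j (by omega) (by omega) hij _ (by simp) _ (by simp))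
      (fun i hi j hj hij ↦ horth i j (by omega) (by omega) hij _ (by simp) _ (by simp))
      (fun i hi j hj hij ↦ horth i j (by omega) (by omega) hij _ (by simp) _ (by simp))
      (fun i hi ↦ (hcw _ (ho i hi _ (by simp) _ (by simp)) (ho i hi _ (by simp) _ (by simp))).1)
      (fun i hi ↦ (hcw _ (ho i hi _ (by simp) _ (by simp)) (ho i hi _ (by simp) _ (by simp))).1)
      (fun i hi ↦ (hcw _ (ho i hi _ (by simp) _ (by simp)) (ho i hi _ (by simp) _ (by simp))).2)
      (fun i hi ↦ (hcw _ (ho i hi _ (by simp) _ (by simp)) (ho i hi _ (by simp) _ (by simp))).2)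
      hc
      (fun i hi ↦ by
        rw [map_sub, map_mul, map_mul, map_ofNat, h4, zero_mul, zero_mul, sub_zero, map_pow]
        exact pow_ne_zero 2 (hq _ (hf i (by omega))))
    exact ⟨s', _, _, c, w, hs', hF⟩
  · obtain ⟨g, r, hlen, hspan, -, hg, hgr, hq, hr⟩ :=
      exists_orthogonal_list (κ := κ) q₀ h2 n (List.ofFn e) (by simp)
    rw [hLe] at hspan
    simp only [hpol] at hg hgr hr
    have hr1 := h.length_le_one hs hker hlen hspan hgr hr
    -- With at most one vector in `r`, orthogonality inside `r` is vacuous.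
    have hpw : (g ++ r).Pairwise fun x y ↦ φ (polar Q x y) = 0 := by
      refine List.pairwise_append.mpr ⟨hg, ?_, hgr⟩
      match r, hr1 with
      | [], _ => exact List.Pairwise.nil
      | [a], _ => exact List.pairwise_singleton _ a
    let f (i : ℕ) : M := (g ++ r).getD i 0
    have hlen' : (g ++ r).length = n := by simpa using hlen
    have horth (i j : ℕ) (hi : i < n) (hj : j < n) (hij : i ≠ j) : φ (polar Q (f i) (f j)) = 0 := by
      obtain hij | hij := hij.lt_or_gt
      · exact pairwise_getD hpw 0 hij (by omega)
      · rw [polar_comm]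
        exact pairwise_getD hpw 0 hij (by omega)
    -- Only the last vector, of index `2 * k + 1`, can come from `r`. It is used as `w`, whose value
    -- is unconstrained.
    have hf (i : ℕ) (hi : i < 2 * k + 1) : algebraMap R κ (φ (Q (f i))) ≠ 0 := by
      refine hq _ ?_
      simp only [f]
      rw [List.getD_append _ _ _ _ (by omega), List.getD_eq_getElem _ _ (by omega)]
      exact List.getElem_mem _
    have hsp : SpannedAt R κ (Set.range e)
        (frameSet k (fun i ↦ f (2 * i)) (fun i ↦ f (2 * i + 1)) (f (2 * k)) (f (2 * k + 1))) := by
      refine hspan.trans (.of_subset_span fun x hx ↦ ?_)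
      refine Submodule.subset_span ?_
      obtain ⟨i, hi, rfl⟩ := List.mem_iff_getElem.mp hx
      rw [← List.getD_eq_getElem _ 0 hi]
      change f i ∈ _
      rw [hlen'] at hi
      obtain ⟨j, rfl | rfl⟩ : ∃ j, i = 2 * j ∨ i = 2 * j + 1 := ⟨i / 2, by omega⟩
      · by_cases hj : j = k
        · subst hj; exact .inl rfl
        · exact .inr (.inr ⟨j, by omega, .inl rfl⟩)
      · by_cases hj : j = k
        · subst hj; exact .inr (.inl rfl)
        · exact .inr (.inr ⟨j, by omega, .inr rfl⟩)
    obtain ⟨s', hs', hF⟩ := h.exists_isFrame (Q := Q) hs (k := k) (p := fun i ↦ f (2 * i))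
      (q := fun i ↦ f (2 * i + 1)) (c := f (2 * k)) (w := f (2 * k + 1))
      hsp
      (fun i hi j hj hij ↦ horth _ _ (by omega) (by omega) (by omega))
      (fun i hi j hj hij ↦ horth _ _ (by omega) (by omega) (by omega))
      (fun i hi j hj hij ↦ horth _ _ (by omega) (by omega) (by omega))
      (fun i hi ↦ horth _ _ (by omega) (by omega) (by omega))
      (fun i hi ↦ horth _ _ (by omega) (by omega) (by omega))
      (fun i hi ↦ horth _ _ (by omega) (by omega) (by omega))
      (fun i hi ↦ horth _ _ (by omega) (by omega) (by omega))
      (hf _ (by omega))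
      (fun i hi ↦ by
        rw [horth _ _ (by omega) (by omega) (by omega), zero_pow two_ne_zero, zero_sub, map_neg,
          neg_ne_zero, map_mul, map_mul, map_ofNat, show (4 : κ) = 2 * 2 by norm_num]
        exact mul_ne_zero (mul_ne_zero (mul_ne_zero h2 h2) (hf _ (by omega))) (hf _ (by omega)))
    exact ⟨s', _, _, _, _, hs', hF⟩

theorem IsLocalBasis.isSpannedByTwo {s : R} {e : Fin 2 → M} {l : N}
    {φ : Module.Dual R N} {Q : QuadraticMap R M N} (h : IsLocalBasis s e l φ) :
    IsSpannedByTwo Q s φ (e 0) (e 1) := by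
  refine ⟨fun ψ ↦ ⟨1, ψ l, by rw [pow_one, h.dual]⟩, fun u ↦ ⟨1, ?_⟩⟩
  rw [pow_one, ← h.sum_coord, Fin.sum_univ_two]
  exact Submodule.mem_span_pair.mpr ⟨_, _, rfl⟩

theorem IsLocalBasis.isSpannedByTwo_of_zero {s : R} {e : Fin 0 → M} {l : N}
    {φ : Module.Dual R N} {Q : QuadraticMap R M N} (h : IsLocalBasis s e l φ) :
    IsSpannedByTwo Q s φ 0 0 := by
  refine ⟨fun ψ ↦ ⟨1, ψ l, by rw [pow_one, h.dual]⟩, fun u ↦ ⟨1, ?_⟩⟩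
  rw [pow_one, ← h.sum_coord, Fin.sum_univ_zero]
  exact zero_mem _

end QuadraticMap

/-! ### Frames and localization -/

namespace QuadraticMap.EvenClifford

section LocalizationOfSpan

variable {R R' : Type*} [CommRing R] [CommRing R'] [Algebra R R'] (g : R)
  [IsLocalization.Away g R'] {X X' : Type*} [AddCommGroup X] [Module R X] [AddCommGroup X']
  [Module R X'] [Module R' X'] [IsScalarTower R R' X'] (e : X →ₗ[R] X')

omit [IsLocalization.Away g R'] in
theorem exists_map_eq_pow_smul [IsLocalizedModule.Away g e] (y : X') :
    ∃ (a : ℕ) (x : X), e x = algebraMap R R' g ^ a • y := by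
  obtain ⟨⟨x, ⟨_, n, rfl⟩⟩, hx⟩ := IsLocalizedModule.surj (.powers g) e y
  exact ⟨n, x, by rw [← map_pow, algebraMap_smul]; exact hx.symm⟩

theorem exists_algebraMap_eq_pow_mul (r : R') :
    ∃ (a : ℕ) (x : R), algebraMap R R' x = algebraMap R R' g ^ a * r := by
  obtain ⟨n, x, hx⟩ := IsLocalization.Away.surj g r
  exact ⟨n, x, by rw [← hx, mul_comm]⟩

omit [IsLocalization.Away g R'] in
theorem map_mem_span {Y : Set X} {x : X} (hx : x ∈ Submodule.span R Y) :
    e x ∈ Submodule.span R' (e '' Y) := by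
  induction hx using Submodule.span_induction with
  | mem x hx => exact Submodule.subset_span ⟨x, hx, rfl⟩
  | zero => simp
  | add x y _ _ hx hy => rw [map_add]; exact add_mem hx hy
  | smul r x _ hx =>
    rw [map_smul, ← algebraMap_smul R' r]
    exact Submodule.smul_mem _ _ hx

/-- A relation in a localization of a module comes from a relation in the module, after clearing
denominators. -/
theorem exists_pow_smul_mem_span [IsLocalizedModule.Away g e] {Y : Set X} {Y' : Set X'}
    (hY : ∀ y' ∈ Y', ∃ (a : ℕ) (y : X), y ∈ Y ∧ e y = algebraMap R R' g ^ a • y') {s : R} {s' : R'}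
    {m : ℕ} (hs : algebraMap R R' s = algebraMap R R' g ^ m * s') (hgs : g ∣ s) {n : ℕ} {x : X}
    (hx : s' ^ n • e x ∈ Submodule.span R' Y') : ∃ n : ℕ, s ^ n • x ∈ Submodule.span R Y := by
  have key (y' : X') (hy' : y' ∈ Submodule.span R' Y') :
      ∃ (a : ℕ) (y : X), y ∈ Submodule.span R Y ∧ e y = algebraMap R R' g ^ a • y' := by
    induction hy' using Submodule.span_induction with
    | mem y hy =>
      obtain ⟨a, y, hy, h⟩ := hY y hy
      exact ⟨a, y, Submodule.subset_span hy, h⟩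
    | zero => exact ⟨0, 0, by simp⟩
    | add x y _ _ hx hy =>
      obtain ⟨a, x, hx, hx'⟩ := hx
      obtain ⟨b, y, hy, hy'⟩ := hy
      refine ⟨a + b, g ^ b • x + g ^ a • y, add_mem (Submodule.smul_mem _ _ hx)
        (Submodule.smul_mem _ _ hy), ?_⟩
      rw [map_add, map_smul, map_smul, hx', hy', ← algebraMap_smul R' (g ^ b),
        ← algebraMap_smul R' (g ^ a), smul_smul, smul_smul, smul_add, map_pow, map_pow, pow_add,
        mul_comm]
    | smul r x _ hx =>
      obtain ⟨a, x, hx, hx'⟩ := hx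
      obtain ⟨b, r, hr⟩ := exists_algebraMap_eq_pow_mul g r
      refine ⟨a + b, r • x, Submodule.smul_mem _ _ hx, ?_⟩
      rw [map_smul, hx', ← algebraMap_smul R' r, hr, smul_smul, smul_smul, pow_add]
      congr 1
      ring
  obtain ⟨a, y, hy, h⟩ := key _ hx
  obtain ⟨⟨_, c, rfl⟩, hc⟩ := (IsLocalizedModule.eq_iff_exists (.powers g) e
    (x₁ := g ^ a • s ^ n • x) (x₂ := g ^ (m * n) • y)).mp (by
      rw [map_smul, map_smul, map_smul, h, ← algebraMap_smul R' (g ^ a),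
        ← algebraMap_smul R' (s ^ n), ← algebraMap_smul R' (g ^ (m * n)), map_pow, map_pow, map_pow,
        hs, smul_smul, smul_smul, smul_smul, mul_pow, pow_mul]
      congr 1
      ring)
  obtain ⟨t, ht⟩ := hgs
  refine ⟨n + (c + a), ?_⟩
  have hc' : g ^ c • g ^ a • s ^ n • x = g ^ c • g ^ (m * n) • y := hc
  have : s ^ (n + (c + a)) • x = t ^ (c + a) • g ^ c • g ^ a • s ^ n • x := by
    rw [smul_smul, smul_smul, smul_smul, pow_add s]
    congr 1
    nth_rw 2 [ht]
    ring
  rw [this, hc']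
  exact Submodule.smul_mem _ _ (Submodule.smul_mem _ _ (Submodule.smul_mem _ _ hy))

/-- Clearing denominators introduces powers of `g`; as `g` divides `s`, they are absorbed by further
powers of `s`. -/
theorem exists_dvd_pow_of_map (hinj : Function.Injective (algebraMap R R')) {s : R} {s' : R'}
    {m : ℕ} (hs : algebraMap R R' s = algebraMap R R' g ^ m * s') (hgs : g ∣ s) {D : R} {D' : R'}
    {a : ℕ} (hD : algebraMap R R' D = algebraMap R R' g ^ a * D') (h : ∃ n : ℕ, D' ∣ s' ^ n) :
    ∃ n : ℕ, D ∣ s ^ n := by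
  obtain ⟨n, t', ht'⟩ := h
  obtain ⟨b, t, ht⟩ := exists_algebraMap_eq_pow_mul g t'
  have h₁ : g ^ (b + a) * s ^ n = D * (g ^ (m * n) * t) := by
    apply hinj
    simp only [map_mul, map_pow, hs, hD, ht, mul_pow, ht']
    ring
  obtain ⟨u, hu⟩ := hgs
  refine ⟨n + (b + a), u ^ (b + a) * (g ^ (m * n) * t), ?_⟩
  rw [mul_left_comm, ← h₁, pow_add s]
  nth_rw 2 [hu]
  ring

end LocalizationOfSpan

section Frame

theorem image_frameSet {M M' : Type*} (f : M → M') {k : ℕ} {p q : ℕ → M} {c w : M} :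
    f '' frameSet k p q c w = frameSet k (f ∘ p) (f ∘ q) (f c) (f w) := by
  ext x
  constructor
  · rintro ⟨x, rfl | rfl | ⟨i, hi, rfl | rfl⟩, rfl⟩
    exacts [.inl rfl, .inr (.inl rfl), .inr (.inr ⟨i, hi, .inl rfl⟩),
      .inr (.inr ⟨i, hi, .inr rfl⟩)]
  · rintro (rfl | rfl | ⟨i, hi, rfl | rfl⟩)
    exacts [⟨_, .inl rfl, rfl⟩, ⟨_, .inr (.inl rfl), rfl⟩, ⟨_, .inr (.inr ⟨i, hi, .inl rfl⟩), rfl⟩,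
      ⟨_, .inr (.inr ⟨i, hi, .inr rfl⟩), rfl⟩]

variable {R R' M M' N N' : Type*} [CommRing R] [CommRing R'] [Algebra R R']
  [AddCommGroup M] [Module R M] [AddCommGroup N] [Module R N]
  [AddCommGroup M'] [Module R' M'] [Module R M'] [IsScalarTower R R' M']
  [AddCommGroup N'] [Module R' N']
  {Q : QuadraticMap R M N} {Q' : QuadraticMap R' M' N'}
  (g : R) [IsLocalization.Away g R']
  (f : M →ₗ[R] M') [IsLocalizedModule.Away g f]
  (d : Module.Dual R N →ₗ[R] Module.Dual R' N') [IsLocalizedModule.Away g d]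
  (h : ∀ φ v, d φ (Q' (f v)) = algebraMap R R' (φ (Q v)))

omit [IsScalarTower R R' M'] [IsLocalization.Away g R'] [IsLocalizedModule.Away g f]
  [IsLocalizedModule.Away g d] in
include h in
theorem dual_polar_map (φ : Module.Dual R N) (x y : M) :
    d φ (polar Q' (f x) (f y)) = algebraMap R R' (φ (polar Q x y)) := by
  simp only [polar, ← map_add f, map_sub, h]

include g h in
/-- Localizations of frames are frames. -/
theorem IsFrame.map {s : R} {k : ℕ} {φ : Module.Dual R N} {p q : ℕ → M} {c w : M}
    (hF : IsFrame Q s k φ p q c w) :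
    IsFrame Q' (algebraMap R R' s) k (d φ) (f ∘ p) (f ∘ q) (f c) (f w) where
  dual ψ := by
    obtain ⟨r₀, ψ, rfl⟩ := exists_eq_smul (R' := R') g d ψ
    obtain ⟨n, r, hr⟩ := hF.dual ψ
    refine ⟨n, r₀ * algebraMap R R' r, ?_⟩
    rw [smul_comm, ← map_pow, algebraMap_smul, ← map_smul, hr, map_smul, mul_smul, algebraMap_smul]
  span u := by
    obtain ⟨r₀, u, rfl⟩ := exists_eq_smul (R' := R') g f u
    obtain ⟨n, hn⟩ := hF.span u
    refine ⟨n, ?_⟩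
    rw [smul_comm, ← map_pow, algebraMap_smul, ← map_smul, ← image_frameSet]
    exact Submodule.smul_mem _ _ (map_mem_span f hn)
  pp i hi j hj hij := by
    rw [Function.comp, Function.comp, dual_polar_map f d h, hF.pp i hi j hj hij, map_zero]
  qq i hi j hj hij := by
    rw [Function.comp, Function.comp, dual_polar_map f d h, hF.qq i hi j hj hij, map_zero]
  pq i hi j hj hij := by
    rw [Function.comp, Function.comp, dual_polar_map f d h, hF.pq i hi j hj hij, map_zero]
  pc i hi := by rw [Function.comp, dual_polar_map f d h, hF.pc i hi, map_zero]
  qc i hi := by rw [Function.comp, dual_polar_map f d h, hF.qc i hi, map_zero]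
  pw i hi := by rw [Function.comp, dual_polar_map f d h, hF.pw i hi, map_zero]
  qw i hi := by rw [Function.comp, dual_polar_map f d h, hF.qw i hi, map_zero]
  unit := by
    obtain ⟨n, hn⟩ := hF.unit
    exact ⟨n, by rw [h, ← map_pow]; exact map_dvd _ hn⟩
  disc i hi := by
    obtain ⟨n, hn⟩ := hF.disc i hi
    refine ⟨n, ?_⟩
    rw [Function.comp, Function.comp, dual_polar_map f d h, h, h]
    simpa only [map_sub, map_mul, map_pow, map_ofNat] using map_dvd (algebraMap R R') hn

include h in
/-- Frames of a localization come from frames, after clearing denominators. -/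
theorem IsFrame.exists_of_map (hinj : Function.Injective (algebraMap R R')) {s' : R'} {k : ℕ}
    {φ' : Module.Dual R' N'} {p' q' : ℕ → M'} {c' w' : M'} (hF : IsFrame Q' s' k φ' p' q' c' w') :
    ∃ (s : R) (m : ℕ) (φ : Module.Dual R N) (p q : ℕ → M) (c w : M),
      algebraMap R R' s = algebraMap R R' g ^ m * s' ∧ IsFrame Q s k φ p q c w := by
  obtain ⟨m, s₀, hs₀⟩ := exists_algebraMap_eq_pow_mul g s'
  obtain ⟨a, φ, hφ⟩ := exists_map_eq_pow_smul (R' := R') g d φ'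
  choose b p hp using fun i ↦ exists_map_eq_pow_smul (R' := R') g f (p' i)
  choose b' q hq using fun i ↦ exists_map_eq_pow_smul (R' := R') g f (q' i)
  obtain ⟨b₁, c, hc⟩ := exists_map_eq_pow_smul (R' := R') g f c'
  obtain ⟨b₂, w, hw⟩ := exists_map_eq_pow_smul (R' := R') g f w'
  -- The extra factor `g` makes the new scalar a multiple of `g`, so that inverting it also inverts
  -- `g`.
  have hs : algebraMap R R' (g * s₀) = algebraMap R R' g ^ (m + 1) * s' := by
    rw [map_mul, hs₀, pow_succ]
    ring
  have hgs : g ∣ g * s₀ := dvd_mul_right _ _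
  have hpol {x y : M} {x' y' : M'} {i j : ℕ} (hx : f x = algebraMap R R' g ^ i • x')
      (hy : f y = algebraMap R R' g ^ j • y') : algebraMap R R' (φ (polar Q x y)) =
        algebraMap R R' g ^ (a + i + j) * φ' (polar Q' x' y') := by
    rw [← dual_polar_map f d h, hφ, hx, hy, polar_smul_left, polar_smul_right, LinearMap.smul_apply,
      map_smul, map_smul]
    simp only [smul_eq_mul]
    ring
  have hpol₀ {x y : M} {x' y' : M'} {i j : ℕ} (hx : f x = algebraMap R R' g ^ i • x')
      (hy : f y = algebraMap R R' g ^ j • y') (h₀ : φ' (polar Q' x' y') = 0) :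
      φ (polar Q x y) = 0 := by
    apply hinj
    rw [hpol hx hy, h₀, mul_zero, map_zero]
  have hQ {x : M} {x' : M'} {i : ℕ} (hx : f x = algebraMap R R' g ^ i • x') :
      algebraMap R R' (φ (Q x)) = algebraMap R R' g ^ (a + i + i) * φ' (Q' x') := by
    rw [← h, hφ, hx, QuadraticMap.map_smul, LinearMap.smul_apply, map_smul]
    simp only [smul_eq_mul]
    ring
  refine ⟨g * s₀, m + 1, φ, p, q, c, w, hs, fun ψ ↦ ?_, fun u ↦ ?_,
    fun i hi j hj hij ↦ hpol₀ (hp i) (hp j) (hF.pp i hi j hj hij),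
    fun i hi j hj hij ↦ hpol₀ (hq i) (hq j) (hF.qq i hi j hj hij),
    fun i hi j hj hij ↦ hpol₀ (hp i) (hq j) (hF.pq i hi j hj hij),
    fun i hi ↦ hpol₀ (hp i) hc (hF.pc i hi), fun i hi ↦ hpol₀ (hq i) hc (hF.qc i hi),
    fun i hi ↦ hpol₀ (hp i) hw (hF.pw i hi), fun i hi ↦ hpol₀ (hq i) hw (hF.qw i hi),
    exists_dvd_pow_of_map g hinj hs hgs (hQ hc) hF.unit, fun i hi ↦ ?_⟩
  · obtain ⟨n, r, hr⟩ := hF.dual (d ψ)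
    obtain ⟨n, hn⟩ := exists_pow_smul_mem_span (R' := R') g d (Y := {φ}) (Y' := {φ'})
      (by rintro _ rfl; exact ⟨a, φ, rfl, hφ⟩) hs hgs (n := n) (x := ψ)
      (Submodule.mem_span_singleton.mpr ⟨r, hr.symm⟩)
    obtain ⟨r, hr⟩ := Submodule.mem_span_singleton.mp hn
    exact ⟨n, r, hr.symm⟩
  · obtain ⟨n, hn⟩ := hF.span (f u)
    refine exists_pow_smul_mem_span (R' := R') g f (fun y' hy' ↦ ?_) hs hgs hn
    obtain rfl | rfl | ⟨i, hi, rfl | rfl⟩ := hy'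
    exacts [⟨_, c, .inl rfl, hc⟩, ⟨_, w, .inr (.inl rfl), hw⟩,
      ⟨_, p i, .inr (.inr ⟨i, hi, .inl rfl⟩), hp i⟩, ⟨_, q i, .inr (.inr ⟨i, hi, .inr rfl⟩), hq i⟩]
  · refine exists_dvd_pow_of_map g hinj hs hgs (a := 2 * (a + b i + b' i)) ?_ (hF.disc i hi)
    rw [map_sub, map_mul, map_mul, map_pow, map_ofNat, hpol (hp i) (hq i), hQ (hp i), hQ (hq i)]
    ring

end Frame

end QuadraticMap.EvenClifford

/-! ### Local bases from trivializations -/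

namespace QuadraticMap

open EvenClifford

section LocalBasisOfLocalization

variable {R R' : Type*} [CommRing R] [CommRing R'] [Algebra R R'] (g : R)
  [IsLocalization.Away g R'] {X X' : Type*} [AddCommGroup X] [Module R X] [AddCommGroup X']
  [Module R X'] [Module R' X'] [IsScalarTower R R' X'] (f : X →ₗ[R] X')
  [IsLocalizedModule.Away g f]

include f in
/-- A basis of a localization of a finite module comes from a basis of a submodule with torsion
quotient. -/
theorem exists_linearIndependent_of_localization [Module.Finite R X]
    (hinj : Function.Injective (algebraMap R R')) {n : ℕ} (b : Module.Basis (Fin n) R' X') :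
    ∃ (e : Fin n → X) (m : ℕ), LinearIndependent R e ∧
      ∀ u, g ^ m • u ∈ Submodule.span R (Set.range e) := by
  choose a e he using fun j ↦ exists_map_eq_pow_smul (R' := R') g f (b j)
  have hg := IsLocalization.Away.algebraMap_isUnit (S := R') g
  refine ⟨e, ?_⟩
  have h₁ (u : X) : ∃ m : ℕ, g ^ m • u ∈ Submodule.span R (Set.range e) := by
    refine exists_pow_smul_mem_span (R' := R') g f (Y' := Set.range b) (s' := 1) (m := 1) (n := 0)
      ?_ (by simp) dvd_rfl ?_
    · rintro _ ⟨j, rfl⟩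
      exact ⟨a j, e j, ⟨j, rfl⟩, he j⟩
    · rw [b.span_eq]
      trivial
  choose m hm using h₁
  obtain ⟨t, ht⟩ := (inferInstance : Module.Finite R X).fg_top
  refine ⟨t.sup m, ?_, fun u ↦ ?_⟩
  · have h₂ : LinearIndependent R' (f ∘ e) := by
      convert b.linearIndependent.units_smul fun j ↦ (hg.pow (a j)).unit
      exact funext fun j ↦ by simpa [Units.smul_def] using he j
    exact (h₂.restrict_scalars (by simpa [← Algebra.algebraMap_eq_smul_one] using hinj)).of_comp f
  · have hu : u ∈ Submodule.span R (t : Set X) := ht ▸ Submodule.mem_top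
    induction hu using Submodule.span_induction with
    | mem u hu =>
      rw [← Nat.sub_add_cancel (Finset.le_sup (f := m) hu), pow_add, mul_smul]
      exact Submodule.smul_mem _ _ (hm u)
    | zero => simp
    | add x y _ _ hx hy => rw [smul_add]; exact add_mem hx hy
    | smul r x _ hx => rw [smul_comm]; exact Submodule.smul_mem _ _ hx

end LocalBasisOfLocalization

/-- The coordinate along `l 0` is defined on `N` only after multiplication by `g ^ b`; the further
factor `g ^ a` makes one scalar serve both modules. -/
theorem exists_isLocalBasis_of_linearIndependent {R M N : Type*} [CommRing R] [AddCommGroup M]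
    [Module R M] [AddCommGroup N] [Module R N] {g : R} {n a b : ℕ} {e : Fin n → M}
    {l : Fin 1 → N} (he : LinearIndependent R e) (hl : LinearIndependent R l)
    (he' : ∀ u, g ^ a • u ∈ Submodule.span R (Set.range e))
    (hl' : ∀ u, g ^ b • u ∈ Submodule.span R (Set.range l)) :
    ∃ φ, IsLocalBasis (g ^ (a + b)) e (l 0) φ := by
  let c : N →ₗ[R] R := Finsupp.lapply 0 ∘ₗ hl.repr ∘ₗ
    (LinearMap.lsmul R N (g ^ b)).codRestrict _ hl'
  have hc (u : N) : g ^ b • u = c u • l 0 := by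
    have := hl.linearCombination_repr ⟨g ^ b • u, hl' u⟩
    rw [Finsupp.linearCombination_apply, Finsupp.sum_fintype _ _ (by simp)] at this
    rw [Fin.sum_univ_one] at this
    exact this.symm
  have hcl : c (l 0) = g ^ b := by
    have := Fintype.linearIndependent_iff.mp hl (fun _ ↦ g ^ b - c (l 0)) (by
      simp [sub_smul, hc]) 0
    exact (sub_eq_zero.mp this).symm
  refine ⟨g ^ a • c, he, fun u ↦ ?_, fun u ↦ ?_, ?_⟩
  · rw [pow_add, mul_comm, mul_smul]
    exact Submodule.smul_mem _ _ (he' u)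
  · rw [pow_add, mul_smul, hc, smul_smul, LinearMap.smul_apply, smul_eq_mul]
  · rw [LinearMap.smul_apply, hcl, smul_eq_mul, pow_add]

end QuadraticMap

namespace AlgebraicGeometry.Scheme

open CategoryTheory Opposite TopologicalSpace

variable {S : Scheme.{u}}

theorem IsLocallyFreeOfRank.exists_linearIndependent [IsIntegral S] {n : ℕ} {E : S.Modules}
    (hE : IsLocallyFreeOfRank E n) {U V : S.Opens} (hU : IsAffineOpen U) {x : S}
    (hE' : Nonempty ((Fin n → Γ(S, V)) ≃ₗ[Γ(S, V)] Γ(E, V))) (g : Γ(S, U))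
    (hV : S.basicOpen g = V) (hx : x ∈ V) :
    ∃ (e : Fin n → Γ(E, U)) (m : ℕ), LinearIndependent Γ(S, U) e ∧
      ∀ u, g ^ m • u ∈ Submodule.span Γ(S, U) (Set.range e) := by
  have : SheafOfModules.IsQuasicoherent.{u} E := hE.isQuasicoherent
  have i : V ⟶ U := homOfLE (hV ▸ S.basicOpen_le g)
  let := resAlgebra i
  let := resModule i E
  have : IsScalarTower Γ(S, U) Γ(S, V) Γ(E, V) := .of_algebraMap_smul fun _ _ ↦ rfl
  have : IsLocalization.Away g Γ(S, V) := LineBundleQuadraticForm.isLocalization_res i hU g hV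
  have : IsLocalizedModule.Away g (resLinear i E) := isLocalizedModule_res i E hU g hV
  have := finitePresentation hE hU
  have : Nonempty V := ⟨⟨x, hx⟩⟩
  exact QuadraticMap.exists_linearIndependent_of_localization g (resLinear i E)
    (map_injective_of_isIntegral S i) (.ofEquivFun hE'.some.symm)

theorem LineBundleQuadraticForm.exists_isLocalBasis [IsIntegral S] {n : ℕ}
    (Q : S.LineBundleQuadraticForm n) {U : S.Opens} (hU : IsAffineOpen U) {x : S} (hx : x ∈ U) :
    ∃ (s : Γ(S, U)) (e : Fin n → Γ(Q.E, U)) (l : Γ(Q.L, U)) (φ : Module.Dual Γ(S, U) Γ(Q.L, U)),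
      x ∈ S.basicOpen s ∧ QuadraticMap.IsLocalBasis s e l φ := by
  obtain ⟨W₁, hx₁, e₁, he₁⟩ := Q.locallyFree.exists_basis x
  obtain ⟨W₂, hx₂, e₂, he₂⟩ := Q.invertible.exists_basis x
  obtain ⟨g, hg, hxg⟩ := hU.exists_basicOpen_le (V := W₁ ⊓ W₂) ⟨x, hx₁, hx₂⟩ hx
  obtain ⟨e, a, he, he'⟩ := Q.locallyFree.exists_linearIndependent hU
    (exists_equiv_of_le Q.E (homOfLE (hg.trans inf_le_left)) (he₁ _ _)) g rfl hxg
  obtain ⟨l, b, hl, hl'⟩ := Q.invertible.exists_linearIndependent hU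
    (exists_equiv_of_le Q.L (homOfLE (hg.trans inf_le_right)) (he₂ _ _)) g rfl hxg
  obtain ⟨φ, hφ⟩ := QuadraticMap.exists_isLocalBasis_of_linearIndependent he hl he' hl'
  refine ⟨_, e, _, φ, ?_, hφ⟩
  rw [← S.evaluation_ne_zero_iff_mem_basicOpen x hx] at hxg ⊢
  rw [map_pow]
  exact pow_ne_zero _ hxg

end AlgebraicGeometry.Scheme

/-! ### The direct implication over the scheme -/

namespace AlgebraicGeometry.Scheme.LineBundleQuadraticForm

open CategoryTheory Opposite TopologicalSpace QuadraticMap QuadraticMap.EvenClifford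

variable {S : Scheme.{u}} {n : ℕ} (Q : S.LineBundleQuadraticForm n)

/-- The `Γ(U, 𝒪_S)`-algebra structure on the functions on `f⁻¹ (U) ⊆ T`. -/
abbrev sectionsAlgebra (U : S.AffineZariskiSite) :
    Algebra Γ(S, U.1) Γ(Q.discriminantCover, Q.toBase ⁻¹ᵁ U.1) :=
  ((Q.sectionsIso U).inv.hom.comp (Q.toCenter.app (op U)).hom).toAlgebra

theorem isScalarTower_sectionsAlgebra (U : S.AffineZariskiSite) :
    letI := Q.evenCliffordAlgebra U
    letI := Q.sectionsAlgebra U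
    IsScalarTower Γ(S, U.1) Γ(Q.discriminantCover, Q.toBase ⁻¹ᵁ U.1)
      (EvenClifford (Q.q U.1)) := by
  let := Q.evenCliffordAlgebra U
  let := Q.sectionsAlgebra U
  refine .of_algebraMap_eq fun r ↦ ?_
  have h : (Q.sectionsIso U).hom.hom ((Q.sectionsIso U).inv.hom ((Q.toCenter.app (op U)).hom r)) =
      (Q.toCenter.app (op U)).hom r := by simp
  exact (congrArg Subtype.val h).symm

theorem algebraMap_evenClifford_injective (U : S.AffineZariskiSite) :
    letI := Q.evenCliffordAlgebra U
    Function.Injective (algebraMap Γ(Q.discriminantCover, Q.toBase ⁻¹ᵁ U.1)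
      (EvenClifford (Q.q U.1))) :=
  Subtype.val_injective.comp (ConcreteCategory.bijective_of_isIso (Q.sectionsIso U).hom).1

theorem exists_algebraMap_evenClifford_eq (U : S.AffineZariskiSite) (a : EvenClifford (Q.q U.1))
    (ha : ∀ b, a * b = b * a) :
    letI := Q.evenCliffordAlgebra U
    ∃ z, algebraMap Γ(Q.discriminantCover, Q.toBase ⁻¹ᵁ U.1) (EvenClifford (Q.q U.1)) z = a := by
  let := Q.evenCliffordAlgebra U
  obtain ⟨z, hz⟩ := (ConcreteCategory.bijective_of_isIso (Q.sectionsIso U).hom).2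
    ⟨a, Subring.mem_center_iff.mpr fun b ↦ (ha b).symm⟩
  exact ⟨z, congrArg Subtype.val hz⟩

/-- Frames extend from one affine neighbourhood of a point to another. -/
theorem exists_isFrame_of_isFrame [IsIntegral S] {U V : S.Opens} (hU : IsAffineOpen U)
    (hV : IsAffineOpen V) {x : S} (hxU : x ∈ U) (hxV : x ∈ V) {s : Γ(S, V)} {k : ℕ} {φ p q c w}
    (h : IsFrame (Q.q V) s k φ p q c w) (hs : x ∈ S.basicOpen s) :
    ∃ s' : Γ(S, U), x ∈ S.basicOpen s' ∧
      ∃ k φ p q c w, IsFrame (Q.q U) s' k φ p q c w := by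
  -- A common basic open subset `W` of `U` and `V`: the frame is restricted from `V` to `W`, then
  -- brought to `U` by clearing denominators.
  obtain ⟨f, g, hfg, hxf⟩ := exists_basicOpen_le_affine_inter hU hV x ⟨hxU, hxV⟩
  obtain ⟨W, hW⟩ : ∃ W, S.basicOpen f = W := ⟨_, rfl⟩
  have hW' : S.basicOpen g = W := hfg.symm.trans hW
  rw [hW] at hxf
  let i : W ⟶ U := homOfLE (hW ▸ S.basicOpen_le f)
  let j : W ⟶ V := homOfLE (hW' ▸ S.basicOpen_le g)
  have : Nonempty W := ⟨⟨x, hxf⟩⟩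
  have : SheafOfModules.IsQuasicoherent.{u} Q.E := Q.locallyFree.isQuasicoherent
  have h₁ : ∃ φ p q c w, IsFrame (Q.q W) (S.presheaf.map j.op s) k φ p q c w := by
    let := resAlgebra j
    let := resModule j Q.E
    have : IsScalarTower Γ(S, V) Γ(S, W) Γ(Q.E, W) := .of_algebraMap_smul fun _ _ ↦ rfl
    have : IsLocalization.Away g Γ(S, W) := isLocalization_res j hV g hW'
    have : IsLocalizedModule.Away g (resLinear j Q.E) := isLocalizedModule_res j Q.E hV g hW'
    have := Q.isLocalizedModule_dualRes j hV g hW'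
    exact ⟨_, _, _, _, _, IsFrame.map g (resLinear j Q.E) (Q.dualRes j hV g hW')
      (fun φ v ↦ (congrArg _ (Q.map_q j v).symm).trans (Q.dualRes_apply j hV g hW' φ _)) h⟩
  obtain ⟨φ, p, q, c, w, h₁⟩ := h₁
  let := resAlgebra i
  let := resModule i Q.E
  have : IsScalarTower Γ(S, U) Γ(S, W) Γ(Q.E, W) := .of_algebraMap_smul fun _ _ ↦ rfl
  have : IsLocalization.Away f Γ(S, W) := isLocalization_res i hU f hW
  have : IsLocalizedModule.Away f (resLinear i Q.E) := isLocalizedModule_res i Q.E hU f hW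
  have := Q.isLocalizedModule_dualRes i hU f hW
  obtain ⟨s', m, φ, p, q, c, w, hs', h₂⟩ :=
    IsFrame.exists_of_map f (resLinear i Q.E) (Q.dualRes i hU f hW)
      (fun φ v ↦ (congrArg _ (Q.map_q i v).symm).trans (Q.dualRes_apply i hU f hW φ _))
      (map_injective_of_isIntegral S i) h₁
  refine ⟨s', ?_, k, φ, p, q, c, w, h₂⟩
  have h₃ : S.presheaf.map i.op s' = S.presheaf.map i.op f ^ m * S.presheaf.map j.op s := hs'
  have h₄ : x ∈ S.basicOpen (S.presheaf.map i.op s') := by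
    rw [h₃, S.basicOpen_mul, S.basicOpen_res]
    refine ⟨?_, hxf, hs⟩
    have hu : IsUnit (S.presheaf.map i.op f) :=
      IsLocalization.Away.algebraMap_isUnit (S := Γ(S, W)) f
    rw [S.basicOpen_of_isUnit (hu.pow m)]
    exact hxf
  rw [S.basicOpen_res] at h₄
  exact h₄.2

/-- A form of even rank at least `2` with simple degeneration has locally an orthogonal frame. -/
theorem span_isFrame [IsNoetherian S] [IsIntegral S] (h : Q.HasSimpleDegeneration) {k : ℕ}
    (hn : n = 2 * k + 2) {U : S.Opens} (hU : IsAffineOpen U) :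
    Ideal.span {s : Γ(S, U) | ∃ k φ p q c w, IsFrame (Q.q U) s k φ p q c w} = ⊤ := by
  rw [← hU.self_le_iSup_basicOpen_iff]
  intro x hx
  -- Degeneration is controlled only at closed points. A frame near a closed point `y` in the
  -- closure of `x` is also one near `x`, but `y` may lie outside `U`; hence the second affine open
  -- `V`.
  obtain ⟨y, hy, hy'⟩ := (isClosed_closure (s := {x})).exists_closed_singleton
    (Set.singleton_nonempty x).closure
  obtain ⟨_, ⟨V, hV, rfl⟩, hyV, -⟩ :=
    S.isBasis_affineOpens.exists_subset_of_mem_open (Set.mem_univ y) isOpen_univ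
  have hsp : x ⤳ y := specializes_iff_mem_closure.mpr hy
  obtain ⟨s, e, l, φ, hs, hb⟩ := Q.exists_isLocalBasis hV hyV
  let := residueAlgebra V y hyV
  rw [← S.evaluation_ne_zero_iff_mem_basicOpen y hyV] at hs
  obtain ⟨s', p, q, c, w, hs', hF⟩ := hb.exists_isFrame_of_finrank_le_one
    (κ := S.residueField y) (Q := Q.q V) hs hn (h V hV y hyV hy')
  have hys : y ∈ S.basicOpen s' := (S.evaluation_ne_zero_iff_mem_basicOpen y hyV s').mp hs'
  obtain ⟨t, hxt, ht⟩ := Q.exists_isFrame_of_isFrame hU hV hx (hsp.mem_open V.2 hyV) hF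
    (hsp.mem_open (S.basicOpen s').2 hys)
  exact Opens.mem_iSup.mpr ⟨⟨t, ht⟩, hxt⟩

theorem span_isSpannedByTwo [IsIntegral S] (hn : n = 0 ∨ n = 2) {U : S.Opens}
    (hU : IsAffineOpen U) :
    Ideal.span {s : Γ(S, U) | ∃ φ x y, IsSpannedByTwo (Q.q U) s φ x y} = ⊤ := by
  rw [← hU.self_le_iSup_basicOpen_iff]
  intro x hx
  obtain ⟨s, e, l, φ, hs, hb⟩ := Q.exists_isLocalBasis hU hx
  refine Opens.mem_iSup.mpr ⟨⟨s, ?_⟩, hs⟩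
  obtain rfl | rfl := hn
  · exact ⟨_, _, _, hb.isSpannedByTwo_of_zero⟩
  · exact ⟨_, _, _, hb.isSpannedByTwo⟩

theorem isAzumayaOverDiscriminantCover [IsNoetherian S] [IsIntegral S] (hn : Even n)
    (h : Q.HasSimpleDegeneration ∨ n = 2) : Q.IsAzumayaOverDiscriminantCover := by
  intro U
  let := Q.evenCliffordAlgebra U
  let := Q.sectionsAlgebra U
  have := Q.isScalarTower_sectionsAlgebra U
  by_cases hn' : n = 0 ∨ n = 2
  · exact isAzumaya_of_commute (Q.algebraMap_evenClifford_injective U)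
      (Q.exists_algebraMap_evenClifford_eq U)
      (commute_of_isSpannedByTwo (Q.span_isSpannedByTwo hn' U.2))
  · have := finitePresentation Q.locallyFree U.2
    have := finite_dual Q.invertible U.2
    refine isAzumaya_of_frames (Q.algebraMap_evenClifford_injective U)
      (Q.exists_algebraMap_evenClifford_eq U)
      (Q.span_isFrame (h.resolve_right fun h ↦ hn' (.inr h)) (k := n / 2 - 1) ?_ U.2)
    obtain ⟨m, rfl⟩ := hn
    omega

end AlgebraicGeometry.Scheme.LineBundleQuadraticForm

/-! ### Central elements in images of Azumaya algebras -/

namespace AzumayaCriterion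

variable {Z A B : Type*} [CommRing Z] [Ring A] [Algebra Z A] [Ring B]

/-- The center of a quotient of an Azumaya algebra comes from the center of the algebra. -/
theorem exists_algebraMap_eq_of_commute [IsAzumaya Z A] (π : A →+* B) (a : A)
    (ha : ∀ b, π a * π b = π b * π a) : ∃ z, π (algebraMap Z A z) = π a := by
  let J : Ideal Z :=
    { carrier := {z | ∃ w, π (algebraMap Z A z) * π a = π (algebraMap Z A w)}
      zero_mem' := ⟨0, by simp⟩
      add_mem' := by
        rintro x y ⟨w, hw⟩ ⟨v, hv⟩
        exact ⟨w + v, by simp only [map_add, add_mul, hw, hv]⟩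
      smul_mem' := by
        rintro c x ⟨w, hw⟩
        exact ⟨c * w, by simp only [smul_eq_mul, map_mul, mul_assoc, hw]⟩ }
  have hJ (f : A →ₗ[Z] Z) (c : A) : f c ∈ J := by
    refine ⟨f (c * a), ?_⟩
    -- The functional `f` is a sum of two-sided multiplications `c ↦ x c y`. As `π a` commutes with
    -- `π y`, it can be moved next to `c`, which gives `f (c * a)`.
    obtain ⟨t, ht⟩ := (IsAzumaya.bij (R := Z) (A := A)).2 (Algebra.linearMap Z A ∘ₗ f)
    have h₁ (x : A) : algebraMap Z A (f x) = AlgHom.mulLeftRight Z A t x := by rw [ht]; rfl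
    rw [h₁, h₁]
    clear h₁ ht
    induction t with
    | zero => simp
    | add x y hx hy =>
      simp only [map_add, LinearMap.add_apply, add_mul, hx, hy]
    | tmul x y =>
      simp only [AlgHom.mulLeftRight_apply, map_mul, mul_assoc, ha]
  -- Projectivity gives `A = J A`. Nakayama's lemma provides `r` congruent to `1` modulo `J` which
  -- kills `A`; faithfulness gives `r = 0`, hence `1 ∈ J`.
  obtain ⟨r, hr, hr'⟩ := Submodule.exists_sub_one_mem_and_smul_eq_zero_of_fg_of_le_smul J
    (⊤ : Submodule Z A) Module.Finite.fg_top (by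
      intro x _
      obtain ⟨σ, hσ⟩ := Module.projective_def.mp (inferInstance : Module.Projective Z A)
      rw [← hσ x, Finsupp.linearCombination_apply]
      exact Submodule.sum_mem _ fun c _ ↦
        Submodule.smul_mem_smul (hJ (Finsupp.lapply c ∘ₗ σ) x) trivial)
  have hr₀ : r = 0 := FaithfulSMul.algebraMap_injective Z A (by
    rw [map_zero, Algebra.algebraMap_eq_smul_one]
    exact hr' 1 trivial)
  rw [hr₀, zero_sub, neg_mem_iff] at hr
  obtain ⟨w, hw⟩ := hr
  exact ⟨w, by rw [← hw]; simp⟩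

end AzumayaCriterion

/-! ### Even elements commuting with all even elements -/

namespace CliffordAlgebra

open scoped CliffordAlgebra

variable {R M : Type*} [CommRing R] [AddCommGroup M] [Module R M] {Q : QuadraticForm R M}

/-- The contraction with a form `polar Q y` is a twisted commutator. -/
theorem ι_mul_sub_involute_mul_ι (y : M) (x : CliffordAlgebra Q) :
    ι Q y * x - involute x * ι Q y = contractLeft (Q.polarBilin y) x := by
  induction x using CliffordAlgebra.left_induction with
  | algebraMap r =>
    rw [AlgHom.commutes, Algebra.commutes, sub_self, contractLeft_algebraMap]
  | add x y hx hy =>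
    rw [mul_add, map_add, add_mul, map_add, ← hx, ← hy]
    abel
  | ι_mul x m hx =>
    rw [contractLeft_ι_mul, ← hx, map_mul, involute_ι, ← mul_assoc,
      eq_sub_of_add_eq (ι_mul_ι_add_swap (Q := Q) y m), sub_mul, Algebra.smul_def, mul_sub]
    simp only [neg_mul, mul_assoc, QuadraticMap.polarBilin_apply_apply]
    abel

/-- Contracting twice gives the twisted commutators `w y z - w z y + y z w - z y w`. Moving `e` from
left to right exchanges the first two terms and the last two, which reverses the sign of the sum.
The factor `Q e` allows `e e` to be inserted where `z` must be crossed by an even product. -/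
theorem smul_anticommute_contractLeft_contractLeft {z : CliffordAlgebra Q}
    (hz : involute z = z) (hc : ∀ a b, ι Q a * ι Q b * z = z * (ι Q a * ι Q b)) {e y w : M}
    (hy : Q.polarBilin y e = 0) (hw : Q.polarBilin w e = 0) :
    Q e • (ι Q e * contractLeft (Q.polarBilin w) (contractLeft (Q.polarBilin y) z) +
      contractLeft (Q.polarBilin w) (contractLeft (Q.polarBilin y) z) * ι Q e) = 0 := by
  have hanti {y : M} (h : Q.polarBilin y e = 0) : ι Q e * ι Q y = -(ι Q y * ι Q e) := by
    rw [eq_neg_iff_add_eq_zero, add_comm, ι_mul_ι_add_swap, ← QuadraticMap.polarBilin_apply_apply,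
      h, map_zero]
  have he (x : CliffordAlgebra Q) : Q e • x = ι Q e * (ι Q e * x) := by
    rw [← mul_assoc, ι_sq_scalar, Algebra.smul_def]
  have he' (x : CliffordAlgebra Q) : Q e • x = x * ι Q e * ι Q e := by
    rw [mul_assoc, ι_sq_scalar, Algebra.smul_def, Algebra.commutes]
  have hE {y : M} (h : Q.polarBilin y e = 0) :
      Q e • (ι Q e * (z * ι Q y)) = -(Q e • (ι Q y * (z * ι Q e))) :=
    calc Q e • (ι Q e * (z * ι Q y)) = ι Q e * (z * (ι Q y * ι Q e)) * ι Q e := by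
          rw [he']; simp only [mul_assoc]
      _ = ι Q e * ι Q y * ι Q e * z * ι Q e := by rw [← hc]; simp only [mul_assoc]
      _ = -(Q e • (ι Q y * (z * ι Q e))) := by
          rw [hanti h, ← mul_smul_comm, he]; simp only [mul_assoc, neg_mul]
  have hd : contractLeft (Q.polarBilin w) (contractLeft (Q.polarBilin y) z) =
      ι Q w * (ι Q y * z) - ι Q w * (z * ι Q y) + (ι Q y * (z * ι Q w) - z * (ι Q y * ι Q w)) := by
    rw [← ι_mul_sub_involute_mul_ι y, hz, ← ι_mul_sub_involute_mul_ι, map_sub, map_mul, map_mul, hz,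
      involute_ι]
    simp only [mul_neg, neg_mul, sub_mul, mul_sub, mul_assoc]
    abel
  have t₁ : ι Q e * (ι Q w * (ι Q y * z)) = ι Q w * (z * ι Q y) * ι Q e := by
    have := hc y e
    rw [← mul_assoc, hanti hw, neg_mul, mul_assoc, ← mul_assoc (ι Q e), hanti hy, neg_mul, this]
    simp only [mul_assoc, mul_neg, neg_neg]
  have t₂ : Q e • (ι Q e * (ι Q w * (z * ι Q y))) = Q e • (ι Q w * (ι Q y * z) * ι Q e) := by
    rw [← mul_assoc, hanti hw, neg_mul, mul_assoc, smul_neg, ← mul_smul_comm, hE hy, mul_neg,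
      neg_neg, mul_smul_comm]
    simp only [mul_assoc]
  have t₃ : Q e • (ι Q e * (ι Q y * (z * ι Q w))) = Q e • (z * (ι Q y * ι Q w) * ι Q e) := by
    rw [← mul_assoc, hanti hy, neg_mul, mul_assoc, smul_neg, ← mul_smul_comm, hE hw, mul_neg,
      neg_neg, mul_smul_comm, ← hc]
    simp only [mul_assoc]
  have t₄ : Q e • (ι Q e * (z * (ι Q y * ι Q w))) = Q e • (ι Q y * (z * ι Q w) * ι Q e) := by
    rw [← mul_assoc z, ← mul_assoc (ι Q e), ← smul_mul_assoc, hE hy, neg_mul, smul_mul_assoc,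
      mul_assoc, mul_assoc, hanti hw]
    simp only [mul_assoc, mul_neg, smul_neg, neg_neg]
  rw [hd]
  simp only [mul_add, mul_sub, add_mul, sub_mul, smul_add, smul_sub, t₁, t₂, t₃, t₄]
  abel

/-- Over a domain, the component of degree `2` of an even element which commutes with all even
elements vanishes in the following sense. -/
theorem functional_eq_zero [IsDomain R] (μ : CliffordAlgebra Q →ₗ[R] R) {z : CliffordAlgebra Q}
    (hz : involute z = z) (hc : ∀ a b, ι Q a * ι Q b * z = z * (ι Q a * ι Q b))
    {c : R} (hc₀ : c ≠ 0) (hQ : ∀ h : Module.Dual R M, ∃ y, Q.polarBilin y = c • h)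
    {e : M} (he : Q e ≠ 0) {h₁ h₂ : Module.Dual R M} (he₁ : h₁ e = 0) (he₂ : h₂ e = 0) :
    μ (ι Q e * contractLeft h₂ (contractLeft h₁ z) +
      contractLeft h₂ (contractLeft h₁ z) * ι Q e) = 0 := by
  obtain ⟨y, hy⟩ := hQ h₁
  obtain ⟨w, hw⟩ := hQ h₂
  -- The functionals become polar forms only after scaling by `c`, so the identity comes with the
  -- factors `c`, `c` and `Q e`, which are cancelled in the domain.
  have := congrArg μ (smul_anticommute_contractLeft_contractLeft hz hc (e := e) (y := y) (w := w)
    (by simp [hy, he₁]) (by simp [hw, he₂]))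
  simpa [hy, hw, he, hc₀, ← smul_add] using this

end CliffordAlgebra

namespace CliffordAlgebra

variable {R : Type*} [CommRing R]

/-- The inclusion of a finite free quadratic module into its Clifford algebra is split. -/
theorem exists_leftInverse_ι {M : Type*} [AddCommGroup M] [Module R M] [Module.Free R M]
    (Q : QuadraticForm R M) :
    ∃ μ : CliffordAlgebra Q →ₗ[R] M, ∀ v, μ (ι Q v) = v := by
  -- A possibly nonsymmetric bilinear form inducing `Q` identifies the Clifford module with the
  -- exterior algebra and fixes vectors, without dividing by `2`.
  obtain ⟨B, hB⟩ := LinearMap.BilinMap.toQuadraticMap_surjective Q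
  have h : (-B).toQuadraticMap = 0 - Q := by
    rw [LinearMap.BilinMap.toQuadraticMap_neg, hB, zero_sub]
  exact ⟨ExteriorAlgebra.ιInv ∘ₗ changeForm h, fun v ↦ by
    rw [LinearMap.comp_apply, changeForm_ι]
    exact ExteriorAlgebra.ι_leftInverse v⟩

variable [IsDomain R] {n : ℕ} {Q : QuadraticForm R (Fin n → R)}

/-- Cramer's rule for the Gram matrix: `c` is its determinant and `y` comes from its adjugate. -/
theorem exists_polarBilin_eq_smul (hQ : ∀ v, Q.polarBilin v = 0 → v = 0) :
    ∃ c : R, c ≠ 0 ∧ ∀ h : Module.Dual R (Fin n → R), ∃ y, Q.polarBilin y = c • h := by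
  classical
  let A : Matrix (Fin n) (Fin n) R := .of fun i j ↦ Q.polarBilin (Pi.single j 1) (Pi.single i 1)
  have hA (v : Fin n → R) (i : Fin n) : A.mulVec v i = Q.polarBilin v (Pi.single i 1) := by
    conv_rhs => rw [pi_eq_sum_univ' v]
    rw [map_sum, LinearMap.sum_apply]
    simp only [Matrix.mulVec, dotProduct]
    refine Finset.sum_congr rfl fun j _ ↦ ?_
    rw [map_smul, LinearMap.smul_apply, smul_eq_mul, mul_comm]
    rfl
  refine ⟨A.det, fun h ↦ ?_, fun h ↦ ⟨A.adjugate.mulVec fun i ↦ h (Pi.single i 1), ?_⟩⟩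
  · obtain ⟨v, hv, hv'⟩ := Matrix.exists_mulVec_eq_zero_iff.mpr h
    refine hv (hQ v (LinearMap.pi_ext' fun i ↦ LinearMap.ext_ring ?_))
    exact (hA v i).symm.trans (congrFun hv' i)
  · refine LinearMap.pi_ext' fun i ↦ LinearMap.ext_ring ?_
    have := hA (A.adjugate.mulVec fun i ↦ h (Pi.single i 1)) i
    rw [Matrix.mulVec_mulVec, Matrix.mul_adjugate, Matrix.smul_mulVec, Matrix.one_mulVec] at this
    exact this.symm

variable {κ : Type*} [Field κ] [Algebra R κ]

/-- If `Q` vanished at every vector reducing outside `W`, comparing `e + v` and `e - v` for `v`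
reducing into `W` would give `2 * Q v = 0`, so `Q = 0`, against regularity. -/
theorem exists_anisotropic (h2 : (2 : κ) ≠ 0) (hQ : ∀ v, Q.polarBilin v = 0 → v = 0)
    (W : Submodule κ (Fin n → κ)) {e : Fin n → R} (he : algebraMap R κ ∘ e ∉ W) :
    ∃ e : Fin n → R, algebraMap R κ ∘ e ∉ W ∧ Q e ≠ 0 := by
  by_contra! H
  have h2' : (2 : R) ≠ 0 := fun h ↦ h2 (by rw [← map_ofNat (algebraMap R κ), h, map_zero])
  have hadd (v w : Fin n → R) : algebraMap R κ ∘ (v + w) = algebraMap R κ ∘ v + algebraMap R κ ∘ w :=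
    funext fun i ↦ map_add _ _ _
  have hsub (v w : Fin n → R) : algebraMap R κ ∘ (v - w) = algebraMap R κ ∘ v - algebraMap R κ ∘ w :=
    funext fun i ↦ map_sub _ _ _
  have h0 (v : Fin n → R) : Q v = 0 := by
    by_cases hv : algebraMap R κ ∘ v ∈ W
    · have h₁ := H (e + v) (by rwa [hadd, W.add_mem_iff_left hv])
      have h₂ := H (e - v) (by rwa [hsub, W.sub_mem_iff_left hv])
      have h₃ := H e he
      rw [sub_eq_add_neg, QuadraticMap.map_add Q, QuadraticMap.polar_neg_right, QuadraticMap.map_neg,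
        h₃] at h₂
      rw [QuadraticMap.map_add Q, h₃] at h₁
      have : 2 * Q v = 0 := by linear_combination h₁ + h₂
      exact (mul_eq_zero.mp this).resolve_left h2'
    · exact H v hv
  refine he ?_
  rw [hQ e (LinearMap.ext fun v ↦ by simp [QuadraticMap.polar, h0])]
  have : algebraMap R κ ∘ (0 : Fin n → R) = 0 := funext fun i ↦ map_zero _
  rw [this]
  exact W.zero_mem

omit [IsDomain R] in
theorem exists_lift_dual (hsurj : Function.Surjective (algebraMap R κ))
    (h : Module.Dual κ (Fin n → κ)) :
    ∃ H : Module.Dual R (Fin n → R), ∀ v, algebraMap R κ (H v) = h (algebraMap R κ ∘ v) := by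
  choose c hc using fun i ↦ hsurj (h (Pi.single i 1))
  refine ⟨Fintype.linearCombination R c, fun v ↦ ?_⟩
  conv_rhs => rw [pi_eq_sum_univ' (algebraMap R κ ∘ v)]
  rw [Fintype.linearCombination_apply, map_sum, map_sum]
  exact Finset.sum_congr rfl fun i _ ↦ by
    rw [smul_eq_mul, map_mul, hc, map_smul, smul_eq_mul, Function.comp]

/-- A functional on the Clifford algebra which vanishes on the even elements commuting with all
even elements, but not on a product of two vectors with independent reductions. -/
theorem exists_functional (hsurj : Function.Surjective (algebraMap R κ)) (h2 : (2 : κ) ≠ 0)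
    (hQ : ∀ v, Q.polarBilin v = 0 → v = 0) (hn : 3 ≤ n) {f g : Fin n → R}
    (hfg : LinearIndependent κ ![algebraMap R κ ∘ f, algebraMap R κ ∘ g]) :
    ∃ θ : CliffordAlgebra Q →ₗ[R] R,
      (∀ z, involute z = z → (∀ a b, ι Q a * ι Q b * z = z * (ι Q a * ι Q b)) → θ z = 0) ∧
        algebraMap R κ (θ (ι Q f * ι Q g)) ≠ 0 := by
  obtain ⟨c, hc, hc'⟩ := exists_polarBilin_eq_smul hQ
  set W := Submodule.span κ (Set.range ![algebraMap R κ ∘ f, algebraMap R κ ∘ g]) with hW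
  -- The rank hypothesis enters here: two vectors cannot span a space of dimension at least `3`.
  obtain ⟨ē, hē⟩ : ∃ ē : Fin n → κ, ē ∉ W := by
    by_contra! H
    have h₁ : W = ⊤ := eq_top_iff.mpr fun v _ ↦ H v
    have h₂ := finrank_range_le_card (R := κ) ![algebraMap R κ ∘ f, algebraMap R κ ∘ g]
    rw [Set.finrank, ← hW, h₁, finrank_top, Module.finrank_fin_fun, Fintype.card_fin] at h₂
    omega
  choose e₀ he₀ using fun i ↦ hsurj (ē i)
  obtain ⟨e, he, hQe⟩ := exists_anisotropic h2 hQ W (e := e₀)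
    (by rwa [show algebraMap R κ ∘ e₀ = ē from funext he₀])
  have hli : LinearIndependent κ
      ![algebraMap R κ ∘ e, algebraMap R κ ∘ f, algebraMap R κ ∘ g] :=
    linearIndependent_finCons.mpr ⟨hfg, he⟩
  obtain ⟨L, hL⟩ := LinearMap.exists_leftInverse_of_injective _
    (LinearMap.ker_eq_bot.mpr (linearIndependent_iff_injective_fintypeLinearCombination.mp hli))
  have hL' (i : Fin 3) : L (![algebraMap R κ ∘ e, algebraMap R κ ∘ f, algebraMap R κ ∘ g] i) =
      Pi.single i 1 := by
    have := LinearMap.congr_fun hL (Pi.single i 1)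
    rwa [LinearMap.comp_apply, Fintype.linearCombination_apply_single, one_smul] at this
  choose H hH using fun i : Fin 3 ↦ exists_lift_dual hsurj (LinearMap.proj i ∘ₗ L)
  have he' (i : Fin 3) := (hH i e).trans (congrFun (hL' 0) i)
  have hf' (i : Fin 3) := (hH i f).trans (congrFun (hL' 1) i)
  have hg' (i : Fin 3) := (hH i g).trans (congrFun (hL' 2) i)
  obtain ⟨μ, hμ⟩ := exists_leftInverse_ι Q
  -- The coordinate functionals along `f` and `g` vanish at `e` only in `κ`; these combinations with
  -- `H 0` vanish at `e` exactly.
  let h₁ := H 0 e • H 1 - H 1 e • H 0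
  let h₂ := H 0 e • H 2 - H 2 e • H 0
  have he₁ : h₁ e = 0 := by simp [h₁, mul_comm]
  have he₂ : h₂ e = 0 := by simp [h₂, mul_comm]
  refine ⟨(H 0 ∘ₗ μ) ∘ₗ (LinearMap.mulLeft R (ι Q e) + LinearMap.mulRight R (ι Q e)) ∘ₗ
    contractLeft h₂ ∘ₗ contractLeft h₁, fun z hz hz' ↦
      functional_eq_zero (H 0 ∘ₗ μ) hz hz' hc hc' hQe he₁ he₂, ?_⟩
  -- On a product of two vectors the double contraction is a scalar, so `θ` takes the value `2 * H 0
  -- e` times a determinant; the determinant and `H 0 e` both reduce to `1`.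
  have h₃ : contractLeft h₂ (contractLeft h₁ (ι Q f * ι Q g)) =
      algebraMap R _ (h₁ f * h₂ g - h₁ g * h₂ f) := by
    rw [contractLeft_ι_mul, contractLeft_ι, map_sub, map_smul, contractLeft_ι,
      contractLeft_mul_algebraMap, contractLeft_ι, Algebra.smul_def, ← map_mul, ← map_mul,
      ← map_sub, mul_comm (h₂ f)]
  simp only [LinearMap.comp_apply, LinearMap.add_apply, LinearMap.mulLeft_apply,
    LinearMap.mulRight_apply, h₃]
  rw [← Algebra.commutes, ← Algebra.smul_def, ← add_smul, map_smul, map_smul, hμ, smul_eq_mul,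
    ← two_mul, map_mul, map_mul, map_ofNat]
  refine mul_ne_zero (mul_ne_zero h2 ?_) ?_
  · simp [h₁, h₂, he', hf', hg']
  · simp [he']

end CliffordAlgebra

/-! ### Passage to a scalar-valued form over a localization -/

namespace QuadraticMap

open EvenClifford

namespace EvenClifford

variable {R M : Type*} [CommRing R] [AddCommGroup M] [Module R M] (Q : QuadraticForm R M)

/-- The map from the even Clifford algebra of a quadratic form to its Clifford algebra. -/
def toClifford : EvenClifford Q →ₐ[R] CliffordAlgebra Q :=
  lift (LinearMap.mul' R (CliffordAlgebra Q) ∘ₗ TensorProduct.map (CliffordAlgebra.ι Q)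
    (CliffordAlgebra.ι Q ∘ₗ (TensorProduct.rid R M).toLinearMap ∘ₗ
      LinearMap.lTensor M (LinearMap.applyₗ 1)))
    (fun v φ ↦ by
      have h : φ (Q v) = φ 1 * Q v := by
        rw [mul_comm, ← smul_eq_mul, ← map_smul, smul_eq_mul, mul_one]
      rw [h, map_mul, ← Algebra.smul_def]
      simp)
    (fun u v w φ ψ ↦ by
      have h : φ (Q v) = φ 1 * Q v := by
        rw [mul_comm, ← smul_eq_mul, ← map_smul, smul_eq_mul, mul_one]
      have h' : CliffordAlgebra.ι Q u * CliffordAlgebra.ι Q v * (CliffordAlgebra.ι Q v *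
          CliffordAlgebra.ι Q w) = Q v • (CliffordAlgebra.ι Q u * CliffordAlgebra.ι Q w) := by
        rw [mul_assoc, ← mul_assoc (CliffordAlgebra.ι Q v), CliffordAlgebra.ι_sq_scalar,
          ← Algebra.smul_def, mul_smul_comm]
      rw [h]
      simp [h', smul_smul, mul_comm])

theorem toClifford_ι (u v : M) (φ : Module.Dual R R) :
    toClifford Q (ι Q (u ⊗ₜ (v ⊗ₜ φ))) =
      φ 1 • (CliffordAlgebra.ι Q u * CliffordAlgebra.ι Q v) := by
  simp [toClifford]

theorem involute_toClifford (a : EvenClifford Q) :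
    CliffordAlgebra.involute (toClifford Q a) = toClifford Q a := by
  induction a using EvenClifford.induction with
  | algebraMap r => simp
  | ι u v φ => simp [toClifford_ι]
  | mul a b ha hb => rw [map_mul, map_mul, ha, hb]
  | add a b ha hb => rw [map_add, map_add, ha, hb]

end EvenClifford

section

variable {R R' : Type*} [CommRing R] [CommRing R'] [Algebra R R']

/-- The base change is made on the matrix of a bilinear form inducing `q`, which need not be
symmetric. -/
theorem exists_quadraticForm_map {n : ℕ} (q : QuadraticForm R (Fin n → R)) :
    ∃ q' : QuadraticForm R' (Fin n → R'),
      ∀ c, q' (algebraMap R R' ∘ c) = algebraMap R R' (q c) := by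
  obtain ⟨B, rfl⟩ := LinearMap.BilinMap.toQuadraticMap_surjective q
  refine ⟨LinearMap.BilinMap.toQuadraticMap (Matrix.toLinearMap₂' R' (Matrix.of fun i j ↦
    algebraMap R R' (B (Pi.single i 1) (Pi.single j 1)))), fun c ↦ ?_⟩
  conv_rhs => rw [← Matrix.toLinearMap₂'_toMatrix' (R := R) B]
  simp only [LinearMap.BilinMap.toQuadraticMap_apply, Matrix.toLinearMap₂'_apply,
    LinearMap.toMatrix₂'_apply, map_sum, smul_eq_mul, map_mul, Function.comp, Matrix.of_apply]

variable {M N κ : Type*} [AddCommGroup M] [Module R M] [AddCommGroup N] [Module R N]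
  {s : R} {n : ℕ} {e : Fin n → M} {l : N} {φ : Module.Dual R N} {Q : QuadraticMap R M N}

/-- The coordinates with respect to a local basis, in a ring where `s` becomes invertible. -/
def IsLocalBasis.toFun (h : IsLocalBasis s e l φ) (t : R') : M →ₗ[R] Fin n → R' :=
  t • LinearMap.compLeft (Algebra.linearMap R R') (Fin n) ∘ₗ h.coord

variable {t : R'} (ht : algebraMap R R' s * t = 1)
include ht

theorem IsLocalBasis.toFun_basis (h : IsLocalBasis s e l φ) (i : Fin n) :
    h.toFun t (e i) = Pi.single i 1 := by
  ext j
  have : h.coord (e i) j = s * (Pi.single i 1 : Fin n → R) j := by rw [h.coord_apply]; rfl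
  rcases eq_or_ne j i with rfl | hj
  · simp [IsLocalBasis.toFun, this, mul_comm t, ht]
  · simp [IsLocalBasis.toFun, this, hj]

theorem IsLocalBasis.exists_toFun_eq (h : IsLocalBasis s e l φ) (P : Submonoid R)
    [IsLocalization P R'] (v : Fin n → R') :
    ∃ p ∈ P, ∃ u, h.toFun t u = algebraMap R R' p • v := by
  obtain ⟨p, hp⟩ := IsLocalization.exist_integer_multiples_of_finite P v
  choose a ha using hp
  refine ⟨p, p.2, ∑ i, a i • e i, ?_⟩
  ext j
  simp [h.toFun_basis ht, Pi.single_apply, ha, Algebra.smul_def]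

theorem IsLocalBasis.exists_quadraticForm (h : IsLocalBasis s e l φ) (Q : QuadraticMap R M N) :
    ∃ q : QuadraticForm R' (Fin n → R'), ∀ v, q (h.toFun t v) = algebraMap R R' (φ (Q v)) := by
  obtain ⟨q, hq⟩ := exists_quadraticForm_map (R' := R')
    ((φ.compQuadraticMap Q).comp (Fintype.linearCombination R e))
  refine ⟨q, fun v ↦ ?_⟩
  have h₁ : h.toFun t v = t • (algebraMap R R' ∘ h.coord v) := rfl
  rw [h₁, QuadraticMap.map_smul, hq, QuadraticMap.comp_apply, Fintype.linearCombination_apply,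
    h.sum_coord, LinearMap.compQuadraticMap_apply, QuadraticMap.map_smul, map_smul]
  simp only [smul_eq_mul, map_mul]
  linear_combination (algebraMap R R' (φ (Q v))) * (algebraMap R R' s * t + 1) * ht

end

end QuadraticMap

/-! ### The Azumaya property bounds the radical -/

namespace QuadraticMap

open EvenClifford

variable {R R' M N κ : Type*} [CommRing R] [CommRing R'] [Algebra R R'] [AddCommGroup M]
  [Module R M] [AddCommGroup N] [Module R N] [Field κ] [Algebra R κ] {s : R} {n : ℕ} {e : Fin n → M}
  {l : N} {φ : Module.Dual R N} {Q : QuadraticMap R M N}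

theorem exists_smul_eq_one_tmul (hfrac : ∀ t : κ, ∃ a b : R, algebraMap R κ b ≠ 0 ∧
      algebraMap R κ b * t = algebraMap R κ a) (x : κ ⊗[R] M) :
    ∃ (b : R) (u : M), algebraMap R κ b ≠ 0 ∧ algebraMap R κ b • x = 1 ⊗ₜ u := by
  induction x with
  | zero => exact ⟨1, 0, by simp, by simp⟩
  | add x y hx hy =>
    obtain ⟨b, u, hb, hu⟩ := hx
    obtain ⟨c, v, hc, hv⟩ := hy
    refine ⟨b * c, c • u + b • v, by simp [hb, hc], ?_⟩
    rw [map_mul, smul_add, mul_smul, smul_comm, hu, mul_smul, hv, tmul_add, tmul_smul, tmul_smul,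
      algebraMap_smul, algebraMap_smul]
  | tmul t m =>
    obtain ⟨a, b, hb, h⟩ := hfrac t
    refine ⟨b, a • m, hb, ?_⟩
    rw [smul_tmul', smul_eq_mul, h, tmul_smul, smul_tmul', Algebra.algebraMap_eq_smul_one]

theorem polar_eq_zero_of_tmul_mem_ker {u : M}
    (hu : (1 : κ) ⊗ₜ[R] u ∈ LinearMap.ker (Q.polarBilin.baseChange κ)) (ψ : Module.Dual R N)
    (w : M) : algebraMap R κ (ψ (polar Q u w)) = 0 := by
  have h₁ := LinearMap.congr_fun (LinearMap.mem_ker.mp hu) ((1 : κ) ⊗ₜ[R] w)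
  have h₂ := congrArg (LinearMap.liftBaseChange κ (Algebra.linearMap R κ ∘ₗ ψ)) h₁
  simpa using h₂

theorem exists_linearIndependent_pair_of_one_lt_finrank_submodule {V : Type*} [AddCommGroup V]
    [Module κ V] (W : Submodule κ V) (h : 1 < Module.finrank κ W) :
    ∃ x ∈ W, ∃ y ∈ W, LinearIndependent κ ![x, y] := by
  have : Nontrivial W := Module.nontrivial_of_finrank_pos (zero_lt_one.trans h)
  obtain ⟨x, hx⟩ := exists_ne (0 : W)
  obtain ⟨y, hxy⟩ := exists_linearIndependent_pair_of_one_lt_finrank h hx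
  refine ⟨x, x.2, y, y.2, ?_⟩
  rw [LinearIndependent.pair_iff] at hxy ⊢
  exact fun i j hij ↦ hxy i j (Subtype.ext hij)

theorem exists_pair_tmul_mem_ker (hfrac : ∀ t : κ, ∃ a b : R, algebraMap R κ b ≠ 0 ∧
      algebraMap R κ b * t = algebraMap R κ a)
    (hker : 1 < Module.finrank κ (LinearMap.ker (Q.polarBilin.baseChange κ))) :
    ∃ u v : M, (1 : κ) ⊗ₜ[R] u ∈ LinearMap.ker (Q.polarBilin.baseChange κ) ∧
      (1 : κ) ⊗ₜ[R] v ∈ LinearMap.ker (Q.polarBilin.baseChange κ) ∧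
        LinearIndependent κ ![(1 : κ) ⊗ₜ[R] u, (1 : κ) ⊗ₜ[R] v] := by
  obtain ⟨x, hx, y, hy, hxy⟩ := exists_linearIndependent_pair_of_one_lt_finrank_submodule _ hker
  obtain ⟨b, u, hb, hu⟩ := exists_smul_eq_one_tmul hfrac x
  obtain ⟨c, v, hc, hv⟩ := exists_smul_eq_one_tmul hfrac y
  refine ⟨u, v, hu ▸ Submodule.smul_mem _ _ hx, hv ▸ Submodule.smul_mem _ _ hy, ?_⟩
  rw [← hu, ← hv, LinearIndependent.pair_iff]
  intro i j hij
  have := (LinearIndependent.pair_iff.mp hxy) (i * algebraMap R κ b) (j * algebraMap R κ c)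
    (by simpa only [mul_smul, algebraMap_smul] using hij)
  simpa [hb, hc] using this

variable [Algebra R' κ] [IsScalarTower R R' κ] {t : R'}

/-- The coordinates identify the fibre with `κ ^ n`: the induced map is surjective between spaces of
equal dimension. -/
theorem IsLocalBasis.linearIndependent_toFun (h : IsLocalBasis s e l φ)
    (ht : algebraMap R R' s * t = 1) {u v : M}
    (huv : LinearIndependent κ ![(1 : κ) ⊗ₜ[R] u, (1 : κ) ⊗ₜ[R] v]) :
    LinearIndependent κ ![algebraMap R' κ ∘ h.toFun t u, algebraMap R' κ ∘ h.toFun t v] := by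
  have hs : algebraMap R κ s ≠ 0 := fun h₀ ↦ by
    have := congrArg (algebraMap R' κ) ht
    rw [map_mul, ← IsScalarTower.algebraMap_apply, h₀, zero_mul, map_one] at this
    exact zero_ne_one this
  let F : κ ⊗[R] M →ₗ[κ] Fin n → κ := LinearMap.liftBaseChange κ
    (LinearMap.compLeft (IsScalarTower.toAlgHom R R' κ).toLinearMap (Fin n) ∘ₗ h.toFun t)
  have hF (u : M) : F ((1 : κ) ⊗ₜ u) = algebraMap R' κ ∘ h.toFun t u := by
    rw [LinearMap.liftBaseChange_tmul, one_smul]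
    rfl
  have hF' : Function.Surjective F := by
    rw [← LinearMap.range_eq_top, eq_top_iff, ← (Pi.basisFun κ (Fin n)).span_eq, Submodule.span_le]
    rintro _ ⟨i, rfl⟩
    refine ⟨(1 : κ) ⊗ₜ e i, ?_⟩
    rw [hF, h.toFun_basis ht, Pi.basisFun_apply]
    ext j
    simp [Pi.single_apply, apply_ite (algebraMap R' κ)]
  have hfin : Module.finrank κ (κ ⊗[R] M) = Module.finrank κ (Fin n → κ) := by
    rw [h.finrank_eq hs, Module.finrank_fin_fun]
  have : Module.Finite κ (κ ⊗[R] M) := by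
    refine ⟨?_⟩
    rw [← h.span_tmul_eq_top hs (SpannedAt.of_subset_span Submodule.subset_span)]
    exact Submodule.fg_span ((Set.finite_range e).image _)
  have hinj : LinearMap.ker F = ⊥ := LinearMap.ker_eq_bot.mpr
    ((LinearMap.injective_iff_surjective_of_finrank_eq_finrank hfin).mpr hF')
  rw [← hF, ← hF]
  have e : ![F ((1 : κ) ⊗ₜ u), F ((1 : κ) ⊗ₜ v)] = F ∘ ![(1 : κ) ⊗ₜ u, (1 : κ) ⊗ₜ v] := by
    ext i : 1
    fin_cases i <;> rfl
  rw [e]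
  exact huv.map' F hinj

theorem IsLocalBasis.finrank_ker_le_one (h : IsLocalBasis s e l φ) [IsDomain R']
    (P : Submonoid R) [IsLocalization P R'] (hinj : Function.Injective (algebraMap R R'))
    (hsurj : Function.Surjective (algebraMap R' κ)) (h2 : (2 : κ) ≠ 0)
    (ht : algebraMap R R' s * t = 1) (hn : 3 ≤ n)
    (hreg : ∀ u, (∀ w, φ (polar Q u w) = 0) → s • u = 0)
    (Z : Type*) [CommRing Z] [Algebra Z (EvenClifford Q)] [IsAzumaya Z (EvenClifford Q)] :
    Module.finrank κ (LinearMap.ker (Q.polarBilin.baseChange κ)) ≤ 1 := by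
  by_contra! hker
  have hfrac (t : κ) : ∃ a b : R, algebraMap R κ b ≠ 0 ∧
      algebraMap R κ b * t = algebraMap R κ a := by
    obtain ⟨t, rfl⟩ := hsurj t
    obtain ⟨⟨a, b⟩, hab⟩ := IsLocalization.surj P t
    refine ⟨a, b, ?_, ?_⟩
    · rw [IsScalarTower.algebraMap_apply R R' κ]
      exact ((IsLocalization.map_units R' b).map (algebraMap R' κ)).ne_zero
    · rw [IsScalarTower.algebraMap_apply R R' κ, IsScalarTower.algebraMap_apply R R' κ, ← map_mul,
        mul_comm, hab]
  obtain ⟨u, v, hu, hv, huv⟩ := exists_pair_tmul_mem_ker hfrac hker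
  obtain ⟨q, hq⟩ := h.exists_quadraticForm ht Q
  set f := h.toFun t with hf
  have hpol (x y : M) : q.polarBilin (f x) (f y) = algebraMap R R' (φ (polar Q x y)) := by
    simp only [polarBilin_apply_apply, polar, ← map_add f, hq, map_sub]
  have hq₀ (v : Fin n → R') (hv : q.polarBilin v = 0) : v = 0 := by
    obtain ⟨p, hp, u, hu⟩ := h.exists_toFun_eq ht P v
    have hs : s • u = 0 := hreg u fun w ↦ hinj (by
      rw [← hpol, hf, hu, map_smul, hv, map_zero, smul_zero, LinearMap.zero_apply])
    have hfu : f u = 0 := by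
      have := congrArg f hs
      rw [map_smul, map_zero, ← algebraMap_smul R'] at this
      exact (IsUnit.of_mul_eq_one _ ht).smul_eq_zero.mp this
    rw [hf, hu] at hfu
    exact (IsLocalization.map_units R' (⟨p, hp⟩ : P)).smul_eq_zero.mp hfu
  obtain ⟨θ, hθ, hθ'⟩ := CliffordAlgebra.exists_functional hsurj h2 hq₀ hn
    (h.linearIndependent_toFun ht huv)
  -- As `t` is the inverse of `s = φ l`, the functional `φ` is sent to the identity, and `ψ` to
  -- multiplication by `ψ l / s`.
  let d : Module.Dual R N →ₗ[R] Module.Dual R' R' :=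
    { toFun ψ := (t * algebraMap R R' (ψ l)) • LinearMap.id
      map_add' _ _ := by rw [LinearMap.add_apply, map_add, mul_add, add_smul]
      map_smul' r ψ := by
        rw [LinearMap.smul_apply, smul_eq_mul, map_mul, mul_left_comm, mul_smul, algebraMap_smul,
          RingHom.id_apply] }
  have hd (ψ : Module.Dual R N) (v : M) : d ψ (q (f v)) = algebraMap R R' (ψ (Q v)) := by
    have := congrArg (algebraMap R R') (LinearMap.congr_fun (h.dual ψ) (Q v))
    simp only [LinearMap.smul_apply, smul_eq_mul, map_mul] at this
    simp only [d, LinearMap.coe_mk, AddHom.coe_mk, LinearMap.smul_apply, LinearMap.id_apply, hq,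
      smul_eq_mul]
    linear_combination (-t) * this + algebraMap R R' (ψ (Q v)) * ht
  let χ : EvenClifford Q →+* CliffordAlgebra q :=
    (toClifford q : EvenClifford q →+* CliffordAlgebra q).comp (EvenClifford.map f d hd)
  have hχ (x y ψ) : χ (br Q ψ x y) =
      (t * algebraMap R R' (ψ l)) • (CliffordAlgebra.ι q (f x) * CliffordAlgebra.ι q (f y)) := by
    simp [χ, br, EvenClifford.map_ι, toClifford_ι, d]
  have hχφ (x y) : χ (br Q φ x y) = CliffordAlgebra.ι q (f x) * CliffordAlgebra.ι q (f y) := by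
    rw [hχ, h.apply, mul_comm, ht, one_smul]
  let π : EvenClifford Q →+* κ ⊗[R'] CliffordAlgebra q :=
    (Algebra.TensorProduct.includeRight (R := R') (A := κ) (B := CliffordAlgebra q) :
      CliffordAlgebra q →+* κ ⊗[R'] CliffordAlgebra q).comp χ
  -- A vector in the radical anticommutes in the fibre with every vector, since their polar value
  -- vanishes in `κ`.
  have hanti {x : M} (hx : (1 : κ) ⊗ₜ[R] x ∈ LinearMap.ker (Q.polarBilin.baseChange κ)) (y : M) :
      (1 : κ) ⊗ₜ[R'] CliffordAlgebra.ι q (f x) * (1 : κ) ⊗ₜ[R'] CliffordAlgebra.ι q (f y) =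
        -((1 : κ) ⊗ₜ[R'] CliffordAlgebra.ι q (f y) * (1 : κ) ⊗ₜ[R'] CliffordAlgebra.ι q (f x)) := by
    rw [eq_neg_iff_add_eq_zero, Algebra.TensorProduct.tmul_mul_tmul,
      Algebra.TensorProduct.tmul_mul_tmul, ← tmul_add, CliffordAlgebra.ι_mul_ι_add_swap,
      ← polarBilin_apply_apply, hpol, Algebra.algebraMap_eq_smul_one, tmul_smul, smul_tmul',
      ← algebraMap_smul κ, ← IsScalarTower.algebraMap_apply, polar_eq_zero_of_tmul_mem_ker hx,
      zero_smul, zero_tmul]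
  -- Moving `u v` across a product of two vectors costs four signs, so its image commutes with the
  -- whole image of `π`.
  have hπ (b : EvenClifford Q) : π (br Q φ u v) * π b = π b * π (br Q φ u v) := by
    induction b using EvenClifford.induction with
    | algebraMap r => rw [← map_mul, ← map_mul, Algebra.commutes]
    | ι x y ψ =>
      have h₁ : π (br Q φ u v) = (1 : κ) ⊗ₜ[R'] CliffordAlgebra.ι q (f u) *
          (1 : κ) ⊗ₜ[R'] CliffordAlgebra.ι q (f v) := by
        rw [Algebra.TensorProduct.tmul_mul_tmul, one_mul, ← hχφ]
        rfl
      have h₂ : π (br Q ψ x y) = (t * algebraMap R R' (ψ l)) •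
          ((1 : κ) ⊗ₜ[R'] CliffordAlgebra.ι q (f x) *
            (1 : κ) ⊗ₜ[R'] CliffordAlgebra.ι q (f y)) := by
        rw [Algebra.TensorProduct.tmul_mul_tmul, one_mul, ← tmul_smul, ← hχ]
        rfl
      change _ * π (br Q ψ x y) = π (br Q ψ x y) * _
      rw [h₁, h₂, mul_smul_comm, smul_mul_assoc]
      congr 1
      have hu' := hanti hu
      have hv' := hanti hv
      rw [mul_assoc, ← mul_assoc (1 ⊗ₜ CliffordAlgebra.ι q (f v)), hv', neg_mul, mul_assoc,
        hv', mul_neg, mul_neg, mul_neg, neg_neg, ← mul_assoc, hu', neg_mul, mul_assoc,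
        ← mul_assoc (1 ⊗ₜ CliffordAlgebra.ι q (f u)), hu', neg_mul, mul_neg, neg_neg]
      simp only [mul_assoc]
    | mul a b ha hb => rw [map_mul, ← mul_assoc, ha, mul_assoc, hb, mul_assoc]
    | add a b ha hb => rw [map_add, mul_add, add_mul, ha, hb]
  obtain ⟨z, hz⟩ := AzumayaCriterion.exists_algebraMap_eq_of_commute (Z := Z) π _ hπ
  set z' := algebraMap Z (EvenClifford Q) z
  have hz' (b : EvenClifford Q) : b * z' = z' * b := (Algebra.commutes z b).symm
  -- Up to units of `R'`, each vector is the image of one of `M`, so `χ z'` commutes with all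
  -- products of two vectors.
  have hθz : θ (χ z') = 0 := by
    refine hθ _ (involute_toClifford q _) fun a b ↦ ?_
    obtain ⟨p, hp, x, hx⟩ := h.exists_toFun_eq ht P a
    obtain ⟨p', hp', y, hy⟩ := h.exists_toFun_eq ht P b
    have h₁ := congrArg χ (hz' (br Q φ x y))
    rw [map_mul, map_mul, hχφ, hf, hx, hy, map_smul, map_smul, smul_mul_smul_comm, smul_mul_assoc,
      mul_smul_comm] at h₁
    exact ((IsLocalization.map_units R' (⟨p, hp⟩ : P)).mul
      (IsLocalization.map_units R' (⟨p', hp'⟩ : P))).smul_left_cancel.mp h₁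
  -- The reduction of `θ` factors through `π`, and `π` does not distinguish `z'` from `u v`.
  have h₂ := congrArg (LinearMap.liftBaseChange κ (Algebra.linearMap R' κ ∘ₗ θ)) hz
  have h₃ (a : EvenClifford Q) : LinearMap.liftBaseChange κ (Algebra.linearMap R' κ ∘ₗ θ) (π a) =
      algebraMap R' κ (θ (χ a)) := by
    change LinearMap.liftBaseChange κ (Algebra.linearMap R' κ ∘ₗ θ) ((1 : κ) ⊗ₜ χ a) = _
    simp
  rw [h₃, h₃, hθz, map_zero, hχφ] at h₂
  exact hθ' h₂.symm

end QuadraticMap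

/-! ### The converse over the scheme -/

namespace AlgebraicGeometry.Scheme.LineBundleQuadraticForm

open CategoryTheory Opposite TopologicalSpace QuadraticMap QuadraticMap.EvenClifford

variable {S : Scheme.{u}} {n : ℕ} (Q : S.LineBundleQuadraticForm n)

/-- At the generic point `u` lies in the radical, so it vanishes there; its coordinates are
functions on an integral scheme that vanish generically, hence are zero. -/
theorem smul_eq_zero_of_forall_polar_eq_zero [IsIntegral S] (hQ : Q.IsGenericallyRegular)
    {U : S.Opens} (hU : IsAffineOpen U) (hne : (U : Set S).Nonempty) {s : Γ(S, U)}
    {e : Fin n → Γ(Q.E, U)} {l : Γ(Q.L, U)} {φ : Module.Dual Γ(S, U) Γ(Q.L, U)}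
    (h : IsLocalBasis s e l φ) (hs : (S.basicOpen s : Set S).Nonempty) {u : Γ(Q.E, U)}
    (hu : ∀ w, φ (polar (Q.q U) u w) = 0) : s • u = 0 := by
  have hgen {V : S.Opens} (hV : (V : Set S).Nonempty) : genericPoint S ∈ V :=
    ((genericPoint_spec S).mem_open_set_iff V.2).mpr (by simpa using hV)
  have hη := hgen hne
  let := residueAlgebra U (genericPoint S) hη
  have hs' : algebraMap Γ(S, U) (S.residueField (genericPoint S)) s ≠ 0 :=
    (S.evaluation_ne_zero_iff_mem_basicOpen _ hη s).mpr (hgen hs)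
  have h₁ : (1 : S.residueField (genericPoint S)) ⊗ₜ[Γ(S, U)] u ∈
      LinearMap.ker ((Q.q U).polarBilin.baseChange (S.residueField (genericPoint S))) :=
    h.tmul_mem_ker hs' (SpannedAt.of_subset_span Submodule.subset_span)
      fun y _ ↦ by rw [hu, map_zero]
  have h₂ : (1 : S.residueField (genericPoint S)) ⊗ₜ[Γ(S, U)] u = 0 :=
    (hQ U hU hη).1 ((LinearMap.mem_ker.mp h₁).trans (map_zero _).symm)
  have h₃ (i : Fin n) : h.coord u i = 0 := by
    have := congrArg (LinearMap.liftBaseChange (S.residueField (genericPoint S))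
      (Algebra.linearMap Γ(S, U) (S.residueField (genericPoint S)) ∘ₗ LinearMap.proj i ∘ₗ h.coord))
      h₂
    have h₄ : S.evaluation U (genericPoint S) hη (h.coord u i) = 0 := by
      simpa only [LinearMap.liftBaseChange_tmul, one_smul, map_zero] using! this
    rw [evaluation_eq_zero_iff_notMem_basicOpen] at h₄
    rw [← basicOpen_eq_bot_iff, eq_bot_iff]
    exact fun x hx ↦ h₄ (hgen ⟨x, hx⟩)
  rw [← h.sum_coord]
  simp [h₃]

theorem finrank_fibrePolar_le_one [IsIntegral S] (hn : 3 ≤ n) (hQ : Q.IsGenericallyRegular)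
    (h2 : IsUnit (2 : Γ(S, ⊤))) (h : Q.IsAzumayaOverDiscriminantCover) {U : S.Opens}
    (hU : IsAffineOpen U) (x : S) (hx : x ∈ U) :
    Module.finrank (S.residueField x) (LinearMap.ker (Q.fibrePolar U x hx)) ≤ 1 := by
  let := Q.evenCliffordAlgebra ⟨U, hU⟩
  have := h ⟨U, hU⟩
  obtain ⟨s, e, l, φ, hs, hb⟩ := Q.exists_isLocalBasis hU hx
  let := residueAlgebra U x hx
  let : Algebra Γ(S, U) (S.presheaf.stalk x) := (S.presheaf.germ U x hx).hom.toAlgebra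
  let : Algebra (S.presheaf.stalk x) (S.residueField x) := (S.residue x).hom.toAlgebra
  have : IsScalarTower Γ(S, U) (S.presheaf.stalk x) (S.residueField x) :=
    .of_algebraMap_eq fun _ ↦ rfl
  have : IsLocalization (hU.primeIdealOf ⟨x, hx⟩).asIdeal.primeCompl (S.presheaf.stalk x) :=
    hU.isLocalization_stalk ⟨x, hx⟩
  obtain ⟨t, ht⟩ := ((S.mem_basicOpen s x hx).mp hs).exists_right_inv
  have h2' : (2 : S.residueField x) ≠ 0 := by
    have := (h2.map (S.evaluation ⊤ x trivial).hom).ne_zero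
    rwa [map_ofNat] at this
  exact hb.finrank_ker_le_one (R' := S.presheaf.stalk x) (κ := S.residueField x)
    (hU.primeIdealOf ⟨x, hx⟩).asIdeal.primeCompl (germ_injective_of_isIntegral S x hx)
    (S.residue_surjective x) h2' ht hn
    (fun u hu ↦ Q.smul_eq_zero_of_forall_polar_eq_zero hQ hU ⟨x, hx⟩ hb ⟨x, hs⟩ hu)
    Γ(Q.discriminantCover, Q.toBase ⁻¹ᵁ U)

theorem hasSimpleDegeneration_or_of_isAzumaya [IsIntegral S] (hn : Even n)
    (hQ : Q.IsGenericallyRegular) (h2 : IsUnit (2 : Γ(S, ⊤)))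
    (h : Q.IsAzumayaOverDiscriminantCover) : Q.HasSimpleDegeneration ∨ n = 2 := by
  -- Rank `0` is left over below rank `3`; there the fibre itself is zero.
  refine or_iff_not_imp_right.mpr fun hn₂ U hU x hx _ ↦ ?_
  rcases Nat.lt_or_ge n 3 with hn₃ | hn₃
  · obtain rfl : n = 0 := by
      obtain ⟨m, rfl⟩ := hn
      omega
    obtain ⟨s, e, l, φ, hs, hb⟩ := Q.exists_isLocalBasis hU hx
    let := residueAlgebra U x hx
    have hs' : algebraMap Γ(S, U) (S.residueField x) s ≠ 0 :=
      (S.evaluation_ne_zero_iff_mem_basicOpen _ hx s).mpr hs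
    by_contra! hker
    obtain ⟨y, -, z, -, hyz⟩ :=
      exists_linearIndependent_pair_of_one_lt_finrank_submodule _ hker
    have h₁ := hb.span_tmul_eq_top hs' (SpannedAt.of_subset_span Submodule.subset_span)
    rw [Set.range_eq_empty, Set.image_empty, Submodule.span_empty] at h₁
    have hy : y ∈ (⊥ : Submodule (S.residueField x) (S.residueField x ⊗[Γ(S, U)] Γ(Q.E, U))) := by
      rw [h₁]
      trivial
    exact hyz.ne_zero 0 hy
  · exact Q.finrank_fibrePolar_le_one hn₃ hQ h2 h hU x hx

end AlgebraicGeometry.Scheme.LineBundleQuadraticForm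

end

theorem mainTheorem10 {S : Scheme.{u}} [AlgebraicGeometry.IsNoetherian S] [S.IsSeparated]
    [AlgebraicGeometry.IsIntegral S] {n : ℕ} (hn : Even n) (Q : S.LineBundleQuadraticForm n)
    (hQ : Q.IsGenericallyRegular) :
    (Q.HasSimpleDegeneration ∨ n = 2 → Q.IsAzumayaOverDiscriminantCover) ∧
      (IsUnit (2 : Γ(S, ⊤)) →
        (Q.IsAzumayaOverDiscriminantCover ↔ Q.HasSimpleDegeneration ∨ n = 2)) := by
  exact ⟨Q.isAzumayaOverDiscriminantCover hn, fun h2 ↦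
    ⟨Q.hasSimpleDegeneration_or_of_isAzumaya hn hQ h2, Q.isAzumayaOverDiscriminantCover hn⟩⟩
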